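/- Let $p$ be a prime, $S$ a finite $p$-group, and $\mathcal F$ a fusion system on $S$: a category whose objects are the subgroups of $S$, whose morphisms $P\to Q$ are injective group homomorphisms (composed as usual), such that $\mathrm{Hom}_{\mathcal F}(P,Q)$ contains all maps $x\mapsto gxg^{-1}$ with $g\in S$, $gPg^{-1}\le Q$, and such that for every $\varphi\in\mathrm{Hom}_{\mathcal F}(P,Q)$ the isomorphism $P\to\varphi(P)$ and its inverse lie in $\mathcal F$. Call $\mathcal F$ saturated if it satisfies the Broto--Levi--Oliver axioms: (I) every fully $\mathcal F$-normalized $P\le S$ (i.e. $|N_S(P)|\ge|N_S(Q)|$ for all $Q$ that are $\mathcal F$-conjugate to $P$) is fully $\mathcal F$-centralized (i.e. $|C_S(P)|\ge|C_S(Q)|$ for all such $Q$), and $\mathrm{Aut}_S(P)$ is a Sylow $p$-subgroup of $\mathrm{Aut}_{\mathcal F}(P)$; (II) every $\varphi\in\mathrm{Hom}_{\mathcal F}(P,S)$ with $\varphi(P)$ fully $\mathcal F$-centralized extends to a morphism in $\mathrm{Hom}_{\mathcal F}(N_\varphi,S)$, where $N_\varphi=\{x\in N_S(P)\mid \exists y\in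 N_S(\varphi(P))\ \forall u\in P:\ \varphi(xux^{-1})=y\varphi(u)y^{-1}\}$. For finite groups $G,H$ let $A(G,H)$ be the Grothendieck group of isomorphism classes of finite $(G,H)$-bisets (sets with commuting right $G$-action and left $H$-action) with free $H$-action, with composition $A(H,K)\times A(G,H)\to A(G,K)$ induced by $[X]\circ[Y]=[X\times_H Y]$ and augmentation $\epsilon\colon A(G,H)\to\mathbb Z$ induced by $\epsilon([X])=|H\backslash X|$. For $K\le G$ and a homomorphism $\varphi\colon K\to H$ let $[K,\varphi]_G^H\in A(G,H)$ be the class of $(H\times G)/\big((x,ky)\sim(x\varphi(k),y),\ k\in K\big)$. Let $A(G,H)_{(p)}=\mathbb Z_{(p)}\otimes A(G,H)$. An element $\Omega\in A(S,S)_{(p)}$ is a right (resp. left, resp. fully) characteristic element for $\mathcal F$ if (a) $\Omega$ lies in the $\mathbb Z_{(p)}$-span of the elements $[T,\varphi]_S^S$ with $T\le S$ and $\varphi\in\mathrm{Hom}_{\mathcal F}(T,S)$; (b) $\Omega$ is right (resp. left, resp. both right and left) $\mathcal F$-stable: for all $P\le S$ and $\varphi\in\mathrm{Hom}_{\mathcal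 F}(P,S)$, right stability means $\Omega\circ[P,\varphi]_P^S=\Omega\circ[P,\mathrm{incl}]_P^S$ in $A(P,S)_{(p)}$, and left stability means $[\varphi(P),\varphi^{-1}]_S^P\circ\Omega=[P,\mathrm{id}]_S^P\circ\Omega$ in $A(S,P)_{(p)}$; (c) $\epsilon(\Omega)$ is not divisible by $p$ in $\mathbb Z_{(p)}$. Then the following are equivalent: $\mathcal F$ is saturated; $\mathcal F$ has a fully characteristic element; $\mathcal F$ has a right characteristic element; $\mathcal F$ has a left characteristic element. -/

import Mathlib

open scoped TensorProduct

universe u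

/-! ### Fusion systems -/

/-- The conjugation map `c_g : P → Q`, `x ↦ g x g⁻¹`, for `g` in the transporter `N_S(P, Q)`. -/
def conjHom {S : Type u} [Group S] (P Q : Subgroup S) (g : S)
    (hg : ∀ x ∈ P, g * x * g⁻¹ ∈ Q) : P →* Q where
  toFun x := ⟨g * x * g⁻¹, hg x x.2⟩
  map_one' := by ext; simp
  map_mul' x y := by ext; simp [mul_assoc]

/-- The image `φ(P)`, as a subgroup of `S`, of a homomorphism `φ : P → Q` of subgroups of `S`. -/
def imageIn {S : Type u} [Group S] {P Q : Subgroup S} (φ : P →* Q) : Subgroup S :=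
  (Q.subtype.comp φ).range

/-- The isomorphism `P ≃ φ(P)` induced by an injective homomorphism `φ : P → Q`. -/
noncomputable def isoOntoImage {S : Type u} [Group S] {P Q : Subgroup S} (φ : P →* Q)
    (hφ : Function.Injective φ) : P ≃* imageIn φ :=
  MonoidHom.ofInjective (f := Q.subtype.comp φ) (Q.subtype_injective.comp hφ)

/-- A fusion system on a group `S` (in the applications, a finite `p`-group): a category whose
objects are the subgroups of `S`, with injective group homomorphisms as morphisms, and with the
usual composition.  (Identities are conjugations by `1`.) -/
structure FusionSystem (S : Type u) [Group S] where
  /-- The morphism sets `Hom_F(P, Q)`. -/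
  Hom : ∀ P Q : Subgroup S, Set (P →* Q)
  injective : ∀ {P Q : Subgroup S} {φ : P →* Q}, φ ∈ Hom P Q → Function.Injective φ
  conj_mem : ∀ (P Q : Subgroup S) (g : S) (hg : ∀ x ∈ P, g * x * g⁻¹ ∈ Q),
    conjHom P Q g hg ∈ Hom P Q
  iso_mem : ∀ {P Q : Subgroup S} {φ : P →* Q} (hφ : φ ∈ Hom P Q),
    (isoOntoImage φ (injective hφ)).toMonoidHom ∈ Hom P (imageIn φ)
  iso_symm_mem : ∀ {P Q : Subgroup S} {φ : P →* Q} (hφ : φ ∈ Hom P Q),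
    (isoOntoImage φ (injective hφ)).symm.toMonoidHom ∈ Hom (imageIn φ) P
  comp_mem : ∀ {P Q R : Subgroup S} {φ : P →* Q} {ψ : Q →* R},
    φ ∈ Hom P Q → ψ ∈ Hom Q R → ψ.comp φ ∈ Hom P R

namespace FusionSystem

variable {S : Type u} [Group S] (F : FusionSystem S)

/-- `Hom_F(P, S)`, regarded as a set of homomorphisms into the group `S` itself. -/
def HomS (P : Subgroup S) : Set (P →* S) :=
  {φ | ∃ ψ ∈ F.Hom P ⊤, φ = (⊤ : Subgroup S).subtype.comp ψ}

theorem HomS_injective {P : Subgroup S} {φ : P →* S} (hφ : φ ∈ F.HomS P) :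
    Function.Injective φ := by
  obtain ⟨ψ, hψ, rfl⟩ := hφ
  exact (Subgroup.subtype_injective _).comp (F.injective hψ)

/-- `P` and `Q` are `F`-conjugate if some morphism `P → Q` of `F` is an isomorphism. -/
def Conj (P Q : Subgroup S) : Prop :=
  ∃ φ ∈ F.Hom P Q, Function.Bijective φ

/-- `|C_S(P)| ≥ |C_S(Q)|` for all `Q` that are `F`-conjugate to `P`. -/
def FullyCentralized (P : Subgroup S) : Prop :=
  ∀ Q : Subgroup S, F.Conj P Q →
    Nat.card (Subgroup.centralizer (Q : Set S)) ≤ Nat.card (Subgroup.centralizer (P : Set S))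

/-- `|N_S(P)| ≥ |N_S(Q)|` for all `Q` that are `F`-conjugate to `P`. -/
def FullyNormalized (P : Subgroup S) : Prop :=
  ∀ Q : Subgroup S, F.Conj P Q →
    Nat.card (Subgroup.normalizer (Q : Set S)) ≤ Nat.card (Subgroup.normalizer (P : Set S))

/-- The group `Aut_F(P)`. -/
def autF (P : Subgroup S) : Subgroup (MulAut P) where
  carrier := {α | α.toMonoidHom ∈ F.Hom P P}
  mul_mem' {α β} hα hβ := F.comp_mem hβ hα
  one_mem' := by
    have h := F.conj_mem P P 1 (by simp)
    have e : conjHom P P 1 (by simp) = (1 : MulAut P).toMonoidHom := by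
      ext x; simp [conjHom]
    rwa [e] at h
  inv_mem' {α} hα := by
    have hα' : α.toMonoidHom ∈ F.Hom P P := hα
    have hle : ∀ x ∈ P, 1 * x * 1⁻¹ ∈ imageIn α.toMonoidHom := by
      intro x hx
      refine ⟨α.symm ⟨x, hx⟩, ?_⟩
      simp
    have h := F.comp_mem (F.conj_mem P _ 1 hle) (F.iso_symm_mem hα')
    have e : (isoOntoImage α.toMonoidHom (F.injective hα')).symm.toMonoidHom.comp
        (conjHom P (imageIn α.toMonoidHom) 1 hle) = (α⁻¹ : MulAut P).toMonoidHom := by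
      ext x
      congr 1
      change (isoOntoImage α.toMonoidHom (F.injective hα')).symm
        (conjHom P (imageIn α.toMonoidHom) 1 hle x) = α.symm x
      rw [MulEquiv.symm_apply_eq]
      ext
      change 1 * (x : S) * 1⁻¹ = (α (α.symm x) : S)
      simp
    rwa [e] at h

/-- The group `Aut_S(P)` of automorphisms of `P` induced by conjugation in `S`. -/
def autS (P : Subgroup S) : Subgroup (MulAut P) :=
  (P.normalizerMonoidHom).range

/-- The subgroup `N_φ` of `N_S(P)`: all `x ∈ N_S(P)` for which there is a `y ∈ N_S(φ(P))` such
that `φ(x u x⁻¹) = y φ(u) y⁻¹` for all `u ∈ P`. -/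
def extender {P : Subgroup S} (φ : P →* S) : Subgroup S where
  carrier := {x | ∃ hx : x ∈ Subgroup.normalizer (P : Set S),
    ∃ y ∈ Subgroup.normalizer (φ.range : Set S), ∀ u : P,
      φ ⟨x * u * x⁻¹, (Subgroup.mem_normalizer_iff.1 hx u).1 u.2⟩ = y * φ u * y⁻¹}
  one_mem' := ⟨Subgroup.one_mem _, 1, Subgroup.one_mem _, fun u => by simp⟩
  mul_mem' := by
    rintro x x' ⟨hx, y, hy, h⟩ ⟨hx', y', hy', h'⟩
    refine ⟨Subgroup.mul_mem _ hx hx', y * y', Subgroup.mul_mem _ hy hy', fun u => ?_⟩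
    have h1 := h ⟨x' * u * x'⁻¹, (Subgroup.mem_normalizer_iff.1 hx' u).1 u.2⟩
    rw [h' u] at h1
    simpa [mul_assoc] using h1
  inv_mem' := by
    rintro x ⟨hx, y, hy, h⟩
    refine ⟨Subgroup.inv_mem _ hx, y⁻¹, Subgroup.inv_mem _ hy, fun u => ?_⟩
    have h1 := h ⟨x⁻¹ * u * x⁻¹⁻¹,
      (Subgroup.mem_normalizer_iff.1 (Subgroup.inv_mem _ hx) u).1 u.2⟩
    have e : (⟨x * (x⁻¹ * u * x⁻¹⁻¹) * x⁻¹, by simp [mul_assoc]⟩ : P) = u := by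
      ext; simp [mul_assoc]
    simp only [e] at h1
    rw [h1]
    simp [mul_assoc]

theorem le_extender {P : Subgroup S} (φ : P →* S) : P ≤ extender φ := by
  intro x hx
  refine ⟨Subgroup.le_normalizer hx, φ ⟨x, hx⟩, Subgroup.le_normalizer ⟨⟨x, hx⟩, rfl⟩,
    fun u => ?_⟩
  rw [← map_mul, ← map_inv, ← map_mul]
  rfl

/-- Saturation (in the form given by Broto, Levi and Oliver). -/
structure IsSaturated (p : ℕ) : Prop where
  /-- Axiom I -/
  sylow : ∀ P : Subgroup S, F.FullyNormalized P → F.FullyCentralized P ∧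
    ∃ T : Sylow p (F.autF P), (T : Subgroup (F.autF P)) = (autS P).subgroupOf (F.autF P)
  /-- Axiom II -/
  extend : ∀ (P : Subgroup S) (φ : P →* S), φ ∈ F.HomS P → F.FullyCentralized φ.range →
    ∃ ψ ∈ F.HomS (extender φ), ψ.comp (Subgroup.inclusion (le_extender φ)) = φ

end FusionSystem

/-! ### Bisets and the double Burnside modules -/

/-- A finite left-free `(G, H)`-biset: a finite set with commuting right `G`-action and free left
`H`-action. -/
structure Biset (G H : Type u) [Group G] [Group H] where
  carrier : Type u
  [left : MulAction H carrier]
  [right : MulAction Gᵐᵒᵖ carrier]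
  [comm : SMulCommClass H Gᵐᵒᵖ carrier]
  [finite : Finite carrier]
  left_free : ∀ (h : H) (x : carrier), h • x = x → h = 1

attribute [instance] Biset.left Biset.right Biset.comm Biset.finite

namespace Biset

variable {G H K : Type u} [Group G] [Group H] [Group K]

/-- Isomorphism of bisets. -/
structure Iso (X Y : Biset G H) where
  toEquiv : X.carrier ≃ Y.carrier
  map_left : ∀ (h : H) (x : X.carrier), toEquiv (h • x) = h • toEquiv x
  map_right : ∀ (g : Gᵐᵒᵖ) (x : X.carrier), toEquiv (g • x) = g • toEquiv x

instance setoid (G H : Type u) [Group G] [Group H] : Setoid (Biset G H) where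
  r X Y := Nonempty (Iso X Y)
  iseqv :=
    { refl := fun _ => ⟨⟨Equiv.refl _, fun _ _ => rfl, fun _ _ => rfl⟩⟩
      symm := by
        rintro X Y ⟨e⟩
        exact ⟨⟨e.toEquiv.symm, fun h y => by simp [Equiv.symm_apply_eq, e.map_left],
          fun g y => by simp [Equiv.symm_apply_eq, e.map_right]⟩⟩
      trans := by
        rintro X Y Z ⟨e⟩ ⟨f⟩
        exact ⟨⟨e.toEquiv.trans f.toEquiv, fun h x => by simp [e.map_left, f.map_left],
          fun g x => by simp [e.map_right, f.map_right]⟩⟩ }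

/-- The empty biset. -/
def empty (G H : Type u) [Group G] [Group H] : Biset G H where
  carrier := PEmpty
  left := { smul := fun _ x => x, one_smul := fun _ => rfl, mul_smul := fun _ _ _ => rfl }
  right := { smul := fun _ x => x, one_smul := fun _ => rfl, mul_smul := fun _ _ _ => rfl }
  comm := @SMulCommClass.mk _ _ _ (_) (_) fun _ _ x => x.elim
  left_free := fun _ x => x.elim

/-- Disjoint union of bisets. -/
def sum (X Y : Biset G H) : Biset G H where
  carrier := X.carrier ⊕ Y.carrier
  left_free := by
    rintro h (x | y) e
    · exact X.left_free h x (Sum.inl_injective e)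
    · exact Y.left_free h y (Sum.inr_injective e)

/-- The relation `(x, k y) ∼ (x φ(k), y)`, `k ∈ K`, on `H × G`. -/
def basicSetoid (K : Subgroup G) (φ : K →* H) : Setoid (H × G) where
  r a b := ∃ k : K, b.1 = a.1 * φ k ∧ a.2 = k * b.2
  iseqv :=
    { refl := fun a => ⟨1, by simp, by simp⟩
      symm := by
        rintro a b ⟨k, h1, h2⟩
        exact ⟨k⁻¹, by simp [h1], by simp [h2]⟩
      trans := by
        rintro a b c ⟨k, h1, h2⟩ ⟨l, h3, h4⟩
        exact ⟨k * l, by simp [h1, h3, mul_assoc], by simp [h2, h4, mul_assoc]⟩ }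

/-- The `(G, H)`-biset `H ×_{(K, φ)} G` for a subgroup `K ≤ G` and a homomorphism `φ : K → H`. -/
def basic [Finite G] [Finite H] (K : Subgroup G) (φ : K →* H) : Biset G H where
  carrier := Quotient (basicSetoid K φ)
  left :=
    { smul := fun h => Quotient.map (fun a => (h * a.1, a.2)) (by
        rintro a b ⟨k, h1, h2⟩
        exact ⟨k, by simp [h1, mul_assoc], h2⟩)
      one_smul := by
        rintro ⟨a⟩
        exact congrArg (Quotient.mk _) (by simp)
      mul_smul := by
        rintro h h' ⟨a⟩
        exact congrArg (Quotient.mk _) (by simp [mul_assoc]) }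
  right :=
    { smul := fun g => Quotient.map (fun a => (a.1, a.2 * g.unop)) (by
        rintro a b ⟨k, h1, h2⟩
        exact ⟨k, h1, by simp [h2, mul_assoc]⟩)
      one_smul := by
        rintro ⟨a⟩
        exact congrArg (Quotient.mk _) (by simp)
      mul_smul := by
        rintro g g' ⟨a⟩
        exact congrArg (Quotient.mk _) (by simp [mul_assoc]) }
  comm := @SMulCommClass.mk _ _ _ (_) (_) (by rintro h g ⟨a⟩; rfl)
  left_free := by
    rintro h ⟨a⟩ e
    obtain ⟨k, h1, h2⟩ := Quotient.exact e
    have hk : k = 1 := by ext; simpa using h2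
    subst hk
    simpa using h1.symm

/-- The relation `(x h, y) ∼ (x, h y)`, `h ∈ H`, on `X × Y`. -/
def tensorSetoid (X : Biset H K) (Y : Biset G H) : Setoid (X.carrier × Y.carrier) where
  r a b := ∃ h : H, a.1 = MulOpposite.op h • b.1 ∧ b.2 = h • a.2
  iseqv :=
    { refl := fun a => ⟨1, by simp, by simp⟩
      symm := by
        rintro a b ⟨h, h1, h2⟩
        exact ⟨h⁻¹, by simp [h1], by simp [h2]⟩
      trans := by
        rintro a b c ⟨h, h1, h2⟩ ⟨l, h3, h4⟩
        exact ⟨l * h, by simp [h1, h3, mul_smul], by simp [h2, h4, mul_smul]⟩ }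

/-- The `(G, K)`-biset `X ×_H Y`. -/
def tensor (X : Biset H K) (Y : Biset G H) : Biset G K where
  carrier := Quotient (tensorSetoid X Y)
  left :=
    { smul := fun k => Quotient.map (fun a => (k • a.1, a.2)) (by
        rintro a b ⟨h, h1, h2⟩
        exact ⟨h, by simp [h1, smul_comm], h2⟩)
      one_smul := by
        rintro ⟨a⟩
        exact congrArg (Quotient.mk _) (by simp)
      mul_smul := by
        rintro k k' ⟨a⟩
        exact congrArg (Quotient.mk _) (by simp [mul_smul]) }
  right :=
    { smul := fun g => Quotient.map (fun a => (a.1, g • a.2)) (by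
        rintro a b ⟨h, h1, h2⟩
        exact ⟨h, h1, by simp [h2, smul_comm]⟩)
      one_smul := by
        rintro ⟨a⟩
        exact congrArg (Quotient.mk _) (by simp)
      mul_smul := by
        rintro g g' ⟨a⟩
        exact congrArg (Quotient.mk _) (by simp [mul_smul]) }
  comm := @SMulCommClass.mk _ _ _ (_) (_) (by rintro k g ⟨a⟩; rfl)
  left_free := by
    rintro k ⟨a⟩ e
    obtain ⟨h, h1, h2⟩ := Quotient.exact e
    have hh : h = 1 := Y.left_free h a.2 h2.symm
    subst hh
    exact X.left_free k a.1 (by simpa using h1)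

theorem sum_congr {X X' Y Y' : Biset G H} (h : X ≈ X') (h' : Y ≈ Y') :
    X.sum Y ≈ X'.sum Y' := by
  obtain ⟨e⟩ := h
  obtain ⟨f⟩ := h'
  refine ⟨⟨Equiv.sumCongr e.toEquiv f.toEquiv, ?_, ?_⟩⟩
  · rintro h (x | x)
    · exact congrArg Sum.inl (e.map_left h x)
    · exact congrArg Sum.inr (f.map_left h x)
  · rintro h (x | x)
    · exact congrArg Sum.inl (e.map_right h x)
    · exact congrArg Sum.inr (f.map_right h x)

theorem tensor_congr {X X' : Biset H K} {Y Y' : Biset G H} (h : X ≈ X') (h' : Y ≈ Y') :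
    X.tensor Y ≈ X'.tensor Y' := by
  obtain ⟨e⟩ := h
  obtain ⟨f⟩ := h'
  refine ⟨⟨Quotient.congr (Equiv.prodCongr e.toEquiv f.toEquiv) ?_, ?_, ?_⟩⟩
  · rintro ⟨x, y⟩ ⟨x', y'⟩
    refine exists_congr fun h => and_congr ?_ ?_
    · change x = _ ↔ e.toEquiv x = _ • e.toEquiv x'
      rw [← e.map_right, e.toEquiv.apply_eq_iff_eq]
    · change y' = _ ↔ f.toEquiv y' = _ • f.toEquiv y
      rw [← f.map_left, f.toEquiv.apply_eq_iff_eq]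
  · rintro k ⟨a⟩
    exact congrArg (Quotient.mk _) (Prod.ext (e.map_left k a.1) rfl)
  · rintro g ⟨a⟩
    exact congrArg (Quotient.mk _) (Prod.ext rfl (f.map_right g a.2))

/-- The number `|H \ X|` of left orbits of a `(G, H)`-biset `X`. -/
noncomputable def numOrbits (X : Biset G H) : ℕ :=
  Nat.card (MulAction.orbitRel.Quotient H X.carrier)

theorem numOrbits_congr {X Y : Biset G H} (h : X ≈ Y) : X.numOrbits = Y.numOrbits := by
  obtain ⟨e⟩ := h
  refine Nat.card_congr (Quotient.congr e.toEquiv fun a b => ?_)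
  change (∃ h : H, h • b = a) ↔ ∃ h : H, h • e.toEquiv b = e.toEquiv a
  refine exists_congr fun h => ?_
  rw [← e.map_left, e.toEquiv.apply_eq_iff_eq]

end Biset

/-- Isomorphism classes of finite left-free `(G, H)`-bisets. -/
def BisetClass (G H : Type u) [Group G] [Group H] : Type (u + 1) :=
  Quotient (Biset.setoid G H)

namespace BisetClass

variable {G H K : Type u} [Group G] [Group H] [Group K]

/-- The isomorphism class of a biset. -/
def mk (X : Biset G H) : BisetClass G H :=
  Quotient.mk (Biset.setoid G H) X

/-- Addition of isomorphism classes is disjoint union. -/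
instance : Add (BisetClass G H) where
  add := Quotient.map₂ Biset.sum fun _ _ h _ _ h' => Biset.sum_congr h h'

/-- The zero element is the class of the empty biset. -/
instance : Zero (BisetClass G H) where
  zero := mk (Biset.empty G H)

/-- The isomorphism classes form a commutative monoid under disjoint union. -/
instance : AddCommMonoid (BisetClass G H) where
  add_assoc := by
    rintro ⟨X⟩ ⟨Y⟩ ⟨Z⟩
    refine Quotient.sound ⟨⟨Equiv.sumAssoc _ _ _, ?_, ?_⟩⟩ <;>
    · rintro h ((x | x) | x) <;> rfl
  zero_add := by
    rintro ⟨X⟩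
    refine Quotient.sound ⟨⟨Equiv.emptySum PEmpty _, ?_, ?_⟩⟩ <;>
    · rintro h (x | x)
      · exact x.elim
      · rfl
  add_zero := by
    rintro ⟨X⟩
    refine Quotient.sound ⟨⟨Equiv.sumEmpty _ PEmpty, ?_, ?_⟩⟩ <;>
    · rintro h (x | x)
      · rfl
      · exact x.elim
  add_comm := by
    rintro ⟨X⟩ ⟨Y⟩
    refine Quotient.sound ⟨⟨Equiv.sumComm _ _, ?_, ?_⟩⟩ <;>
    · rintro h (x | x) <;> rfl
  nsmul := nsmulRec

/-- The class `[X ×_H Y]` of classes `[X]` and `[Y]`. -/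
def comp (a : BisetClass H K) (b : BisetClass G H) : BisetClass G K :=
  Quotient.map₂ Biset.tensor (fun _ _ h _ _ h' => Biset.tensor_congr h h') a b

theorem zero_comp (b : BisetClass G H) : (0 : BisetClass H K).comp b = 0 := by
  obtain ⟨Y⟩ := b
  have : IsEmpty ((Biset.empty H K).tensor Y).carrier := ⟨by rintro ⟨a⟩; exact a.1.elim⟩
  exact Quotient.sound ⟨⟨Equiv.equivPEmpty _, fun _ x => isEmptyElim x,
    fun _ x => isEmptyElim x⟩⟩

theorem comp_zero (a : BisetClass H K) : a.comp (0 : BisetClass G H) = 0 := by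
  obtain ⟨X⟩ := a
  have : IsEmpty (X.tensor (Biset.empty G H)).carrier := ⟨by rintro ⟨a⟩; exact a.2.elim⟩
  exact Quotient.sound ⟨⟨Equiv.equivPEmpty _, fun _ x => isEmptyElim x,
    fun _ x => isEmptyElim x⟩⟩

theorem add_comp (a a' : BisetClass H K) (b : BisetClass G H) :
    (a + a').comp b = a.comp b + a'.comp b := by
  obtain ⟨X⟩ := a
  obtain ⟨X'⟩ := a'
  obtain ⟨Y⟩ := b
  refine Quotient.sound ⟨⟨⟨
    Quotient.lift (fun z : (X.carrier ⊕ X'.carrier) × Y.carrier =>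
      z.1.elim (fun x => Sum.inl (Quotient.mk (X.tensorSetoid Y) (x, z.2)))
        (fun x => Sum.inr (Quotient.mk (X'.tensorSetoid Y) (x, z.2)))) ?_,
    Sum.elim
      (Quotient.map (fun z => (Sum.inl z.1, z.2)) ?_)
      (Quotient.map (fun z => (Sum.inr z.1, z.2)) ?_), ?_, ?_⟩, ?_, ?_⟩⟩
  · rintro ⟨x | x, y⟩ ⟨x' | x', y'⟩ ⟨h, h1, h2⟩
    · exact congrArg Sum.inl (Quotient.sound ⟨h, Sum.inl_injective h1, h2⟩)
    · exact (Sum.inl_ne_inr h1).elim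
    · exact (Sum.inr_ne_inl h1).elim
    · exact congrArg Sum.inr (Quotient.sound ⟨h, Sum.inr_injective h1, h2⟩)
  · rintro z z' ⟨h, h1, h2⟩
    exact ⟨h, congrArg Sum.inl h1, h2⟩
  · rintro z z' ⟨h, h1, h2⟩
    exact ⟨h, congrArg Sum.inr h1, h2⟩
  · rintro ⟨x | x, y⟩ <;> rfl
  · rintro (⟨x, y⟩ | ⟨x, y⟩) <;> rfl
  · rintro h ⟨x | x, y⟩ <;> rfl
  · rintro h ⟨x | x, y⟩ <;> rfl

theorem comp_add (a : BisetClass H K) (b b' : BisetClass G H) :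
    a.comp (b + b') = a.comp b + a.comp b' := by
  obtain ⟨X⟩ := a
  obtain ⟨Y⟩ := b
  obtain ⟨Y'⟩ := b'
  refine Quotient.sound ⟨⟨⟨
    Quotient.lift (fun z : X.carrier × (Y.carrier ⊕ Y'.carrier) =>
      z.2.elim (fun y => Sum.inl (Quotient.mk (X.tensorSetoid Y) (z.1, y)))
        (fun y => Sum.inr (Quotient.mk (X.tensorSetoid Y') (z.1, y)))) ?_,
    Sum.elim
      (Quotient.map (fun z => (z.1, Sum.inl z.2)) ?_)
      (Quotient.map (fun z => (z.1, Sum.inr z.2)) ?_), ?_, ?_⟩, ?_, ?_⟩⟩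
  · rintro ⟨x, y | y⟩ ⟨x', y' | y'⟩ ⟨h, h1, h2⟩
    · exact congrArg Sum.inl (Quotient.sound ⟨h, h1, Sum.inl_injective h2⟩)
    · exact (Sum.inr_ne_inl h2).elim
    · exact (Sum.inl_ne_inr h2).elim
    · exact congrArg Sum.inr (Quotient.sound ⟨h, h1, Sum.inr_injective h2⟩)
  · rintro z z' ⟨h, h1, h2⟩
    exact ⟨h, h1, congrArg Sum.inl h2⟩
  · rintro z z' ⟨h, h1, h2⟩
    exact ⟨h, h1, congrArg Sum.inr h2⟩
  · rintro ⟨x, y | y⟩ <;> rfl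
  · rintro (⟨x, y⟩ | ⟨x, y⟩) <;> rfl
  · rintro h ⟨x, y | y⟩ <;> rfl
  · rintro h ⟨x, y | y⟩ <;> rfl

/-- The number of left orbits, as an additive function of the isomorphism class. -/
noncomputable def numOrbits : BisetClass G H →+ ℕ where
  toFun := Quotient.lift Biset.numOrbits fun _ _ => Biset.numOrbits_congr
  map_zero' := by
    have : IsEmpty (MulAction.orbitRel.Quotient H (Biset.empty G H).carrier) :=
      ⟨by rintro ⟨a⟩; exact a.elim⟩
    exact Nat.card_of_isEmpty
  map_add' := by
    rintro ⟨X⟩ ⟨Y⟩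
    have hX : Finite (MulAction.orbitRel.Quotient H X.carrier) := Quotient.finite _
    have hY : Finite (MulAction.orbitRel.Quotient H Y.carrier) := Quotient.finite _
    refine Eq.trans (Nat.card_congr ⟨
      Quotient.lift (fun z : X.carrier ⊕ Y.carrier =>
        Sum.map (Quotient.mk (MulAction.orbitRel H X.carrier))
          (Quotient.mk (MulAction.orbitRel H Y.carrier)) z) ?_,
      Sum.elim (Quotient.map Sum.inl ?_) (Quotient.map Sum.inr ?_), ?_, ?_⟩)
      (Nat.card_sum (α := MulAction.orbitRel.Quotient H X.carrier)
        (β := MulAction.orbitRel.Quotient H Y.carrier))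
    · rintro (x | x) (y | y) ⟨h, e⟩
      · exact congrArg Sum.inl (Quotient.sound ⟨h, Sum.inl_injective e⟩)
      · exact (Sum.inr_ne_inl e).elim
      · exact (Sum.inl_ne_inr e).elim
      · exact congrArg Sum.inr (Quotient.sound ⟨h, Sum.inr_injective e⟩)
    · rintro x y ⟨h, e⟩
      exact ⟨h, congrArg Sum.inl e⟩
    · rintro x y ⟨h, e⟩
      exact ⟨h, congrArg Sum.inr e⟩
    · rintro ⟨x | x⟩ <;> rfl
    · rintro (x | x) <;> exact Quotient.inductionOn x fun _ => rfl

end BisetClass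

/-- The Burnside module `A(G, H)`: the Grothendieck group of isomorphism classes of finite
left-free `(G, H)`-bisets. -/
abbrev BurnsideModule (G H : Type u) [Group G] [Group H] : Type (u + 1) :=
  Algebra.GrothendieckAddGroup (BisetClass G H)

/-- The ring `ℤ_(p)` of rational numbers with denominator prime to `p`. -/
def ZLoc (p : ℕ) [hp : Fact p.Prime] : Subring ℚ where
  carrier := {q | ¬ p ∣ q.den}
  mul_mem' {a b} ha hb h :=
    (hp.out.dvd_mul.1 (h.trans (Rat.mul_den_dvd a b))).elim ha hb
  one_mem' := by simpa using hp.out.one_lt.ne'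
  add_mem' {a b} ha hb h :=
    (hp.out.dvd_mul.1 (h.trans (Rat.add_den_dvd a b))).elim ha hb
  zero_mem' := by simpa using hp.out.one_lt.ne'
  neg_mem' {a} ha := by simpa using ha

/-- The `p`-localized Burnside module `A(G, H)_(p)`. -/
abbrev BurnsideLoc (p : ℕ) [Fact p.Prime] (G H : Type u) [Group G] [Group H] : Type (u + 1) :=
  ZLoc p ⊗[ℤ] BurnsideModule G H

namespace Burnside

variable {G H K : Type u} [Group G] [Group H] [Group K]

theorem lift_of {M A : Type*} [AddCommMonoid M] [AddCommGroup A] (f : M →+ A) (x : M) :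
    Algebra.GrothendieckAddGroup.lift f (Algebra.GrothendieckAddGroup.of x) = f x :=
  DFunLike.congr_fun (Algebra.GrothendieckAddGroup.lift.symm_apply_apply f) x

/-- The composition pairing `A(H, K) × A(G, H) → A(G, K)`, the biadditive extension of
`([X], [Y]) ↦ [X ×_H Y]`. -/
noncomputable def compInt : BurnsideModule H K →+ BurnsideModule G H →+ BurnsideModule G K :=
  Algebra.GrothendieckAddGroup.lift
    { toFun := fun a => Algebra.GrothendieckAddGroup.lift
        { toFun := fun b => Algebra.GrothendieckAddGroup.of (a.comp b)
          map_zero' := by rw [BisetClass.comp_zero, map_zero]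
          map_add' := fun b b' => by rw [BisetClass.comp_add, map_add] }
      map_zero' := by
        apply Algebra.GrothendieckAddGroup.lift.symm.injective
        rw [Equiv.symm_apply_apply]
        ext b
        simp [BisetClass.zero_comp]
      map_add' := fun a a' => by
        apply Algebra.GrothendieckAddGroup.lift.symm.injective
        rw [Equiv.symm_apply_apply]
        ext b
        change Algebra.GrothendieckAddGroup.of ((a + a').comp b) =
          Algebra.GrothendieckAddGroup.lift _ (Algebra.GrothendieckAddGroup.of b) +
            Algebra.GrothendieckAddGroup.lift _ (Algebra.GrothendieckAddGroup.of b)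
        rw [lift_of, lift_of, BisetClass.add_comp, map_add]
        rfl }

/-- The augmentation `A(G, H) → ℤ`, the additive extension of `[X] ↦ |H \ X|`. -/
noncomputable def augInt : BurnsideModule G H →+ ℤ :=
  Algebra.GrothendieckAddGroup.lift ((Nat.castAddMonoidHom ℤ).comp BisetClass.numOrbits)

variable (p : ℕ) [Fact p.Prime]

/-- The composition pairing `A(H, K)_(p) × A(G, H)_(p) → A(G, K)_(p)`. -/
noncomputable def comp (x : BurnsideLoc p H K) (y : BurnsideLoc p G H) : BurnsideLoc p G K :=
  TensorProduct.map₂ (LinearMap.mul ℤ (ZLoc p))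
    (AddMonoidHom.toIntLinearMap
      { toFun := fun a => (compInt (G := G) (H := H) (K := K) a).toIntLinearMap
        map_zero' := by ext; simp
        map_add' := fun a b => by ext; simp }) x y

/-- The augmentation `A(G, H)_(p) → ℤ_(p)`. -/
noncomputable def aug : BurnsideLoc p G H →ₗ[ZLoc p] ZLoc p :=
  (TensorProduct.AlgebraTensorModule.rid ℤ (ZLoc p) (ZLoc p)).toLinearMap ∘ₗ
    (augInt (G := G) (H := H)).toIntLinearMap.baseChange (ZLoc p)

/-- The basis element `[K, φ]` of `A(G, H)_(p)`, for `K ≤ G` and `φ : K → H`. -/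
noncomputable def basis [Finite G] [Finite H] (K : Subgroup G) (φ : K →* H) :
    BurnsideLoc p G H :=
  1 ⊗ₜ[ℤ] Algebra.GrothendieckAddGroup.of (BisetClass.mk (Biset.basic K φ))

/-- The element `[G, φ]` of `A(G, H)_(p)` given by a homomorphism `φ : G → H`. -/
noncomputable def ofHom [Finite G] [Finite H] (φ : G →* H) : BurnsideLoc p G H :=
  basis p ⊤ (φ.comp (⊤ : Subgroup G).subtype)

end Burnside

/-! ### Characteristic elements -/

namespace FusionSystem

variable {S : Type u} [Group S] [Finite S] (F : FusionSystem S) (p : ℕ) [Fact p.Prime]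

/-- `Ω` lies in the submodule of `A(S, S)_(p)` generated by the `[T, φ]` with `T ≤ S` and
`φ ∈ Hom_F(T, S)`. -/
def IsGenerated (Ω : BurnsideLoc p S S) : Prop :=
  Ω ∈ Submodule.span (ZLoc p)
    {x | ∃ (T : Subgroup S) (φ : T →* S), φ ∈ F.HomS T ∧ x = Burnside.basis p T φ}

/-- `Ω ∘ [P, φ] = Ω ∘ [P, incl]` in `A(P, S)_(p)` for all `P ≤ S` and `φ ∈ Hom_F(P, S)`. -/
def RightStable (Ω : BurnsideLoc p S S) : Prop :=
  ∀ (P : Subgroup S) (φ : P →* S), φ ∈ F.HomS P →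
    Burnside.comp p Ω (Burnside.ofHom p φ) = Burnside.comp p Ω (Burnside.ofHom p P.subtype)

/-- `[φ(P), φ⁻¹] ∘ Ω = [P, id] ∘ Ω` in `A(S, P)_(p)` for all `P ≤ S` and `φ ∈ Hom_F(P, S)`. -/
def LeftStable (Ω : BurnsideLoc p S S) : Prop :=
  ∀ (P : Subgroup S) (φ : P →* S) (hφ : φ ∈ F.HomS P),
    Burnside.comp p (Burnside.basis p φ.range
        (MonoidHom.ofInjective (F.HomS_injective hφ)).symm.toMonoidHom) Ω =
      Burnside.comp p (Burnside.basis p P (MonoidHom.id P)) Ω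

/-- Right characteristic elements. -/
structure IsRightCharacteristic (Ω : BurnsideLoc p S S) : Prop where
  generated : F.IsGenerated p Ω
  stable : F.RightStable p Ω
  aug_prime : ¬ (p : ZLoc p) ∣ Burnside.aug p Ω

/-- Left characteristic elements. -/
structure IsLeftCharacteristic (Ω : BurnsideLoc p S S) : Prop where
  generated : F.IsGenerated p Ω
  stable : F.LeftStable p Ω
  aug_prime : ¬ (p : ZLoc p) ∣ Burnside.aug p Ω

/-- (Fully) characteristic elements. -/
structure IsCharacteristic (Ω : BurnsideLoc p S S) : Prop where
  generated : F.IsGenerated p Ω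
  right_stable : F.RightStable p Ω
  left_stable : F.LeftStable p Ω
  aug_prime : ¬ (p : ZLoc p) ∣ Burnside.aug p Ω

end FusionSystem

/-!
The proof works with marks. A `(G, H)`-biset is an `H × G`-set, and its mark at `Γ ≤ H × G` is the
number of points fixed by `Γ`. By Burnside's theorem a biset is determined by its marks
(`BisetClass.ext_mark`), each mark extends to a linear form on `A(G, H)_(p)`, and composition with
`[P, φ]` or `[φ(P), φ⁻¹]` amounts to restricting one of the two actions. Condition (a) says that `Ω`
is a combination of bisets whose stabilizers are graphs `{(φ(u), u)}` of morphisms of `F`, and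
stability implies that the mark at a graph depends only on the image of `φ` (right stability), or
only on its source (left stability).

*A characteristic element forces saturation.* The normalizer in `S × S` of the graph of `φ : P → S`
meets `S × 1` in `C_S(φ(P)) × 1` and projects onto the extender `N_φ`. It acts on the points fixed
by the graph, so `|C_S(φ(P))|` divides the mark at `φ`, and even `p |C_S(φ(P))|` does if `φ` has no
extension to `N_φ` in `F` (`card_centralizer_mul_dvd_mark`). On the other hand, counting the fixed
points of `Q` on `S \ X` gives `|S| ε(Ω)` modulo `p |S|` as the sum of the marks at the morphisms of
`F` with source `Q`. As `ε(Ω)` is prime to `p`, some `R` in the `F`-conjugacy class of `Q` is fully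
automized and has mark not divisible by `p |C_S(R)|` (`exists_fullyAutomized_not_dvd`). Such an `R`
is receptive, and a fusion system on a finite `p`-group is saturated if every conjugacy class has a
fully automized receptive member (`isSaturated_of_exists_receptive`).

*Saturation gives a characteristic element.* Start with bisets `[S, φ]` for the automorphisms of `S`
in `F`, and add copies of `[P, φ]` in decreasing order of `|P|`, so that the marks at the graphs of
all morphisms `P → S` of `F` with `P` in a given class become equal (`exists_mark_eq`). The mark at
`φ` can be changed only by multiples of the index of its graph in the normalizer, so it has to be
shown that the marks are already congruent to each other modulo this index. This is a Burnside
congruence (`MulAction.index_dvd_card_fixedPoints_sub`), applied to the normalizer of the graph and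
its image under extensions to normalizers provided by the saturation axioms
(`IsSaturated.mark_congr`). The resulting element has equal marks wherever right or left stability
asks for it, so it is fully characteristic, and it is an actual biset. Its augmentation is congruent
to `|Aut_F(S) : Aut_S(S)|` modulo `p`.
-/

open scoped Pointwise

/-! ### Fixed points of finite `G`-sets -/

namespace MulAction

/-- A sum of an invariant function `f` over a finite `N`-set is divisible by `d` as soon as each
orbit contributes a multiple of `d`; the orbit of `x` contributes `|N x| * f x`. -/
theorem dvd_sum_of_dvd_card_orbit_mul {N X R : Type*} [Group N] [MulAction N X] [Fintype X]
    [CommSemiring R] (f : X → R) (hf : ∀ (n : N) x, f (n • x) = f x) (d : R)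
    (h : ∀ x, d ∣ (Nat.card (orbit N x) : R) * f x) : d ∣ ∑ x, f x := by
  classical
  have : Fintype (orbitRel.Quotient N X) := Quotient.fintype _
  rw [← Finset.sum_fiberwise Finset.univ (Quotient.mk (orbitRel N X)) f]
  refine Finset.dvd_sum fun ω _ => ?_
  induction ω using Quotient.inductionOn with
  | h x =>
    convert h x using 1
    have e : ∀ y ∈ Finset.univ.filter (fun y => Quotient.mk (orbitRel N X) y =
        Quotient.mk (orbitRel N X) x), f y = f x := by
      intro y hy
      obtain ⟨n, rfl⟩ := Quotient.exact (Finset.mem_filter.1 hy).2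
      exact hf n x
    rw [Finset.sum_congr rfl e, Finset.sum_const, nsmul_eq_mul]
    congr 2
    rw [← Fintype.card_subtype, ← Nat.card_eq_fintype_card]
    exact Nat.card_congr (Equiv.subtypeEquivRight fun y => Quotient.eq (r := orbitRel N X))

theorem dvd_card_of_dvd_card_orbit {N X : Type*} [Group N] [MulAction N X] [Finite X]
    (A : Set X) (hA : ∀ (n : N), ∀ x ∈ A, n • x ∈ A) (d : ℕ)
    (h : ∀ x ∈ A, d ∣ Nat.card (orbit N x)) : d ∣ Nat.card A := by
  classical
  have := Fintype.ofFinite X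
  have hA' : ∀ (n : N) x, n • x ∈ A ↔ x ∈ A := fun n x =>
    ⟨fun hx => by simpa using hA n⁻¹ _ hx, hA n x⟩
  have := dvd_sum_of_dvd_card_orbit_mul (N := N) (fun x => if x ∈ A then 1 else 0)
    (fun n x => by simp only [hA']) d (fun x => by
      by_cases hx : x ∈ A
      · simpa [hx] using h x hx
      · simp [hx])
  rw [Finset.sum_boole] at this
  rwa [Nat.card_eq_fintype_card, Fintype.card_subtype]

section Burnside

variable {G X Y : Type*} [Group G] [MulAction G X] [MulAction G Y]

theorem mem_fixedPoints_smul_iff (H : Subgroup G) (g : G) (x : X) :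
    g • x ∈ fixedPoints (MulAut.conj g • H : Subgroup G) X ↔ x ∈ fixedPoints H X := by
  simp only [mem_fixedPoints, Subtype.forall, Subgroup.mk_smul]
  constructor
  · intro h a ha
    have := h (g * a * g⁻¹) (Subgroup.smul_mem_pointwise_smul a (MulAut.conj g) H ha)
    simpa [mul_smul] using this
  · intro h a ha
    obtain ⟨b, hb, rfl⟩ := ha
    have := h b hb
    simp [mul_smul, this]

theorem card_fixedPoints_conj (H : Subgroup G) (g : G) :
    Nat.card (fixedPoints (MulAut.conj g • H : Subgroup G) X) = Nat.card (fixedPoints H X) :=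
  (Nat.card_congr ((MulAction.toPerm g).subtypeEquiv
    fun x => (mem_fixedPoints_smul_iff H g x).symm)).symm

theorem mem_fixedPoints_iff_le_stabilizer (H : Subgroup G) (x : X) :
    x ∈ fixedPoints H X ↔ H ≤ stabilizer G x := by
  simp [SetLike.le_def]

theorem smul_mem_orbit_iff (g : G) (x a : X) : g • x ∈ orbit G a ↔ x ∈ orbit G a := by
  rw [← orbit_eq_iff, orbit_smul, orbit_eq_iff]

theorem ncard_sdiff_orbit_inter_fixedPoints [Finite X] (C : Set X) (c : X) (H : Subgroup G)
    (hC : orbit G c ⊆ C) : ((C \ orbit G c) ∩ fixedPoints H X).ncard =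
      (C ∩ fixedPoints H X).ncard - (orbit G c ∩ fixedPoints H X).ncard := by
  rw [← Set.ncard_sdiff (Set.inter_subset_inter_left _ hC)]
  congr 1
  ext z; simp; tauto

theorem card_fixedPoints_bot : Nat.card (fixedPoints (⊥ : Subgroup G) X) = Nat.card X := by
  have : fixedPoints (⊥ : Subgroup G) X = Set.univ := by ext; simp
  rw [this, Nat.card_univ]

/-- Burnside's theorem for invariant subsets, by induction on the number of points: a point of `A`
with stabilizer of maximal order has the same stabilizer as a suitable point of `B`, and removing
the two orbits preserves the equality of the numbers of fixed points. -/
theorem exists_bijOn_of_ncard_fixedPoints [Finite G] [Finite X] [Finite Y] [Nonempty Y] (n : ℕ) :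
    ∀ (A : Set X) (B : Set Y), A.ncard = n → (∀ (g : G), ∀ x ∈ A, g • x ∈ A) →
      (∀ (g : G), ∀ y ∈ B, g • y ∈ B) →
      (∀ H : Subgroup G, (A ∩ fixedPoints H X).ncard = (B ∩ fixedPoints H Y).ncard) →
      ∃ f : X → Y, Set.BijOn f A B ∧ ∀ (g : G), ∀ x ∈ A, f (g • x) = g • f x := by
  classical
  induction n using Nat.strong_induction_on with
  | _ n ih =>
  intro A B hn hA hB h
  rcases A.eq_empty_or_nonempty with rfl | hne
  · have hB0 : B = ∅ := by
      have := h ⊥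
      have e : fixedPoints (⊥ : Subgroup G) Y = Set.univ := by
        ext y; simp
      rw [e, Set.empty_inter, Set.ncard_empty, Set.inter_univ, eq_comm,
        Set.ncard_eq_zero] at this
      exact this
    subst hB0
    exact ⟨fun _ => Classical.arbitrary Y, Set.bijOn_empty _, fun g x hx => hx.elim⟩
  obtain ⟨a, ha, hmax⟩ := Set.exists_max_image A (fun x => Nat.card (stabilizer G x))
    (Set.toFinite A) hne
  have hpos : ∀ H : Subgroup G,
      (A ∩ fixedPoints H X).Nonempty ↔ (B ∩ fixedPoints H Y).Nonempty := fun H => by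
    rw [← Set.ncard_pos, ← Set.ncard_pos, h H]
  obtain ⟨b, hb, hab⟩ := (hpos (stabilizer G a)).1
    ⟨a, ha, (mem_fixedPoints_iff_le_stabilizer _ _).2 le_rfl⟩
  obtain ⟨a', ha', hba'⟩ := (hpos (stabilizer G b)).2
    ⟨b, hb, (mem_fixedPoints_iff_le_stabilizer _ _).2 le_rfl⟩
  rw [mem_fixedPoints_iff_le_stabilizer] at hab hba'
  have hstab : stabilizer G a = stabilizer G b :=
    Subgroup.eq_of_le_of_card_ge hab
      ((Nat.card_le_card_of_injective _ (Subgroup.inclusion_injective hba')).trans (hmax a' ha'))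
  have hrho : ∀ g g' : G, g • a = g' • a ↔ g • b = g' • b := fun g g' => by
    rw [← inv_smul_eq_iff, ← inv_smul_eq_iff, smul_smul, smul_smul, ← mem_stabilizer_iff,
      ← mem_stabilizer_iff, hstab]
  have hrho' : ∀ (H : Subgroup G) (g : G), g • a ∈ fixedPoints H X ↔ g • b ∈ fixedPoints H Y :=
    fun H g => by
      simp only [mem_fixedPoints, Subtype.forall, Subgroup.mk_smul, smul_smul]
      exact forall₂_congr fun k _ => hrho _ _
  obtain ⟨r, hr⟩ : ∃ r : X → Y, ∀ g : G, r (g • a) = g • b := by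
    refine ⟨fun x => if hx : ∃ g : G, g • a = x then hx.choose • b else b, fun g => ?_⟩
    have hx : ∃ g' : G, g' • a = g • a := ⟨g, rfl⟩
    simp only [dif_pos hx]
    exact (hrho _ _).1 hx.choose_spec
  have hrbij : Set.BijOn r (orbit G a) (orbit G b) := by
    refine ⟨?_, ?_, ?_⟩
    · rintro _ ⟨g, rfl⟩; exact ⟨g, (hr g).symm⟩
    · rintro _ ⟨g, rfl⟩ _ ⟨g', rfl⟩ e
      exact (hrho g g').2 (by simpa [hr] using e)
    · rintro _ ⟨g, rfl⟩; exact ⟨g • a, ⟨g, rfl⟩, hr g⟩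
  have horb : ∀ H : Subgroup G,
      (orbit G a ∩ fixedPoints H X).ncard = (orbit G b ∩ fixedPoints H Y).ncard := fun H => by
    have e : r '' (orbit G a ∩ fixedPoints H X) = orbit G b ∩ fixedPoints H Y := by
      ext y
      constructor
      · rintro ⟨_, ⟨⟨g, rfl⟩, hg⟩, rfl⟩
        exact ⟨⟨g, (hr g).symm⟩, by rw [hr]; exact (hrho' H g).1 hg⟩
      · rintro ⟨⟨g, rfl⟩, hg⟩
        exact ⟨g • a, ⟨⟨g, rfl⟩, (hrho' H g).2 hg⟩, hr g⟩
    rw [← e, (hrbij.2.1.mono Set.inter_subset_left).ncard_image]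
  have hsubA : orbit G a ⊆ A := by rintro _ ⟨g, rfl⟩; exact hA g a ha
  have hsubB : orbit G b ⊆ B := by rintro _ ⟨g, rfl⟩; exact hB g b hb
  obtain ⟨f, hf, hfe⟩ := ih (A \ orbit G a).ncard
    (by rw [← hn]; exact Set.ncard_lt_ncard
          ⟨Set.sdiff_subset, fun hh => (hh ha).2 (mem_orbit_self a)⟩)
    (A \ orbit G a) (B \ orbit G b) rfl
    (fun g x hx => ⟨hA g x hx.1, fun hh => hx.2 ((smul_mem_orbit_iff _ _ _).1 hh)⟩)
    (fun g x hx => ⟨hB g x hx.1, fun hh => hx.2 ((smul_mem_orbit_iff _ _ _).1 hh)⟩)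
    (fun H => by rw [ncard_sdiff_orbit_inter_fixedPoints A a H hsubA,
      ncard_sdiff_orbit_inter_fixedPoints B b H hsubB, h, horb])
  have hF1 : Set.EqOn (fun x => if x ∈ orbit G a then r x else f x) r (orbit G a) :=
    fun x hx => if_pos hx
  have hF2 : Set.EqOn (fun x => if x ∈ orbit G a then r x else f x) f (A \ orbit G a) :=
    fun x hx => if_neg hx.2
  refine ⟨fun x => if x ∈ orbit G a then r x else f x, ?_, ?_⟩
  · have hu := (hrbij.congr hF1.symm).union (hf.congr hF2.symm) ?_
    · rwa [Set.union_sdiff_cancel hsubA, Set.union_sdiff_cancel hsubB] at hu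
    · rw [Set.injOn_union Set.disjoint_sdiff_right]
      refine ⟨(hrbij.congr hF1.symm).injOn, (hf.congr hF2.symm).injOn, fun x hx y hy e => ?_⟩
      have e' : r x = f y := (hF1 hx).symm.trans (e.trans (hF2 hy))
      exact (hf.mapsTo hy).2 (e' ▸ hrbij.mapsTo hx)
  · intro g x hx
    by_cases hxa : x ∈ orbit G a
    · have : g • x ∈ orbit G a := (smul_mem_orbit_iff _ _ _).2 hxa
      simp only [if_pos hxa, if_pos this]
      obtain ⟨g', rfl⟩ := hxa
      change r (g • g' • a) = g • r (g' • a)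
      rw [smul_smul, hr, hr, smul_smul]
    · have : g • x ∉ orbit G a := fun hh => hxa ((smul_mem_orbit_iff _ _ _).1 hh)
      simp only [if_neg hxa, if_neg this]
      exact hfe g x ⟨hx, hxa⟩

/-- Burnside's theorem: finite `G`-sets with the same marks are isomorphic. -/
theorem exists_equiv_of_card_fixedPoints [Finite G] [Finite X] [Finite Y]
    (h : ∀ H : Subgroup G, Nat.card (fixedPoints H X) = Nat.card (fixedPoints H Y)) :
    ∃ e : X ≃ Y, ∀ (g : G) (x : X), e (g • x) = g • e x := by
  have hbot : Nat.card X = Nat.card Y := by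
    rw [← card_fixedPoints_bot (G := G), h, card_fixedPoints_bot]
  rcases isEmpty_or_nonempty Y with hY | hY
  · have : IsEmpty X := by
      rw [Nat.card_of_isEmpty (α := Y)] at hbot
      exact (Nat.card_eq_zero.1 hbot).resolve_right (fun h => not_finite X)
    exact ⟨Equiv.equivOfIsEmpty X Y, fun _ x => isEmptyElim x⟩
  · obtain ⟨f, hf, he⟩ := exists_bijOn_of_ncard_fixedPoints (G := G) _ (Set.univ : Set X)
      (Set.univ : Set Y) rfl (by simp) (by simp) (fun H => by simpa using h H)
    exact ⟨Equiv.ofBijective f (Set.bijOn_univ.1 hf), fun g x => he g x trivial⟩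

end Burnside

/-- A Burnside congruence that compares two homomorphisms `θ₁, θ₂ : N → G`. If the marks at
`θ₁(⟨D, w⟩)` and `θ₂(⟨D, w⟩)` agree for all `w ∉ D`, then those at `θ₁(D)` and `θ₂(D)` agree modulo
`|N : D|`. Indeed `N` acts through each `θᵢ` on the fixed points of `D`, and in the two instances of
Burnside's lemma all terms outside `D` cancel. -/
theorem index_dvd_card_fixedPoints_sub {N G X : Type*} [Group N] [Finite N] [Group G]
    [MulAction G X] [Finite X] (D : Subgroup N) [D.Normal] (θ₁ θ₂ : N →* G)
    (h : ∀ w ∉ D, Nat.card (fixedPoints ((D ⊔ Subgroup.zpowers w).map θ₁) X) =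
      Nat.card (fixedPoints ((D ⊔ Subgroup.zpowers w).map θ₂) X)) :
    (D.index : ℤ) ∣ Nat.card (fixedPoints (D.map θ₁) X) - Nat.card (fixedPoints (D.map θ₂) X) := by
  classical
  have := Fintype.ofFinite N
  -- Burnside's lemma for the action of `N` through `θ` on the fixed points of `D`.
  have key : ∀ θ : N →* G, ∃ k : ℕ, ∑ w : N,
      Nat.card (fixedPoints ((D ⊔ Subgroup.zpowers w).map θ) X) = k * Nat.card N := by
    intro θ
    let : MulAction N X := MulAction.compHom X θ
    have hmem : ∀ (K : Subgroup N) (x : X),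
        x ∈ fixedPoints (K.map θ) X ↔ x ∈ fixedPoints K X := fun K x => by
      simp only [mem_fixedPoints, Subtype.forall, Subgroup.mk_smul]
      constructor
      · exact fun h a ha => h _ ⟨a, ha, rfl⟩
      · rintro h _ ⟨a, ha, rfl⟩; exact h a ha
    let Y := fixedPointsSubMulOfNormal (G := N) (α := X) (H := D)
    have := Fintype.ofFinite (Quotient (orbitRel N Y))
    have (w : N) : Fintype (fixedBy Y w) := Fintype.ofFinite _
    refine ⟨Fintype.card (Quotient (orbitRel N Y)), ?_⟩
    rw [Nat.card_eq_fintype_card, ← sum_card_fixedBy_eq_card_orbits_mul_card_group]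
    refine Finset.sum_congr rfl fun w _ => ?_
    rw [← Nat.card_eq_fintype_card]
    refine Nat.card_congr
      { toFun := fun x => ⟨⟨x.1, ?_⟩, ?_⟩
        invFun := fun y => ⟨y.1.1, ?_⟩
        left_inv := fun _ => rfl
        right_inv := fun _ => rfl }
    · have := (hmem _ _).1 x.2
      rw [mem_fixedPoints_iff_le_stabilizer] at this
      exact (mem_fixedPoints_iff_le_stabilizer D x.1).2 (le_sup_left.trans this)
    · have := (hmem _ _).1 x.2
      rw [mem_fixedPoints_iff_le_stabilizer] at this
      exact Subtype.ext (this (le_sup_right (a := D) (Subgroup.mem_zpowers w)))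
    · rw [hmem, mem_fixedPoints_iff_le_stabilizer, sup_le_iff, Subgroup.zpowers_le]
      exact ⟨(mem_fixedPoints_iff_le_stabilizer D y.1.1).1 y.1.2, congrArg Subtype.val y.2⟩
  obtain ⟨k₁, h₁⟩ := key θ₁
  obtain ⟨k₂, h₂⟩ := key θ₂
  have hD : ∀ θ : N →* G, ∑ w ∈ Finset.univ.filter (· ∈ D),
      Nat.card (fixedPoints ((D ⊔ Subgroup.zpowers w).map θ) X) =
        Nat.card D * Nat.card (fixedPoints (D.map θ) X) := fun θ => by
    rw [Finset.sum_congr rfl (g := fun _ => Nat.card (fixedPoints (D.map θ) X)) ?_,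
      Finset.sum_const, smul_eq_mul, ← Fintype.card_subtype, Nat.card_eq_fintype_card (α := D)]
    intro w hw
    rw [sup_eq_left.2 ((Subgroup.zpowers_le).2 (Finset.mem_filter.1 hw).2)]
  rw [← Finset.sum_filter_add_sum_filter_not Finset.univ (· ∈ D), hD] at h₁ h₂
  rw [Finset.sum_congr rfl fun w hw => h w (Finset.mem_filter.1 hw).2] at h₁
  have hcard := D.card_mul_index
  refine ⟨k₁ - k₂, ?_⟩
  have hpos : (Nat.card D : ℤ) ≠ 0 := by exact_mod_cast Nat.card_pos.ne'
  apply mul_left_cancel₀ hpos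
  rw [← hcard] at h₁ h₂
  zify at h₁ h₂
  linear_combination h₁ - h₂

section Transitive

variable {G X : Type*} [Group G] [MulAction G X] [IsPretransitive G X]

/-- In a transitive `G`-set, the fixed points of the stabilizer `H` of a point form a torsor under
`N_G(H) / H`. -/
theorem card_fixedPoints_stabilizer_mul [Finite G] (x : X) :
    Nat.card (fixedPoints (stabilizer G x) X) * Nat.card (stabilizer G x) =
      Nat.card (Subgroup.normalizer (stabilizer G x : Set G)) := by
  classical
  set N := Subgroup.normalizer (stabilizer G x : Set G) with hN
  have horb : (fixedPoints (stabilizer G x) X) = orbit N x := by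
    ext y
    obtain ⟨g, rfl⟩ := exists_smul_eq G x y
    rw [mem_fixedPoints_iff_le_stabilizer, stabilizer_smul_eq_stabilizer_map_conj]
    constructor
    · intro h
      refine ⟨⟨g, ?_⟩, rfl⟩
      have e := Subgroup.eq_of_le_of_card_ge h
        (Nat.card_congr ((stabilizer G x).equivMapOfInjective _
          (MulAut.conj g).injective).toEquiv).symm.le
      rw [hN, Subgroup.mem_normalizer_iff]
      intro k
      conv_rhs => rw [e]
      simp [Subgroup.mem_map]
    · rintro ⟨⟨n, hn⟩, hnx⟩
      have hnx : n • x = g • x := hnx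
      rw [← stabilizer_smul_eq_stabilizer_map_conj, ← hnx]
      intro k hk
      have := (Subgroup.mem_normalizer_iff.1 (Subgroup.inv_mem _ hn) k).1 hk
      simp only [inv_inv, mem_stabilizer_iff, mul_smul] at this
      rwa [inv_smul_eq_iff] at this
  have := Fintype.ofFinite G
  have := Fintype.ofFinite N
  have hs : Nat.card (stabilizer N x) = Nat.card (stabilizer G x) := by
    have : stabilizer N x = (stabilizer G x).subgroupOf N := by ext; rfl
    rw [this]
    exact Nat.card_congr (Subgroup.subgroupOfEquivOfLe Subgroup.le_normalizer).toEquiv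
  have : Finite (orbit N x) := Set.finite_range _
  have : Fintype (orbit N x) := Fintype.ofFinite _
  rw [horb, ← hs, Nat.card_eq_fintype_card, Nat.card_eq_fintype_card, Nat.card_eq_fintype_card,
    card_orbit_mul_card_stabilizer_eq_card_group]

theorem exists_le_conj_of_card_fixedPoints_ne_zero (H : Subgroup G) (x : X)
    (h : Nat.card (fixedPoints H X) ≠ 0) : ∃ g : G, H ≤ MulAut.conj g • stabilizer G x := by
  obtain ⟨⟨y, hy⟩⟩ := (Nat.card_ne_zero.1 h).1
  obtain ⟨g, rfl⟩ := exists_smul_eq G x y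
  refine ⟨g, ?_⟩
  rw [mem_fixedPoints_iff_le_stabilizer, stabilizer_smul_eq_stabilizer_map_conj] at hy
  exact hy

end Transitive

end MulAction

/-! ### Marks of bisets and of Burnside modules -/

namespace Biset

variable {G H K : Type u} [Group G] [Group H] [Group K]

/-- A `(G, H)`-biset as a set with a left action of `H × G`, namely `(h, g) • x = h x g⁻¹`. -/
instance prodAction (X : Biset G H) : MulAction (H × G) X.carrier where
  smul a x := a.1 • MulOpposite.op a.2⁻¹ • x
  one_smul x := by
    change (1 : H) • MulOpposite.op (1 : G)⁻¹ • x = x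
    simp
  mul_smul a b x := by
    change (a.1 * b.1) • MulOpposite.op (a.2 * b.2)⁻¹ • x =
      a.1 • MulOpposite.op a.2⁻¹ • b.1 • MulOpposite.op b.2⁻¹ • x
    rw [← smul_comm b.1 (MulOpposite.op a.2⁻¹), mul_inv_rev, MulOpposite.op_mul, mul_smul, mul_smul]

theorem prod_smul_def (X : Biset G H) (a : H × G) (x : X.carrier) :
    a • x = a.1 • MulOpposite.op a.2⁻¹ • x :=
  rfl

theorem smul_eq_prod_smul (X : Biset G H) (h : H) (x : X.carrier) :
    h • x = ((h, 1) : H × G) • x := by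
  simp [prod_smul_def]

theorem op_smul_eq_prod_smul (X : Biset G H) (g : Gᵐᵒᵖ) (x : X.carrier) :
    g • x = ((1, g.unop⁻¹) : H × G) • x := by
  simp [prod_smul_def]

theorem equiv_of_card_fixedPoints [Finite G] [Finite H] (X Y : Biset G H)
    (h : ∀ Γ : Subgroup (H × G), Nat.card (MulAction.fixedPoints Γ X.carrier) =
      Nat.card (MulAction.fixedPoints Γ Y.carrier)) : X ≈ Y := by
  obtain ⟨e, he⟩ := MulAction.exists_equiv_of_card_fixedPoints h
  exact ⟨⟨e, fun h x => by simp only [smul_eq_prod_smul, he],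
    fun g x => by simp only [op_smul_eq_prod_smul, he]⟩⟩

/-- The twisted diagonal subgroup `{(φ(u), u) | u ∈ L}` of `H × G`. The source of `φ` is the second
factor, as in the order of the factors of `H × G` in the action on a `(G, H)`-biset. -/
def graph {L : Subgroup G} (φ : L →* H) : Subgroup (H × G) :=
  (φ.prod L.subtype).range

theorem mem_graph {L : Subgroup G} {φ : L →* H} {a : H × G} :
    a ∈ graph φ ↔ ∃ u : L, φ u = a.1 ∧ (u : G) = a.2 := by
  simp [graph, MonoidHom.mem_range, Prod.ext_iff]

theorem mk_mem_graph {L : Subgroup G} {φ : L →* H} {h : H} {g : G} :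
    (h, g) ∈ graph φ ↔ ∃ hg : g ∈ L, φ ⟨g, hg⟩ = h := by
  rw [mem_graph]
  constructor
  · rintro ⟨u, h1, rfl⟩; exact ⟨u.2, h1⟩
  · rintro ⟨hg, e⟩; exact ⟨⟨g, hg⟩, e, rfl⟩

theorem card_graph {L : Subgroup G} (φ : L →* H) : Nat.card (graph φ) = Nat.card L :=
  (Nat.card_congr (MonoidHom.ofInjective (f := φ.prod L.subtype)
    fun _ _ e => Subtype.ext (congrArg Prod.snd e)).toEquiv).symm

theorem map_snd_graph {L : Subgroup G} (φ : L →* H) :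
    (graph φ).map (MonoidHom.snd H G) = L := by
  ext g
  simp only [Subgroup.mem_map, mem_graph]
  constructor
  · rintro ⟨a, ⟨u, -, h⟩, rfl⟩
    rw [MonoidHom.coe_snd, ← h]
    exact u.2
  · exact fun hg => ⟨(φ ⟨g, hg⟩, g), ⟨⟨g, hg⟩, rfl, rfl⟩, rfl⟩

/-- Left freeness: the first coordinate in a stabilizer is determined by the second. -/
theorem fst_eq_of_mem_stabilizer (X : Biset G H) {x : X.carrier} {h h' : H} {g : G}
    (hh : (h, g) ∈ MulAction.stabilizer (H × G) x)
    (hh' : (h', g) ∈ MulAction.stabilizer (H × G) x) : h = h' := by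
  have := Subgroup.mul_mem _ hh (Subgroup.inv_mem _ hh')
  have e : (h, g) * (h', g)⁻¹ = (h * h'⁻¹, (1 : G)) := by simp
  rw [e, MulAction.mem_stabilizer_iff, ← smul_eq_prod_smul] at this
  exact mul_inv_eq_one.1 (X.left_free _ _ this)

/-- The point `[1, 1]` of the biset `H ×_{(L, φ)} G`. -/
def basicPoint [Finite G] [Finite H] (L : Subgroup G) (φ : L →* H) : (basic L φ).carrier :=
  Quotient.mk (basicSetoid L φ) (1, 1)

instance basic_isPretransitive [Finite G] [Finite H] (L : Subgroup G) (φ : L →* H) :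
    MulAction.IsPretransitive (H × G) (basic L φ).carrier := by
  have key : ∀ x : (basic L φ).carrier, ∃ a : H × G,
      a • basicPoint L φ = x := by
    rintro ⟨a⟩
    refine ⟨(a.1, a.2⁻¹), ?_⟩
    change Quotient.mk (basicSetoid L φ) (a.1 * 1, 1 * a.2⁻¹⁻¹) = _
    simp
    rfl
  refine ⟨fun x y => ?_⟩
  obtain ⟨a, rfl⟩ := key x
  obtain ⟨b, rfl⟩ := key y
  exact ⟨b * a⁻¹, by simp [mul_smul]⟩

theorem stabilizer_basic [Finite G] [Finite H] (L : Subgroup G) (φ : L →* H) :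
    MulAction.stabilizer (H × G) (basicPoint L φ) = graph φ := by
  ext ⟨h, g⟩
  rw [MulAction.mem_stabilizer_iff, mk_mem_graph]
  change Quotient.mk (basicSetoid L φ) (h * 1, 1 * g⁻¹) = Quotient.mk (basicSetoid L φ) (1, 1) ↔ _
  rw [Quotient.eq]
  constructor
  · rintro ⟨k, h1, h2⟩
    simp only [mul_one, one_mul] at h1 h2
    have : g = (k⁻¹ : L) := by simp [← h2]
    subst this
    exact ⟨(k⁻¹).2, by
      rw [Subtype.coe_eta, map_inv]
      exact (eq_inv_of_mul_eq_one_left h1.symm).symm⟩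
  · rintro ⟨hg, rfl⟩
    exact ⟨⟨g, hg⟩⁻¹, by simp, by simp⟩

/-- Restriction of the right action of a biset along a homomorphism `φ`. This is composition with
`[G, φ]`, see `tensor_basic_top`. -/
def resRight (X : Biset H K) (φ : G →* H) : Biset G K where
  carrier := X.carrier
  right := MulAction.compHom X.carrier φ.op
  comm := @SMulCommClass.mk _ _ _ (_) (_) fun k g x => smul_comm k (MonoidHom.op φ g) x
  left_free := X.left_free

theorem tensor_basic_top [Finite G] [Finite H] (X : Biset H K) (φ : G →* H) :
    X.tensor (basic ⊤ (φ.comp (⊤ : Subgroup G).subtype)) ≈ X.resRight φ := by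
  have h1 : ∀ (x : X.carrier) (b b' : H × G),
      basicSetoid _ (φ.comp (⊤ : Subgroup G).subtype) b b' →
      MulOpposite.op (b.1 * φ b.2) • x = MulOpposite.op (b'.1 * φ b'.2) • x := by
    rintro x ⟨h, g⟩ ⟨h', g'⟩ ⟨k, h1, h2⟩
    change h' = h * φ k at h1
    change g = k * g' at h2
    subst h1 h2
    change MulOpposite.op (h * φ (k * g')) • x = MulOpposite.op (h * φ k * φ g') • x
    rw [map_mul, mul_assoc]
  let e : (X.tensor (basic ⊤ (φ.comp (⊤ : Subgroup G).subtype))).carrier ≃ X.carrier :=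
    { toFun := Quotient.lift
        (fun a : X.carrier × (basic ⊤ (φ.comp (⊤ : Subgroup G).subtype)).carrier =>
          Quotient.lift (fun b : H × G => MulOpposite.op (b.1 * φ b.2) • a.1) (h1 a.1) a.2) (by
        rintro ⟨x, ⟨b⟩⟩ ⟨x', ⟨b'⟩⟩ ⟨h, h1, h2⟩
        obtain ⟨k, h3, h4⟩ := Quotient.exact h2
        dsimp at h1 h3 h4
        change MulOpposite.op (b.1 * φ b.2) • x = MulOpposite.op (b'.1 * φ b'.2) • x'
        rw [h1, smul_smul, ← MulOpposite.op_mul, h4, ← mul_assoc, h3]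
        simp [mul_assoc])
      invFun := fun x => Quotient.mk _ (x, Quotient.mk (basicSetoid _ _) (1, 1))
      left_inv := by
        rintro ⟨x, ⟨h, g⟩⟩
        refine Quotient.sound ⟨(h * φ g), rfl, ?_⟩
        refine Quotient.sound ⟨⟨g, trivial⟩, ?_, ?_⟩ <;> simp
      right_inv := fun x => by
        change MulOpposite.op ((1 : H) * φ 1) • x = x
        simp }
  refine ⟨⟨e, ?_, ?_⟩⟩
  · rintro k ⟨x, ⟨b⟩⟩
    change MulOpposite.op (b.1 * φ b.2) • k • x = k • MulOpposite.op (b.1 * φ b.2) • x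
    rw [smul_comm k]
  · rintro g ⟨x, ⟨b⟩⟩
    change MulOpposite.op (b.1 * φ (b.2 * g.unop)) • x =
      MulOpposite.op (φ g.unop) • MulOpposite.op (b.1 * φ b.2) • x
    rw [smul_smul, ← MulOpposite.op_mul, map_mul, mul_assoc]

/-- Restriction of the left action of a biset along an injective homomorphism `φ`; injectivity keeps
the action free. This is composition with `[φ(K), φ⁻¹]`, see `basic_tensor`. -/
def resLeft (X : Biset G H) (φ : K →* H) (hφ : Function.Injective φ) : Biset G K where
  carrier := X.carrier
  left := MulAction.compHom X.carrier φ
  comm := @SMulCommClass.mk _ _ _ (_) (_) fun k g x => smul_comm (φ k) g x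
  left_free k x h := hφ ((X.left_free (φ k) x h).trans (map_one φ).symm)

theorem basic_tensor [Finite H] [Finite K] (L : Subgroup H) (e : L ≃* K) (X : Biset G H)
    (φ : K →* H) (hφ : Function.Injective φ) (he : ∀ l : L, φ (e l) = l) :
    (basic L e.toMonoidHom).tensor X ≈ X.resLeft φ hφ := by
  have he' : ∀ k : K, ((e.symm k : L) : H) = φ k := fun k => by rw [← he]; simp
  have h1 : ∀ (x : X.carrier) (b b' : K × H), basicSetoid L e.toMonoidHom b b' →
      (φ b.1 * b.2) • x = (φ b'.1 * b'.2) • x := by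
    rintro x ⟨k, h⟩ ⟨k', h'⟩ ⟨l, h1, h2⟩
    dsimp at h1 h2 ⊢
    rw [h1, h2, map_mul, he, mul_assoc]
  let f : ((basic L e.toMonoidHom).tensor X).carrier ≃ X.carrier :=
    { toFun := Quotient.lift (fun a : (basic L e.toMonoidHom).carrier × X.carrier =>
        Quotient.lift (fun b : K × H => (φ b.1 * b.2) • a.2) (h1 a.2) a.1) (by
        rintro ⟨⟨b⟩, x⟩ ⟨⟨b'⟩, x'⟩ ⟨h, h1, h2⟩
        obtain ⟨l, h3, h4⟩ := Quotient.exact h1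
        dsimp at h2 h3 h4
        change (φ b.1 * b.2) • x = (φ b'.1 * b'.2) • x'
        rw [h2, smul_smul]
        congr 1
        rw [h3, map_mul, he, mul_assoc, mul_assoc, h4])
      invFun := fun x => Quotient.mk _ (Quotient.mk (basicSetoid _ _) (1, 1), x)
      left_inv := by
        rintro ⟨⟨k, h⟩, x⟩
        symm
        refine Quotient.sound ⟨φ k * h, ?_, rfl⟩
        refine Quotient.sound ⟨(e.symm k)⁻¹, ?_, ?_⟩ <;> simp [he']
      right_inv := fun x => by
        change (φ (1 : K) * 1) • x = x
        simp }
  refine ⟨⟨f, ?_, ?_⟩⟩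
  · rintro k ⟨⟨b⟩, x⟩
    change (φ (k * b.1) * b.2) • x = φ k • (φ b.1 * b.2) • x
    rw [smul_smul, map_mul, mul_assoc]
  · rintro g ⟨⟨b⟩, x⟩
    change (φ b.1 * b.2) • g • x = g • (φ b.1 * b.2) • x
    rw [smul_comm]

theorem card_fixedPoints_congr {X Y : Biset G H} (h : X ≈ Y) (Γ : Subgroup (H × G)) :
    Nat.card (MulAction.fixedPoints Γ X.carrier) =
      Nat.card (MulAction.fixedPoints Γ Y.carrier) := by
  obtain ⟨e⟩ := h
  have he : ∀ (a : H × G) x, e.toEquiv (a • x) = a • e.toEquiv x := fun a x => by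
    simp only [prod_smul_def, e.map_left, e.map_right]
  refine Nat.card_congr (e.toEquiv.subtypeEquiv fun x => ?_)
  simp only [MulAction.mem_fixedPoints, Subtype.forall, Subgroup.mk_smul, ← he,
    e.toEquiv.apply_eq_iff_eq]

theorem mem_fixedPoints {X : Biset G H} {Γ : Subgroup (H × G)} {x : X.carrier} :
    x ∈ MulAction.fixedPoints Γ X.carrier ↔
      ∀ a ∈ Γ, a.1 • MulOpposite.op a.2⁻¹ • x = x := by
  simp only [MulAction.mem_fixedPoints, Subtype.forall, Subgroup.mk_smul, prod_smul_def]

theorem fixedPoints_resRight (X : Biset H K) (φ : G →* H) (Γ : Subgroup (K × G)) :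
    MulAction.fixedPoints Γ (X.resRight φ).carrier =
      MulAction.fixedPoints (Γ.map ((MonoidHom.id K).prodMap φ)) X.carrier := by
  ext x
  refine mem_fixedPoints.trans (Iff.trans ?_ mem_fixedPoints.symm)
  constructor
  · rintro h _ ⟨a, ha, rfl⟩
    have := h a ha
    change a.1 • MulOpposite.op (φ a.2⁻¹) • (show X.carrier from x) = x at this
    rwa [map_inv] at this
  · intro h a ha
    have := h _ ⟨a, ha, rfl⟩
    change a.1 • MulOpposite.op (φ a.2⁻¹) • (show X.carrier from x) = x
    rwa [map_inv]

theorem fixedPoints_resLeft (X : Biset G H) (φ : K →* H) (hφ : Function.Injective φ)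
    (Γ : Subgroup (K × G)) : MulAction.fixedPoints Γ (X.resLeft φ hφ).carrier =
      MulAction.fixedPoints (Γ.map (φ.prodMap (MonoidHom.id G))) X.carrier := by
  ext x
  refine mem_fixedPoints.trans (Iff.trans ?_ mem_fixedPoints.symm)
  constructor
  · rintro h _ ⟨a, ha, rfl⟩
    exact h a ha
  · intro h a ha
    exact h _ ⟨a, ha, rfl⟩

theorem card_carrier (X : Biset G H) [Finite H] :
    Nat.card X.carrier = Nat.card H * X.numOrbits := by
  rw [Nat.card_congr (MulAction.selfEquivOrbitsQuotientProd (G := H) (X := X.carrier) fun x => ?_),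
    Nat.card_prod, mul_comm, numOrbits]
  exact (Subgroup.eq_bot_iff_forall _).2 fun h hh => X.left_free h x hh

end Biset

namespace BisetClass

variable {G H K : Type u} [Group G] [Group H] [Group K]

/-- The mark of a class of bisets at a subgroup `Γ ≤ H × G`: the number of fixed points. -/
noncomputable def mark (Γ : Subgroup (H × G)) : BisetClass G H →+ ℕ where
  toFun := Quotient.lift (fun X : Biset G H => Nat.card (MulAction.fixedPoints Γ X.carrier))
    fun _ _ h => Biset.card_fixedPoints_congr h Γ
  map_zero' := by
    have : IsEmpty (MulAction.fixedPoints Γ (Biset.empty G H).carrier) := ⟨fun x => x.1.elim⟩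
    exact Nat.card_of_isEmpty
  map_add' := by
    rintro ⟨X⟩ ⟨Y⟩
    refine Eq.trans (Nat.card_congr ?_) (Nat.card_sum (α := MulAction.fixedPoints Γ X.carrier)
      (β := MulAction.fixedPoints Γ Y.carrier))
    refine (Equiv.subtypeSum (α := X.carrier) (β := Y.carrier)
      (p := fun x => x ∈ MulAction.fixedPoints Γ (X.sum Y).carrier)).trans (Equiv.sumCongr ?_ ?_)
    · exact Equiv.subtypeEquivRight fun x =>
        Biset.mem_fixedPoints.trans (Iff.trans
          (forall₂_congr fun a _ => Sum.inl_injective.eq_iff) Biset.mem_fixedPoints.symm)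
    · exact Equiv.subtypeEquivRight fun x =>
        Biset.mem_fixedPoints.trans (Iff.trans
          (forall₂_congr fun a _ => Sum.inr_injective.eq_iff) Biset.mem_fixedPoints.symm)

theorem mark_mk (Γ : Subgroup (H × G)) (X : Biset G H) :
    mark Γ (mk X) = Nat.card (MulAction.fixedPoints Γ X.carrier) :=
  rfl

/-- A class of bisets is determined by its marks, by Burnside's theorem for `H × G`-sets. -/
theorem ext_mark [Finite G] [Finite H] {x y : BisetClass G H} (h : ∀ Γ, mark Γ x = mark Γ y) :
    x = y := by
  induction x using Quotient.inductionOn with | h X => ?_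
  induction y using Quotient.inductionOn with | h Y => ?_
  exact Quotient.sound (Biset.equiv_of_card_fixedPoints X Y h)

theorem mark_comp_basic_top [Finite G] [Finite H] (x : BisetClass H K) (φ : G →* H)
    (Γ : Subgroup (K × G)) :
    mark Γ (x.comp (mk (Biset.basic ⊤ (φ.comp (⊤ : Subgroup G).subtype)))) =
      mark (Γ.map ((MonoidHom.id K).prodMap φ)) x := by
  induction x using Quotient.inductionOn with | h X => ?_
  refine (Biset.card_fixedPoints_congr (Biset.tensor_basic_top X φ) Γ).trans ?_
  rw [Biset.fixedPoints_resRight]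
  rfl

theorem mark_basic_comp [Finite H] [Finite K] (L : Subgroup H) (e : L ≃* K) (x : BisetClass G H)
    (φ : K →* H) (hφ : Function.Injective φ) (he : ∀ l : L, φ (e l) = l)
    (Γ : Subgroup (K × G)) :
    mark Γ ((mk (Biset.basic L e.toMonoidHom)).comp x) =
      mark (Γ.map (φ.prodMap (MonoidHom.id G))) x := by
  induction x using Quotient.inductionOn with | h X => ?_
  refine (Biset.card_fixedPoints_congr (Biset.basic_tensor L e X φ hφ he) Γ).trans ?_
  rw [Biset.fixedPoints_resLeft]
  rfl

end BisetClass

namespace Burnside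

variable {G H K : Type u} [Group G] [Group H] [Group K] (p : ℕ) [Fact p.Prime]

/-- The `ℤ_(p)`-linear extension to `A(G, H)_(p)` of an additive function of bisets. -/
noncomputable def locMap (f : BisetClass G H →+ ℕ) : BurnsideLoc p G H →ₗ[ZLoc p] ZLoc p :=
  (TensorProduct.AlgebraTensorModule.rid ℤ (ZLoc p) (ZLoc p)).toLinearMap ∘ₗ
    (Algebra.GrothendieckAddGroup.lift
      ((Nat.castAddMonoidHom ℤ).comp f)).toIntLinearMap.baseChange (ZLoc p)

theorem aug_eq_locMap : aug p = locMap p (BisetClass.numOrbits (G := G) (H := H)) :=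
  rfl

theorem locMap_tmul_of (f : BisetClass G H →+ ℕ) (c : ZLoc p) (x : BisetClass G H) :
    locMap p f (c ⊗ₜ Algebra.GrothendieckAddGroup.of x) = f x * c := by
  simp only [locMap, LinearMap.coe_comp, LinearEquiv.coe_coe, Function.comp_apply,
    LinearMap.baseChange_tmul, AddMonoidHom.coe_toIntLinearMap, lift_of]
  simp

theorem comp_tmul_of (c d : ZLoc p) (x : BisetClass H K) (y : BisetClass G H) :
    comp p (c ⊗ₜ Algebra.GrothendieckAddGroup.of x) (d ⊗ₜ Algebra.GrothendieckAddGroup.of y) =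
      (c * d) ⊗ₜ Algebra.GrothendieckAddGroup.of (x.comp y) := by
  simp only [comp, TensorProduct.map₂_apply_tmul]
  refine congrArg₂ (· ⊗ₜ[ℤ] ·) rfl ?_
  change compInt (Algebra.GrothendieckAddGroup.of x) (Algebra.GrothendieckAddGroup.of y) = _
  rw [compInt, lift_of]
  change Algebra.GrothendieckAddGroup.lift _ (Algebra.GrothendieckAddGroup.of y) = _
  rw [lift_of]
  rfl

/-- Additive maps out of `A(G, H)_(p)` are determined by their values on scalar multiples of classes
of bisets. -/
theorem addHom_ext {A : Type*} [AddCommGroup A] {f g : BurnsideLoc p G H →+ A}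
    (h : ∀ (c : ZLoc p) (x : BisetClass G H), f (c ⊗ₜ Algebra.GrothendieckAddGroup.of x) =
      g (c ⊗ₜ Algebra.GrothendieckAddGroup.of x)) : f = g := by
  suffices h' : ∀ c a, f (c ⊗ₜ a) = g (c ⊗ₜ a) by
    ext Ω
    induction Ω using TensorProduct.induction_on with
    | zero => simp
    | tmul c a => exact h' c a
    | add a b ha hb => rw [map_add, map_add, ha, hb]
  intro c a
  have : (f.comp ((TensorProduct.mk ℤ (ZLoc p) (BurnsideModule G H) c).toAddMonoidHom)) =
      (g.comp ((TensorProduct.mk ℤ (ZLoc p) (BurnsideModule G H) c).toAddMonoidHom)) := by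
    apply Algebra.GrothendieckAddGroup.lift.symm.injective
    ext x
    exact h c x
  exact DFunLike.congr_fun this a

/-- An identity between additive functions of bisets that involves composition with a fixed biset on
the right extends to `A(H, K)_(p)`. -/
theorem locMap_comp_right (f : BisetClass G K →+ ℕ) (f' : BisetClass H K →+ ℕ)
    (y : BisetClass G H) (h : ∀ x, f (x.comp y) = f' x) (Ω : BurnsideLoc p H K) :
    locMap p f (comp p Ω (1 ⊗ₜ Algebra.GrothendieckAddGroup.of y)) = locMap p f' Ω := by
  let A : BurnsideLoc p H K →+ ZLoc p :=
    { toFun := fun Ω => locMap p f (comp p Ω (1 ⊗ₜ Algebra.GrothendieckAddGroup.of y))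
      map_zero' := by simp [comp]
      map_add' := fun a b => by simp [comp] }
  have : A = (locMap p f').toAddMonoidHom := addHom_ext p fun c x => by
    change locMap p f (comp p (_ ⊗ₜ _) (_ ⊗ₜ _)) = locMap p f' (_ ⊗ₜ _)
    rw [comp_tmul_of, locMap_tmul_of, locMap_tmul_of, h, mul_one]
  exact DFunLike.congr_fun this Ω

theorem locMap_comp_left (f : BisetClass G K →+ ℕ) (f' : BisetClass G H →+ ℕ)
    (x : BisetClass H K) (h : ∀ y, f (x.comp y) = f' y) (Ω : BurnsideLoc p G H) :
    locMap p f (comp p (1 ⊗ₜ Algebra.GrothendieckAddGroup.of x) Ω) = locMap p f' Ω := by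
  let A : BurnsideLoc p G H →+ ZLoc p :=
    { toFun := fun Ω => locMap p f (comp p (1 ⊗ₜ Algebra.GrothendieckAddGroup.of x) Ω)
      map_zero' := by simp [comp]
      map_add' := fun a b => by simp [comp] }
  have : A = (locMap p f').toAddMonoidHom := addHom_ext p fun c y => by
    change locMap p f (comp p (_ ⊗ₜ _) (_ ⊗ₜ _)) = locMap p f' (_ ⊗ₜ _)
    rw [comp_tmul_of, locMap_tmul_of, locMap_tmul_of, h, one_mul]
  exact DFunLike.congr_fun this Ω

theorem locMap_basis [Finite G] [Finite H] (f : BisetClass G H →+ ℕ) (L : Subgroup G)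
    (φ : L →* H) : locMap p f (basis p L φ) = f (BisetClass.mk (Biset.basic L φ)) := by
  rw [basis, locMap_tmul_of, mul_one]

end Burnside

/-! ### The relation on homomorphisms given by a fusion system -/

namespace FusionSystem

variable {S : Type u} [Group S] (F : FusionSystem S)

theorem inclusion_mem_Hom {P Q : Subgroup S} (h : P ≤ Q) : Subgroup.inclusion h ∈ F.Hom P Q := by
  have := F.conj_mem P Q 1 (fun x hx => by simpa using h hx)
  convert this using 1
  ext x
  simp [conjHom]

theorem mem_Hom_iff {P Q : Subgroup S} {ψ : P →* Q} :
    ψ ∈ F.Hom P Q ↔ Q.subtype.comp ψ ∈ F.HomS P := by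
  constructor
  · intro h
    exact ⟨_, F.comp_mem h (F.inclusion_mem_Hom le_top), rfl⟩
  · rintro ⟨χ, hχ, e⟩
    have hle : imageIn χ ≤ Q := by
      rintro _ ⟨u, rfl⟩
      change (χ u : S) ∈ Q
      have := DFunLike.congr_fun e u
      exact (show ((ψ u : Q) : S) = χ u from this) ▸ (ψ u).2
    have := F.comp_mem (F.iso_mem hχ) (F.inclusion_mem_Hom hle)
    convert this using 1
    ext u
    exact DFunLike.congr_fun e u

theorem mem_HomS_of_eqOn {P Q : Subgroup S} {φ : P →* S} (hφ : φ ∈ F.HomS P) (hQ : Q ≤ P)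
    {χ : Q →* S} (h : ∀ u : Q, χ u = φ ⟨u, hQ u.2⟩) : χ ∈ F.HomS Q := by
  obtain ⟨ψ, hψ, rfl⟩ := hφ
  refine ⟨_, F.comp_mem (F.inclusion_mem_Hom hQ) hψ, ?_⟩
  ext u
  exact h u

/-- Two homomorphisms `a, b : T → S` are related if `b = ψ ∘ a` for a morphism `ψ` of `F` on the
image of `a`. This is an equivalence relation stable under precomposition, and it expresses
membership in `Hom_F`, `Aut_F` and `F`-conjugacy without changing the sources and targets of
morphisms. -/
def Related {T : Type*} [Group T] (a b : T →* S) : Prop :=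
  ∃ ψ ∈ F.HomS a.range, ∀ t, ψ ⟨a t, t, rfl⟩ = b t

variable {F}

theorem range_subtype_comp_toMonoidHom {P R : Subgroup S} (e : P ≃* R) :
    (R.subtype.comp e.toMonoidHom).range = R := by
  rw [MonoidHom.range_comp, MonoidHom.range_eq_top.2 e.surjective, ← MonoidHom.range_eq_map,
    Subgroup.range_subtype]

section Related

variable {T T' : Type*} [Group T] [Group T']

theorem Related.comp {a b : T →* S} (h : F.Related a b) (f : T' →* T) :
    F.Related (a.comp f) (b.comp f) := by
  obtain ⟨ψ, hψ, e⟩ := h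
  have hle : (a.comp f).range ≤ a.range := by rintro _ ⟨t, rfl⟩; exact ⟨f t, rfl⟩
  exact ⟨ψ.comp (Subgroup.inclusion hle), F.mem_HomS_of_eqOn hψ hle fun u => rfl,
    fun t => e (f t)⟩

theorem Related.symm {a b : T →* S} (h : F.Related a b) : F.Related b a := by
  obtain ⟨ψ, ⟨χ, hχ, rfl⟩, e⟩ := h
  have hle : b.range ≤ imageIn χ := by
    rintro _ ⟨t, rfl⟩
    exact ⟨⟨a t, t, rfl⟩, e t⟩
  refine ⟨a.range.subtype.comp ((isoOntoImage χ (F.injective hχ)).symm.toMonoidHom.comp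
    (Subgroup.inclusion hle)), ?_, fun t => ?_⟩
  · exact F.mem_Hom_iff.1 (F.comp_mem (F.inclusion_mem_Hom hle) (F.iso_symm_mem hχ))
  · have : (Subgroup.inclusion hle) ⟨b t, t, rfl⟩ =
        isoOntoImage χ (F.injective hχ) ⟨a t, t, rfl⟩ := Subtype.ext (e t).symm
    change ((isoOntoImage χ (F.injective hχ)).symm
      (Subgroup.inclusion hle ⟨b t, t, rfl⟩) : S) = a t
    rw [this, MulEquiv.symm_apply_apply]

theorem Related.trans {a b c : T →* S} (h : F.Related a b) (h' : F.Related b c) :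
    F.Related a c := by
  obtain ⟨ψ, hψ, e⟩ := h
  obtain ⟨χ, ⟨χ', hχ', rfl⟩, e'⟩ := h'
  have hr : ∀ u, ψ u ∈ b.range := by
    rintro ⟨_, t, rfl⟩
    exact ⟨t, (e t).symm⟩
  have h1 : ψ.codRestrict b.range hr ∈ F.Hom a.range b.range := F.mem_Hom_iff.2 hψ
  refine ⟨_, ⟨_, F.comp_mem h1 hχ', rfl⟩, fun t => ?_⟩
  rw [← e' t]
  change ((χ' (ψ.codRestrict b.range hr ⟨a t, t, rfl⟩) : (⊤ : Subgroup S)) : S) = χ' ⟨b t, t, rfl⟩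
  congr 2
  exact Subtype.ext (e t)

variable (F) in
theorem related_conj (a : T →* S) (g : S) :
    F.Related a ((MulAut.conj g).toMonoidHom.comp a) :=
  ⟨_, ⟨_, F.conj_mem a.range ⊤ g (fun _ _ => trivial), rfl⟩, fun _ => rfl⟩

variable (F) in
theorem related_refl (a : T →* S) : F.Related a a := by
  have := F.related_conj a 1
  rwa [map_one, show (MulEquiv.toMonoidHom (1 : MulAut S)).comp a = a from rfl] at this

theorem Related.map_eq_one_iff {a b : T →* S} (h : F.Related a b) (t : T) :
    a t = 1 ↔ b t = 1 := by
  obtain ⟨ψ, hψ, e⟩ := h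
  rw [← e t, _root_.map_eq_one_iff ψ (F.HomS_injective hψ)]
  exact (Subgroup.mk_eq_one (H := a.range)).symm

theorem mem_HomS_iff {P : Subgroup S} {φ : P →* S} : φ ∈ F.HomS P ↔ F.Related P.subtype φ := by
  have hP : P.subtype.range = P := P.range_subtype
  constructor
  · intro h
    exact ⟨φ.comp (Subgroup.inclusion hP.le), F.mem_HomS_of_eqOn h hP.le fun u => rfl,
      fun t => rfl⟩
  · rintro ⟨ψ, hψ, e⟩
    exact F.mem_HomS_of_eqOn hψ hP.ge fun u => (e u).symm

theorem mem_autF_iff {P : Subgroup S} {α : MulAut P} :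
    α ∈ F.autF P ↔ F.Related P.subtype (P.subtype.comp α.toMonoidHom) := by
  rw [← mem_HomS_iff, ← F.mem_Hom_iff]
  rfl

theorem conj_iff {P Q : Subgroup S} : F.Conj P Q ↔ ∃ φ ∈ F.HomS P, φ.range = Q := by
  constructor
  · rintro ⟨φ, hφ, hb⟩
    refine ⟨_, F.mem_Hom_iff.1 hφ, ?_⟩
    rw [MonoidHom.range_comp, MonoidHom.range_eq_top.2 hb.2, ← MonoidHom.range_eq_map,
      Subgroup.range_subtype]
  · rintro ⟨φ, hφ, rfl⟩
    exact ⟨φ.rangeRestrict, F.mem_Hom_iff.2 hφ,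
      fun x y h => F.HomS_injective hφ (congrArg Subtype.val h), φ.rangeRestrict_surjective⟩

theorem Related.conj {a b : T →* S} (h : F.Related a b) : F.Conj a.range b.range := by
  obtain ⟨ψ, hψ, e⟩ := h
  refine conj_iff.2 ⟨ψ, hψ, ?_⟩
  ext x
  constructor
  · rintro ⟨⟨_, t, rfl⟩, rfl⟩; exact ⟨t, (e t).symm⟩
  · rintro ⟨t, rfl⟩; exact ⟨_, e t⟩

/-- An isomorphism of subgroups of `S` that belongs to `F`. -/
def IsIso (F : FusionSystem S) {P Q : Subgroup S} (e : P ≃* Q) : Prop :=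
  F.Related P.subtype (Q.subtype.comp e.toMonoidHom)

theorem exists_isIso_of_mem_HomS {P Q : Subgroup S} {φ : P →* S} (hφ : φ ∈ F.HomS P)
    (h : φ.range = Q) : ∃ e : P ≃* Q, F.IsIso e ∧ ∀ u, (e u : S) = φ u := by
  refine ⟨(MonoidHom.ofInjective (F.HomS_injective hφ)).trans (MulEquiv.subgroupCongr h), ?_,
    fun _ => rfl⟩
  exact mem_HomS_iff.1 hφ

theorem conj_iff_exists_isIso {P Q : Subgroup S} : F.Conj P Q ↔ ∃ e : P ≃* Q, F.IsIso e := by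
  constructor
  · intro h
    obtain ⟨φ, hφ, h⟩ := conj_iff.1 h
    obtain ⟨e, he, -⟩ := exists_isIso_of_mem_HomS hφ h
    exact ⟨e, he⟩
  · rintro ⟨e, he⟩
    exact conj_iff.2 ⟨_, mem_HomS_iff.2 he, range_subtype_comp_toMonoidHom e⟩

theorem IsIso.symm {P Q : Subgroup S} {e : P ≃* Q} (h : F.IsIso e) : F.IsIso e.symm := by
  have := Related.symm (h.comp e.symm.toMonoidHom)
  have e1 : (Q.subtype.comp e.toMonoidHom).comp e.symm.toMonoidHom = Q.subtype := by ext; simp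
  rwa [e1] at this

theorem IsIso.trans {P Q R : Subgroup S} {e : P ≃* Q} {f : Q ≃* R} (h : F.IsIso e)
    (h' : F.IsIso f) : F.IsIso (e.trans f) :=
  Related.trans h (h'.comp e.toMonoidHom)

theorem isIso_iff_mem_autF {P : Subgroup S} {α : MulAut P} : F.IsIso α ↔ α ∈ F.autF P :=
  mem_autF_iff.symm

variable (F) in
theorem conj_refl (P : Subgroup S) : F.Conj P P :=
  conj_iff_exists_isIso.2 ⟨MulEquiv.refl P, F.related_refl _⟩

theorem Conj.symm {P Q : Subgroup S} (h : F.Conj P Q) : F.Conj Q P := by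
  obtain ⟨e, he⟩ := conj_iff_exists_isIso.1 h
  exact conj_iff_exists_isIso.2 ⟨_, he.symm⟩

theorem Conj.trans {P Q R : Subgroup S} (h : F.Conj P Q) (h' : F.Conj Q R) : F.Conj P R := by
  obtain ⟨e, he⟩ := conj_iff_exists_isIso.1 h
  obtain ⟨f, hf⟩ := conj_iff_exists_isIso.1 h'
  exact conj_iff_exists_isIso.2 ⟨_, he.trans hf⟩

theorem Conj.card_eq {P Q : Subgroup S} (h : F.Conj P Q) : Nat.card P = Nat.card Q := by
  obtain ⟨e, -⟩ := conj_iff_exists_isIso.1 h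
  exact Nat.card_congr e.toEquiv

theorem IsIso.congr_mem_autF_iff {P Q : Subgroup S} {e : P ≃* Q} (h : F.IsIso e) (α : MulAut P) :
    MulAut.congr e α ∈ F.autF Q ↔ α ∈ F.autF P := by
  rw [← isIso_iff_mem_autF, ← isIso_iff_mem_autF]
  constructor
  · intro h'
    have := (h.trans h').trans h.symm
    convert this using 1
    ext u; simp
  · intro h'
    exact (h.symm.trans h').trans h

theorem IsIso.map_autF {P Q : Subgroup S} {e : P ≃* Q} (h : F.IsIso e) :
    (F.autF P).map (MulAut.congr e).toMonoidHom = F.autF Q := by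
  ext α
  rw [Subgroup.mem_map_equiv, ← h.congr_mem_autF_iff, MulEquiv.apply_symm_apply]

theorem Conj.card_autF_eq {P Q : Subgroup S} (h : F.Conj P Q) :
    Nat.card (F.autF P) = Nat.card (F.autF Q) := by
  obtain ⟨e, he⟩ := conj_iff_exists_isIso.1 h
  rw [← he.map_autF]
  exact Nat.card_congr ((F.autF P).equivMapOfInjective _ (MulAut.congr e).injective).toEquiv

end Related

/-! ### Automizers, extenders and a criterion for saturation -/

theorem mem_autS_iff {P : Subgroup S} {α : MulAut P} :
    α ∈ autS P ↔ ∃ x ∈ Subgroup.normalizer (P : Set S), ∀ u : P, (α u : S) = x * u * x⁻¹ := by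
  constructor
  · rintro ⟨x, rfl⟩
    exact ⟨x, x.2, fun u => rfl⟩
  · rintro ⟨x, hx, h⟩
    exact ⟨⟨x, hx⟩, MulEquiv.ext fun u => Subtype.ext (h u).symm⟩

variable (F) in
theorem autS_le_autF (P : Subgroup S) : autS P ≤ F.autF P := by
  intro α hα
  obtain ⟨x, hx, h⟩ := mem_autS_iff.1 hα
  rw [mem_autF_iff]
  convert F.related_conj P.subtype x using 1
  ext u
  exact h u

/-- `|N_S(P)| = |C_S(P)| |Aut_S(P)|`. -/
theorem card_normalizer_eq (P : Subgroup S) :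
    Nat.card (Subgroup.normalizer (P : Set S)) =
      Nat.card (Subgroup.centralizer (P : Set S)) * Nat.card (autS P) := by
  rw [autS, ← Subgroup.index_ker, Subgroup.normalizerMonoidHom_ker,
    ← Subgroup.card_mul_index ((Subgroup.centralizer (P : Set S)).subgroupOf _)]
  congr 1
  exact Nat.card_congr (Subgroup.subgroupOfEquivOfLe
    (Subgroup.centralizer_le_normalizer (P : Set S))).toEquiv

theorem isPGroup_autS {p : ℕ} (hS : IsPGroup p S) (P : Subgroup S) : IsPGroup p (autS P) :=
  IsPGroup.of_surjective (hS.to_subgroup _) P.normalizerMonoidHom.rangeRestrict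
    P.normalizerMonoidHom.rangeRestrict_surjective

variable (F) in
/-- `P` is fully automized: `Aut_S(P)` has index prime to `p` in `Aut_F(P)`. For a finite `p`-group
`S` this says that `Aut_S(P)` is a Sylow `p`-subgroup of `Aut_F(P)`. -/
def FullyAutomized (p : ℕ) (P : Subgroup S) : Prop :=
  ¬ p ∣ (autS P).relIndex (F.autF P)

theorem card_autS_mul_relIndex (P : Subgroup S) :
    Nat.card (autS P) * (autS P).relIndex (F.autF P) = Nat.card (F.autF P) := by
  rw [← Subgroup.card_mul_index ((autS P).subgroupOf (F.autF P)), Subgroup.relIndex]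
  congr 1
  exact (Nat.card_congr (Subgroup.subgroupOfEquivOfLe (F.autS_le_autF P)).toEquiv).symm

theorem fullyAutomized_of_sylow {p : ℕ} [Fact p.Prime] [Finite S] {P : Subgroup S}
    (h : ∃ T : Sylow p (F.autF P), (T : Subgroup (F.autF P)) = (autS P).subgroupOf (F.autF P)) :
    F.FullyAutomized p P := by
  obtain ⟨T, hT⟩ := h
  rw [FullyAutomized, Subgroup.relIndex, ← hT]
  exact T.not_dvd_index

theorem FullyAutomized.exists_sylow {p : ℕ} [Fact p.Prime] (hS : IsPGroup p S) {P : Subgroup S}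
    (h : F.FullyAutomized p P) :
    ∃ T : Sylow p (F.autF P), (T : Subgroup (F.autF P)) = (autS P).subgroupOf (F.autF P) := by
  have h1 : IsPGroup p ((autS P).subgroupOf (F.autF P)) :=
    (isPGroup_autS hS P).comap_of_injective _ (Subgroup.subtype_injective _)
  exact ⟨h1.toSylow h, h1.toSylow_coe h⟩

/-- Any `F`-conjugate `P` of a fully automized `R` has an `F`-isomorphism onto `R` that carries
`Aut_S(P)` into `Aut_S(R)`, by Sylow's theorem in `Aut_F(R)`. -/
theorem FullyAutomized.exists_isIso {p : ℕ} [Fact p.Prime] [Finite S] (hS : IsPGroup p S)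
    {P R : Subgroup S} (hR : F.FullyAutomized p R) (hPR : F.Conj P R) :
    ∃ e : P ≃* R, F.IsIso e ∧ ∀ α ∈ autS P, MulAut.congr e α ∈ autS R := by
  obtain ⟨e, he⟩ := conj_iff_exists_isIso.1 hPR
  obtain ⟨T, hT⟩ := hR.exists_sylow hS
  have hA : IsPGroup p (((autS P).map (MulAut.congr e).toMonoidHom).subgroupOf (F.autF R)) :=
    ((isPGroup_autS hS P).map _).comap_of_injective _ (Subgroup.subtype_injective _)
  obtain ⟨T', hT'⟩ := hA.exists_le_sylow
  obtain ⟨g, rfl⟩ := MulAction.exists_smul_eq (F.autF R) T T'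
  refine ⟨e.trans (g⁻¹ : F.autF R).1, he.trans (isIso_iff_mem_autF.2 (g⁻¹).2), fun α hα => ?_⟩
  have h1 : (⟨MulAut.congr e α, (he.congr_mem_autF_iff α).2 (F.autS_le_autF P hα)⟩ : F.autF R) ∈
      (g • T : Sylow p (F.autF R)) := hT' ⟨α, hα, rfl⟩
  change _ ∈ ((g • T : Sylow p (F.autF R)) : Subgroup (F.autF R)) at h1
  rw [Sylow.coe_subgroup_smul, Subgroup.mem_pointwise_smul_iff_inv_smul_mem, hT] at h1
  have h2 := Subgroup.mem_subgroupOf.1 h1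
  convert h2 using 1
  ext u
  simp [MulAut.conj]

variable (F) in
/-- `R` is receptive: every morphism `φ` of `F` with image `R` extends to a morphism on `N_φ`. -/
def Receptive (R : Subgroup S) : Prop :=
  ∀ (P : Subgroup S) (φ : P →* S), φ ∈ F.HomS P → φ.range = R →
    ∃ ψ ∈ F.HomS (extender φ), ∀ u : P, ψ ⟨u, le_extender φ u.2⟩ = φ u

theorem centralizer_le_extender {P : Subgroup S} (φ : P →* S) :
    Subgroup.centralizer (P : Set S) ≤ extender φ := by
  intro x hx
  refine ⟨Subgroup.centralizer_le_normalizer (P : Set S) hx, 1, Subgroup.one_mem _, fun u => ?_⟩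
  rw [one_mul, inv_one, mul_one]
  congr 1
  ext
  change x * u * x⁻¹ = u
  rw [← Subgroup.mem_centralizer_iff.1 hx u u.2, mul_inv_cancel_right]

theorem map_centralizer_le {P A : Subgroup S} (hPA : P ≤ A) {φ : P →* S} {ψ : A →* S}
    (e : ∀ u : P, ψ ⟨u, hPA u.2⟩ = φ u) :
    ((Subgroup.centralizer (P : Set S)).subgroupOf A).map ψ ≤
      Subgroup.centralizer (φ.range : Set S) := by
  rintro _ ⟨x, hx, rfl⟩
  rw [Subgroup.mem_centralizer_iff]
  rintro _ ⟨u, rfl⟩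
  rw [← e u, ← map_mul, ← map_mul]
  congr 1
  exact Subtype.ext (Subgroup.mem_centralizer_iff.1 hx u u.2)

theorem card_map_centralizer {P A : Subgroup S} (hA : Subgroup.centralizer (P : Set S) ≤ A)
    {ψ : A →* S} (hψ : Function.Injective ψ) :
    Nat.card (((Subgroup.centralizer (P : Set S)).subgroupOf A).map ψ) =
      Nat.card (Subgroup.centralizer (P : Set S)) := by
  rw [← Nat.card_congr (Subgroup.equivMapOfInjective _ ψ hψ).toEquiv]
  exact Nat.card_congr (Subgroup.subgroupOfEquivOfLe hA).toEquiv

/-- An extension `ψ` of `φ` intertwines conjugation by `x` with conjugation by `ψ x`. -/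
theorem conj_apply_of_extends {P A : Subgroup S} (hPA : P ≤ A) {φ : P →* S} {ψ : A →* S}
    (e : ∀ u : P, ψ ⟨u, hPA u.2⟩ = φ u) {x : S} (hx : x ∈ A) (u : P)
    (hu : x * u * x⁻¹ ∈ P) : φ ⟨x * u * x⁻¹, hu⟩ = ψ ⟨x, hx⟩ * φ u * (ψ ⟨x, hx⟩)⁻¹ := by
  rw [← e, ← e, ← map_inv, ← map_mul, ← map_mul]
  rfl

/-- If `e : P ≃ R` carries `Aut_S(P)` into `Aut_S(R)`, then `N_e = N_S(P)`. -/
theorem normalizer_le_extender {P R : Subgroup S} {e : P ≃* R}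
    (he : ∀ α ∈ autS P, MulAut.congr e α ∈ autS R) :
    Subgroup.normalizer (P : Set S) ≤ extender (R.subtype.comp e.toMonoidHom) := by
  intro x hx
  have hr := range_subtype_comp_toMonoidHom e
  obtain ⟨z, hz, h⟩ := mem_autS_iff.1 (he _ (mem_autS_iff.2 ⟨x, hx, fun u => rfl⟩ :
    P.normalizerMonoidHom ⟨x, hx⟩ ∈ autS P))
  refine ⟨hx, z, hr.symm ▸ hz, fun u => ?_⟩
  have := h (e u)
  rw [MulAut.congr_apply, MulEquiv.trans_apply, MulEquiv.trans_apply,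
    MulEquiv.symm_apply_apply] at this
  exact this

theorem Receptive.card_centralizer_le [Finite S] {P R : Subgroup S} (hR : F.Receptive R)
    (h : F.Conj P R) : Nat.card (Subgroup.centralizer (P : Set S)) ≤
      Nat.card (Subgroup.centralizer (R : Set S)) := by
  obtain ⟨φ, hφ, hr⟩ := conj_iff.1 h
  obtain ⟨ψ, hψ, e⟩ := hR P φ hφ hr
  rw [← card_map_centralizer (centralizer_le_extender φ) (F.HomS_injective hψ), ← hr]
  exact Nat.card_le_card_of_injective _
    (Subgroup.inclusion_injective (map_centralizer_le (le_extender φ) e))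

/-- The criterion of Roberts and Shpectorov: `F` is saturated if every `F`-conjugacy class contains
a subgroup `R` that is fully automized and receptive. For the extension axiom, let `φ : P → S` have
fully centralized image, and let `e : φ(P) → R` be an isomorphism that carries `Aut_S(φ(P))` into
`Aut_S(R)`. Both `e` and `e ∘ φ` extend, to `ψ` on `N_S(φ(P))` and `χ` on `N_φ`, and the image of
`χ` lies in that of `ψ`; so `ψ⁻¹ ∘ χ` extends `φ`. -/
theorem isSaturated_of_exists_receptive {p : ℕ} [Fact p.Prime] [Finite S] (hS : IsPGroup p S)
    (h : ∀ P, ∃ R, F.Conj P R ∧ F.FullyAutomized p R ∧ F.Receptive R) : F.IsSaturated p := by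
  constructor
  · intro P hP
    obtain ⟨R, hPR, hRa, hRr⟩ := h P
    have hC := hRr.card_centralizer_le hPR
    have hN := hP R hPR
    obtain ⟨e, he, hea⟩ := hRa.exists_isIso hS hPR
    have hA : Nat.card (autS P) ≤ Nat.card (autS R) :=
      Nat.card_le_card_of_injective (fun α => ⟨MulAut.congr e α.1, hea _ α.2⟩ : autS P → autS R)
        fun α β hαβ => Subtype.ext ((MulAut.congr e).injective (congrArg Subtype.val hαβ))
    rw [card_normalizer_eq, card_normalizer_eq] at hN
    have hc0 : 0 < Nat.card (Subgroup.centralizer (P : Set S)) := Nat.card_pos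
    have hcR : 0 < Nat.card (Subgroup.centralizer (R : Set S)) := Nat.card_pos
    have ha0 : 0 < Nat.card (autS P) := Nat.card_pos
    have haR : 0 < Nat.card (autS R) := Nat.card_pos
    have hCe : Nat.card (Subgroup.centralizer (R : Set S)) ≤
        Nat.card (Subgroup.centralizer (P : Set S)) := by
      by_contra! hlt
      exact absurd hN (not_le.2 (Nat.mul_lt_mul_of_lt_of_le hlt hA haR))
    have hAe : Nat.card (autS P) = Nat.card (autS R) := by
      refine hA.antisymm ?_
      by_contra! hlt
      exact absurd hN (not_le.2 (Nat.mul_lt_mul_of_le_of_lt hC hlt hcR))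
    refine ⟨fun Q hQ => (hRr.card_centralizer_le (hQ.symm.trans hPR)).trans hCe, ?_⟩
    refine FullyAutomized.exists_sylow hS ?_
    have h1 := card_autS_mul_relIndex (F := F) P
    have h2 := card_autS_mul_relIndex (F := F) R
    rw [hPR.card_autF_eq, ← h2, hAe] at h1
    rw [FullyAutomized, Nat.eq_of_mul_eq_mul_left haR h1]
    exact hRa
  · intro P φ hφ hC
    obtain ⟨R, hQR, hRa, hRr⟩ := h φ.range
    obtain ⟨e, he, hea⟩ := hRa.exists_isIso hS hQR
    set ψ₀ : φ.range →* S := R.subtype.comp e.toMonoidHom with hψ₀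
    have hψ₀F : ψ₀ ∈ F.HomS φ.range := mem_HomS_iff.2 he
    have hr₀ : ψ₀.range = R := range_subtype_comp_toMonoidHom e
    obtain ⟨ψ, hψ, eψ⟩ := hRr _ ψ₀ hψ₀F hr₀
    have hψi := F.HomS_injective hψ
    -- `ψ` maps `C_S(φ(P))` onto `C_S(R)`, since `φ(P)` is fully centralized.
    have hcent : ((Subgroup.centralizer (φ.range : Set S)).subgroupOf (extender ψ₀)).map ψ =
        Subgroup.centralizer (R : Set S) := by
      refine Subgroup.eq_of_le_of_card_ge
        (by rw [← hr₀]; exact map_centralizer_le (le_extender ψ₀) eψ) ?_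
      rw [card_map_centralizer (centralizer_le_extender ψ₀) hψi]
      exact hC R hQR
    set χ₀ : P →* S := ψ₀.comp φ.rangeRestrict with hχ₀
    have hχ₀F : χ₀ ∈ F.HomS P := mem_HomS_iff.2
      ((mem_HomS_iff.1 hφ).trans ((mem_HomS_iff.1 hψ₀F).comp φ.rangeRestrict))
    have hr₁ : χ₀.range = R := by
      rw [hχ₀, MonoidHom.range_comp, MonoidHom.range_eq_top.2 φ.rangeRestrict_surjective,
        ← MonoidHom.range_eq_map, hr₀]
    obtain ⟨χ, hχ, eχ⟩ := hRr _ χ₀ hχ₀F hr₁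
    have hle : extender φ ≤ extender χ₀ := by
      rintro x ⟨hx, y, hy, hxy⟩
      obtain ⟨hy', z, hz, hyz⟩ := normalizer_le_extender hea hy
      refine ⟨hx, z, by rwa [hr₁, ← hr₀], fun u => ?_⟩
      refine Eq.trans ?_ (hyz (φ.rangeRestrict u))
      change ψ₀ (φ.rangeRestrict _) = ψ₀ _
      congr 1
      exact Subtype.ext (hxy u)
    -- For `x` in `N_φ` witnessed by `y`, the elements `χ x` and `ψ y` induce the same automorphism
    -- of `R`, so they differ by an element of `C_S(R) = ψ(C_S(φ(P)))`.
    have hrange : ∀ x : extender φ, χ (Subgroup.inclusion hle x) ∈ ψ.range := by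
      rintro ⟨x, hx, y, hy, hxy⟩
      have hy' : y ∈ extender ψ₀ := normalizer_le_extender hea hy
      have hx' : x ∈ extender χ₀ := hle ⟨hx, y, hy, hxy⟩
      have hmem : (ψ ⟨y, hy'⟩)⁻¹ * χ ⟨x, hx'⟩ ∈ Subgroup.centralizer (R : Set S) := by
        rw [Subgroup.mem_centralizer_iff, ← hr₁]
        rintro _ ⟨u, rfl⟩
        have h1 := conj_apply_of_extends (le_extender χ₀) eχ hx' u
          ((Subgroup.mem_normalizer_iff.1 hx u).1 u.2)
        have h2 := conj_apply_of_extends (le_extender ψ₀) eψ hy' (φ.rangeRestrict u)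
          ((Subgroup.mem_normalizer_iff.1 hy _).1 (φ.rangeRestrict u).2)
        have h3 : χ₀ ⟨x * u * x⁻¹, (Subgroup.mem_normalizer_iff.1 hx u).1 u.2⟩ =
            ψ₀ ⟨y * (φ.rangeRestrict u) * y⁻¹,
              (Subgroup.mem_normalizer_iff.1 hy _).1 (φ.rangeRestrict u).2⟩ := by
          rw [hχ₀, MonoidHom.comp_apply]
          congr 1
          exact Subtype.ext (hxy u)
        rw [h1, h2] at h3
        change _ = ψ ⟨y, hy'⟩ * χ₀ u * _ at h3
        have h4 : χ ⟨x, hx'⟩ * χ₀ u = ψ ⟨y, hy'⟩ * χ₀ u * (ψ ⟨y, hy'⟩)⁻¹ * χ ⟨x, hx'⟩ := by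
          rw [← h3]; group
        rw [mul_assoc _ (χ ⟨x, hx'⟩), h4]
        group
      rw [← hcent] at hmem
      obtain ⟨c, -, hc⟩ := hmem
      exact ⟨⟨y, hy'⟩ * c, by rw [map_mul, hc]; exact mul_inv_cancel_left _ _⟩
    let f : extender φ →* extender ψ₀ := (MonoidHom.ofInjective hψi).symm.toMonoidHom.comp
      ((χ.comp (Subgroup.inclusion hle)).codRestrict ψ.range hrange)
    have hf : ψ.comp f = χ.comp (Subgroup.inclusion hle) := by
      ext x
      exact MonoidHom.apply_ofInjective_symm hψi
        ((χ.comp (Subgroup.inclusion hle)).codRestrict ψ.range hrange x)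
    refine ⟨(extender ψ₀).subtype.comp f, mem_HomS_iff.2 ?_, ?_⟩
    · have h1 := (mem_HomS_iff.1 hψ).comp f
      have h2 := (mem_HomS_iff.1 hχ).comp (Subgroup.inclusion hle)
      rw [hf] at h1
      exact Related.trans h2 h1.symm
    · ext u
      have h1 : ψ (f ⟨u, le_extender φ u.2⟩) = ψ ⟨φ u, le_extender ψ₀ ⟨u, rfl⟩⟩ := by
        refine (DFunLike.congr_fun hf _).trans ((eχ u).trans ?_)
        exact (eψ (φ.rangeRestrict u)).symm
      exact congrArg Subtype.val (hψi h1)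

end FusionSystem

/-! ### Orbit counting on bisets with twisted diagonal stabilizers -/

namespace Biset

variable {G H : Type u} [Group G] [Group H]

/-- A subgroup of `H × G` that meets `H × 1` trivially is the graph of a homomorphism (Goursat). -/
theorem exists_eq_graph {Γ : Subgroup (H × G)} (h : ∀ a ∈ Γ, a.2 = 1 → a.1 = 1)
    {L : Subgroup G} (hL : Γ.map (MonoidHom.snd H G) = L) : ∃ φ : L →* H, Γ = graph φ := by
  subst hL
  have hi : Function.Injective ((MonoidHom.snd H G).subgroupMap Γ) := by
    rw [injective_iff_map_eq_one]
    intro a ha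
    have h2 : (a : H × G).2 = 1 := congrArg Subtype.val ha
    exact Subtype.ext (Prod.ext (h a a.2 h2) h2)
  let e := MulEquiv.ofBijective _ ⟨hi, (MonoidHom.snd H G).subgroupMap_surjective Γ⟩
  have he : ∀ u, ((e.symm u : H × G)).2 = u := fun u =>
    congrArg Subtype.val (e.apply_symm_apply u)
  refine ⟨((MonoidHom.fst H G).comp Γ.subtype).comp e.symm.toMonoidHom, ?_⟩
  ext a
  rw [mem_graph]
  constructor
  · intro ha
    refine ⟨e ⟨a, ha⟩, ?_, rfl⟩
    change ((e.symm (e ⟨a, ha⟩) : H × G)).1 = a.1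
    rw [e.symm_apply_apply]
  · rintro ⟨u, h1, h2⟩
    have : (e.symm u : H × G) = a := Prod.ext h1 ((he u).trans h2)
    exact this ▸ (e.symm u).2

theorem card_map_snd (X : Biset G H) (x : X.carrier) (Γ : Subgroup (H × G))
    (hΓ : Γ ≤ MulAction.stabilizer (H × G) x) :
    Nat.card (Γ.map (MonoidHom.snd H G)) = Nat.card Γ := by
  obtain ⟨φ, hφ⟩ := exists_eq_graph (Γ := Γ) (fun a ha h2 => by
    have h1 : (a.1, (1 : G)) ∈ MulAction.stabilizer (H × G) x := h2 ▸ hΓ ha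
    exact X.fst_eq_of_mem_stabilizer h1 (Subgroup.one_mem _)) rfl
  conv_rhs => rw [hφ]
  exact (card_graph φ).symm

theorem mem_fixedPoints_graph_iff {X : Biset G H} {L : Subgroup G} {φ : L →* H} {x : X.carrier} :
    x ∈ MulAction.fixedPoints (graph φ) X.carrier ↔
      graph φ ≤ MulAction.stabilizer (H × G) x :=
  MulAction.mem_fixedPoints_iff_le_stabilizer _ _

variable [Finite G] [Finite H]

/-- An orbit of `N ≤ H × G` on a left-free biset has order `c = |N ∩ (H × 1)|` times the index, in
the second projection of `N`, of the projection of a stabilizer: the stabilizer projects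
injectively. -/
theorem card_orbit_eq (X : Biset G H) (N : Subgroup (H × G)) {c : ℕ}
    (hc : Nat.card N = c * Nat.card (N.map (MonoidHom.snd H G))) (x : X.carrier) :
    Nat.card (MulAction.orbit N x) = c *
      (((MulAction.stabilizer (H × G) x ⊓ N).map (MonoidHom.snd H G)).subgroupOf
        (N.map (MonoidHom.snd H G))).index := by
  set D := N.map (MonoidHom.snd H G)
  set E := (MulAction.stabilizer (H × G) x ⊓ N).map (MonoidHom.snd H G)
  have hED : E ≤ D := Subgroup.map_mono inf_le_right
  have := Fintype.ofFinite N
  have : Finite (MulAction.orbit N x) := Set.finite_range _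
  have := Fintype.ofFinite (MulAction.orbit N x)
  have := Fintype.ofFinite (MulAction.stabilizer N x)
  have h1 := MulAction.card_orbit_mul_card_stabilizer_eq_card_group N x
  simp only [← Nat.card_eq_fintype_card] at h1
  have h2 : Nat.card (MulAction.stabilizer N x) = Nat.card E := by
    rw [card_map_snd X x _ inf_le_left]
    have : MulAction.stabilizer N x = (MulAction.stabilizer (H × G) x ⊓ N).subgroupOf N := by
      ext n
      simp [Subgroup.mem_subgroupOf]
      rfl
    rw [this]
    exact Nat.card_congr (Subgroup.subgroupOfEquivOfLe inf_le_right).toEquiv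
  have h3 := (E.subgroupOf D).card_mul_index
  rw [Nat.card_congr (Subgroup.subgroupOfEquivOfLe hED).toEquiv] at h3
  rw [h2, hc, ← h3] at h1
  have hpos : 0 < Nat.card E := Nat.card_pos
  apply Nat.eq_of_mul_eq_mul_right hpos
  rw [h1]; ring

theorem dvd_card_of_smul_mem (X : Biset G H) (N : Subgroup (H × G)) {c : ℕ}
    (hc : Nat.card N = c * Nat.card (N.map (MonoidHom.snd H G))) (A : Set X.carrier)
    (hA : ∀ n ∈ N, ∀ x ∈ A, n • x ∈ A) : c ∣ Nat.card A :=
  MulAction.dvd_card_of_dvd_card_orbit (N := N) A (fun n => hA n n.2) c fun x _ => by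
    rw [card_orbit_eq X N hc x]
    exact dvd_mul_right _ _

/-- If the second projection of `N` is a `p`-group and no point of `A` has a stabilizer in `N` that
projects onto it, all orbits of `N` on `A` have order divisible by `c * p`. -/
theorem mul_dvd_card_of_smul_mem (X : Biset G H) (N : Subgroup (H × G)) {c p : ℕ} [Fact p.Prime]
    (hc : Nat.card N = c * Nat.card (N.map (MonoidHom.snd H G)))
    (hp : IsPGroup p (N.map (MonoidHom.snd H G))) (A : Set X.carrier)
    (hA : ∀ n ∈ N, ∀ x ∈ A, n • x ∈ A)
    (h : ∀ x ∈ A, (MulAction.stabilizer (H × G) x ⊓ N).map (MonoidHom.snd H G) ≠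
      N.map (MonoidHom.snd H G)) : c * p ∣ Nat.card A :=
  MulAction.dvd_card_of_dvd_card_orbit (N := N) A (fun n => hA n n.2) _ fun x hx => by
    rw [card_orbit_eq X N hc x]
    refine mul_dvd_mul_left c ?_
    obtain ⟨k, hk⟩ := hp.index (((MulAction.stabilizer (H × G) x ⊓ N).map
      (MonoidHom.snd H G)).subgroupOf (N.map (MonoidHom.snd H G)))
    rw [hk]
    refine dvd_pow_self p fun h0 => h x hx ?_
    rw [h0, pow_zero, Subgroup.index_eq_one, Subgroup.subgroupOf_eq_top] at hk
    exact le_antisymm (Subgroup.map_mono inf_le_right) hk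

/-- The number of fixed points of the `p`-group `L` on `H \ X` is congruent to `|H \ X|` modulo `p`.
Multiplied by `|H|` this is a statement about `X`: the points of `X` over fixed points of `L` are
those fixed by the graph of a homomorphism `L → H`, which is unique by left freeness. -/
theorem exists_card_mul_numOrbits_eq (X : Biset G H) {p : ℕ} [Fact p.Prime] (L : Subgroup G)
    (hL : IsPGroup p L) [Fintype (L →* H)] :
    ∃ k : ℕ, Nat.card H * X.numOrbits =
      (∑ ψ : L →* H, Nat.card (MulAction.fixedPoints (graph ψ) X.carrier)) +
        Nat.card H * p * k := by
  classical
  set N : Subgroup (H × G) := (⊤ : Subgroup H).prod L with hN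
  have hND : N.map (MonoidHom.snd H G) = L := by
    ext g
    constructor
    · rintro ⟨a, ha, rfl⟩; exact ha.2
    · exact fun hg => ⟨(1, g), ⟨trivial, hg⟩, rfl⟩
  have hc : Nat.card N = Nat.card H * Nat.card (N.map (MonoidHom.snd H G)) := by
    rw [hND, Nat.card_congr (Subgroup.prodEquiv (⊤ : Subgroup H) L).toEquiv, Nat.card_prod,
      Subgroup.card_top]
  set A : Set X.carrier := {x | ∃ ψ : L →* H, x ∈ MulAction.fixedPoints (graph ψ) X.carrier}
    with hA
  have hAiff : ∀ x, x ∈ A ↔ (MulAction.stabilizer (H × G) x ⊓ N).map (MonoidHom.snd H G) = L := by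
    intro x
    constructor
    · rintro ⟨ψ, hψ⟩
      rw [mem_fixedPoints_graph_iff] at hψ
      refine le_antisymm ((Subgroup.map_mono inf_le_right).trans hND.le) fun g hg => ?_
      exact ⟨(ψ ⟨g, hg⟩, g), ⟨hψ (mem_graph.2 ⟨⟨g, hg⟩, rfl, rfl⟩), trivial, hg⟩, rfl⟩
    · intro hx
      obtain ⟨ψ, hψ⟩ := exists_eq_graph (Γ := MulAction.stabilizer (H × G) x ⊓ N)
        (fun a ha h2 => by
          have h1 : (a.1, (1 : G)) ∈ MulAction.stabilizer (H × G) x := h2 ▸ ha.1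
          exact X.fst_eq_of_mem_stabilizer h1 (Subgroup.one_mem _)) hx
      exact ⟨ψ, mem_fixedPoints_graph_iff.2 (hψ ▸ inf_le_left)⟩
  have hinv : ∀ n ∈ N, ∀ x ∈ Aᶜ, n • x ∈ Aᶜ := by
    intro n hn x hx hnx
    apply hx
    have : ∀ n ∈ N, ∀ x ∈ A, n • x ∈ A := by
      intro n hn x hx
      rw [hAiff] at hx ⊢
      refine le_antisymm ((Subgroup.map_mono inf_le_right).trans hND.le) fun g hg => ?_
      have hg' : n.2⁻¹ * g * n.2 ∈ L := L.mul_mem (L.mul_mem (L.inv_mem hn.2) hg) hn.2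
      rw [← hx] at hg'
      obtain ⟨a, ⟨ha1, ha2⟩, ha⟩ := hg'
      refine ⟨n * a * n⁻¹, ⟨?_, N.mul_mem (N.mul_mem hn ha2) (N.inv_mem hn)⟩, ?_⟩
      · change _ ∈ MulAction.stabilizer (H × G) (n • x)
        rw [MulAction.mem_stabilizer_iff, smul_smul, inv_mul_cancel_right, mul_smul,
          MulAction.mem_stabilizer_iff.1 ha1]
      · change n.2 * a.2 * n.2⁻¹ = g
        rw [show a.2 = _ from ha]; group
    simpa using this n⁻¹ (N.inv_mem hn) _ hnx
  obtain ⟨k, hk⟩ := mul_dvd_card_of_smul_mem X N hc (hND ▸ hL) Aᶜ hinv fun x hx h =>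
    hx ((hAiff x).2 (h.trans hND))
  refine ⟨k, ?_⟩
  rw [← card_carrier, ← hk, Nat.card_coe_set_eq, ← Set.ncard_add_ncard_compl A]
  congr 1
  have hU : ∀ x : A, ∃! ψ : L →* H, x.1 ∈ MulAction.fixedPoints (graph ψ) X.carrier := by
    rintro ⟨x, ψ, hψ⟩
    refine ⟨ψ, hψ, fun χ hχ => ?_⟩
    ext u
    exact X.fst_eq_of_mem_stabilizer (mem_fixedPoints_graph_iff.1 hχ (mem_graph.2 ⟨u, rfl, rfl⟩))
      (mem_fixedPoints_graph_iff.1 hψ (mem_graph.2 ⟨u, rfl, rfl⟩))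
  rw [← Nat.card_coe_set_eq, ← Nat.card_sigma]
  exact Nat.card_congr
    { toFun := fun x => ⟨(hU x).choose, x, (hU x).choose_spec.1⟩
      invFun := fun y => ⟨y.2.1, y.1, y.2.2⟩
      left_inv := fun x => rfl
      right_inv := fun y => by
        have := (hU ⟨y.2.1, y.1, y.2.2⟩).choose_spec.2 y.1 y.2.2
        exact Sigma.subtype_ext this.symm rfl }

end Biset

namespace FusionSystem

open Biset BisetClass

variable {S : Type u} [Group S] {F : FusionSystem S}

theorem Related.of_comp {T T' : Type*} [Group T] [Group T'] {a b : T →* S} {f : T' →* T}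
    (hf : Function.Surjective f) (h : F.Related (a.comp f) (b.comp f)) : F.Related a b := by
  obtain ⟨ψ, hψ, e⟩ := h
  have hle : a.range ≤ (a.comp f).range := by
    rintro _ ⟨t, rfl⟩
    obtain ⟨t, rfl⟩ := hf t
    exact ⟨t, rfl⟩
  refine ⟨ψ.comp (Subgroup.inclusion hle), F.mem_HomS_of_eqOn hψ hle fun _ => rfl, fun t => ?_⟩
  obtain ⟨t, rfl⟩ := hf t
  exact e t

variable (F) in
/-- `F`-twisted diagonal subgroups of `S × S`, that is graphs of morphisms of `F` (see
`diag_graph_iff` and `Diag.exists_eq_graph`): the first projection is a morphism of `F` after the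
second. -/
def Diag (Γ : Subgroup (S × S)) : Prop :=
  F.Related ((MonoidHom.snd S S).comp Γ.subtype) ((MonoidHom.fst S S).comp Γ.subtype)

theorem diag_map_iff {T : Type*} [Group T] {a b : T →* S} {Γ : Subgroup T} :
    F.Diag (Γ.map (b.prod a)) ↔ F.Related (a.comp Γ.subtype) (b.comp Γ.subtype) :=
  ⟨fun h => h.comp ((b.prod a).subgroupMap Γ), fun h =>
    Related.of_comp ((b.prod a).subgroupMap_surjective Γ) h⟩

theorem diag_graph_iff {P : Subgroup S} {φ : P →* S} : F.Diag (graph φ) ↔ φ ∈ F.HomS P := by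
  rw [graph, MonoidHom.range_eq_map, diag_map_iff, mem_HomS_iff]
  exact ⟨fun h => Related.of_comp (fun u => ⟨⟨u, trivial⟩, rfl⟩) h, fun h => h.comp _⟩

theorem Diag.exists_eq_graph {Γ : Subgroup (S × S)} (h : F.Diag Γ) {P : Subgroup S}
    (hP : Γ.map (MonoidHom.snd S S) = P) : ∃ φ ∈ F.HomS P, Γ = graph φ := by
  obtain ⟨φ, hφ⟩ := Biset.exists_eq_graph (fun a ha h2 => (h.map_eq_one_iff ⟨a, ha⟩).1 h2) hP
  exact ⟨φ, diag_graph_iff.1 (hφ ▸ h), hφ⟩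

theorem Diag.mono {Γ Γ' : Subgroup (S × S)} (h : F.Diag Γ) (h' : Γ' ≤ Γ) : F.Diag Γ' :=
  Related.comp h (Subgroup.inclusion h')

theorem Diag.card_eq {Γ : Subgroup (S × S)} (h : F.Diag Γ) :
    Nat.card (Γ.map (MonoidHom.snd S S)) = Nat.card Γ := by
  obtain ⟨φ, -, hφ⟩ := h.exists_eq_graph rfl
  conv_rhs => rw [hφ]
  exact (card_graph φ).symm

theorem Diag.map {T : Type*} [Group T] {a₁ a₂ b₁ b₂ : T →* S} (ha : F.Related a₁ a₂)
    (hb : F.Related b₁ b₂) {Γ : Subgroup T} (h : F.Diag (Γ.map (b₁.prod a₁))) :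
    F.Diag (Γ.map (b₂.prod a₂)) :=
  diag_map_iff.2 (((ha.comp _).symm.trans (diag_map_iff.1 h)).trans (hb.comp _))

theorem map_snd_map_prod {T : Type*} [Group T] (a b : T →* S) (Γ : Subgroup T) :
    (Γ.map (b.prod a)).map (MonoidHom.snd S S) = (a.comp Γ.subtype).range := by
  rw [Subgroup.map_map, MonoidHom.snd_comp_prod, MonoidHom.range_comp, Subgroup.range_subtype]

theorem Related.conj_map_snd {T : Type*} [Group T] {a₁ a₂ b₁ b₂ : T →* S}
    (ha : F.Related a₁ a₂) (Γ : Subgroup T) :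
    F.Conj ((Γ.map (b₁.prod a₁)).map (MonoidHom.snd S S))
      ((Γ.map (b₂.prod a₂)).map (MonoidHom.snd S S)) := by
  rw [map_snd_map_prod, map_snd_map_prod]
  exact (ha.comp _).conj

theorem conj_smul_eq_map (a : S × S) (Γ : Subgroup (S × S)) :
    MulAut.conj a • Γ = Γ.map (((MulAut.conj a.1).toMonoidHom.comp (MonoidHom.fst S S)).prod
      ((MulAut.conj a.2).toMonoidHom.comp (MonoidHom.snd S S))) :=
  rfl

theorem Diag.conj {Γ : Subgroup (S × S)} (h : F.Diag Γ) (a : S × S) :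
    F.Diag (MulAut.conj a • Γ) := by
  rw [conj_smul_eq_map]
  refine Diag.map (F.related_conj (MonoidHom.snd S S) a.2)
    (F.related_conj (MonoidHom.fst S S) a.1) ?_
  exact (Subgroup.map_id Γ).symm ▸ h

variable (F) in
theorem conj_map_snd_smul (a : S × S) (Γ : Subgroup (S × S)) :
    F.Conj (Γ.map (MonoidHom.snd S S)) ((MulAut.conj a • Γ).map (MonoidHom.snd S S)) := by
  rw [conj_smul_eq_map]
  have := (F.related_conj (MonoidHom.snd S S) a.2).conj_map_snd (b₁ := MonoidHom.fst S S)
    (b₂ := (MulAut.conj a.1).toMonoidHom.comp (MonoidHom.fst S S)) Γ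
  rwa [show (MonoidHom.fst S S).prod (MonoidHom.snd S S) = MonoidHom.id _ from rfl,
    Subgroup.map_id] at this

/-- `(y, x)` normalizes the graph of `φ` if and only if `x` normalizes `P` and `φ` intertwines the
conjugations by `x` and `y`; so the normalizer projects onto `N_φ`. -/
theorem mem_normalizer_graph_iff {P : Subgroup S} {φ : P →* S} {y x : S} :
    (y, x) ∈ Subgroup.normalizer (graph φ : Set (S × S)) ↔
      ∃ hx : x ∈ Subgroup.normalizer (P : Set S), ∀ u : P,
        φ ⟨x * u * x⁻¹, (Subgroup.mem_normalizer_iff.1 hx u).1 u.2⟩ = y * φ u * y⁻¹ := by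
  constructor
  · intro h
    have hx : x ∈ Subgroup.normalizer (P : Set S) := by
      have := Subgroup.le_normalizer_map (H := graph φ) (MonoidHom.snd S S) ⟨_, h, rfl⟩
      rwa [map_snd_graph] at this
    refine ⟨hx, fun u => ?_⟩
    obtain ⟨_, e⟩ := mk_mem_graph.1 ((Subgroup.mem_normalizer_iff.1 h (φ u, u)).1
      (mem_graph.2 ⟨u, rfl, rfl⟩))
    exact e
  · rintro ⟨hx, h⟩
    rw [Subgroup.mem_normalizer_iff]
    rintro ⟨b, a⟩
    change _ ↔ (y * b * y⁻¹, x * a * x⁻¹) ∈ _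
    rw [mk_mem_graph, mk_mem_graph]
    constructor
    · rintro ⟨ha, rfl⟩
      exact ⟨_, h ⟨a, ha⟩⟩
    · rintro ⟨ha, e⟩
      have ha' := (Subgroup.mem_normalizer_iff.1 hx a).2 ha
      refine ⟨ha', ?_⟩
      rw [h ⟨a, ha'⟩] at e
      simpa using e

theorem map_fst_graph {P : Subgroup S} (φ : P →* S) :
    (graph φ).map (MonoidHom.fst S S) = φ.range := by
  rw [graph, ← MonoidHom.range_comp, MonoidHom.fst_comp_prod]

theorem map_snd_normalizer_graph {P : Subgroup S} (φ : P →* S) :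
    (Subgroup.normalizer (graph φ : Set (S × S))).map (MonoidHom.snd S S) = extender φ := by
  ext x
  constructor
  · rintro ⟨⟨y, x⟩, h, rfl⟩
    obtain ⟨hx, e⟩ := mem_normalizer_graph_iff.1 h
    refine ⟨hx, y, ?_, e⟩
    have := Subgroup.le_normalizer_map (H := graph φ) (MonoidHom.fst S S) ⟨_, h, rfl⟩
    rwa [map_fst_graph] at this
  · rintro ⟨hx, y, -, e⟩
    exact ⟨(y, x), mem_normalizer_graph_iff.2 ⟨hx, e⟩, rfl⟩

theorem card_normalizer_graph [Finite S] {P : Subgroup S} (φ : P →* S) :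
    Nat.card (Subgroup.normalizer (graph φ : Set (S × S))) =
      Nat.card (Subgroup.centralizer (φ.range : Set S)) *
        Nat.card ((Subgroup.normalizer (graph φ : Set (S × S))).map (MonoidHom.snd S S)) := by
  set N := Subgroup.normalizer (graph φ : Set (S × S)) with hN
  have h1 : N.map (MonoidHom.snd S S) = ((MonoidHom.snd S S).comp N.subtype).range := by
    rw [MonoidHom.range_comp, Subgroup.range_subtype]
  rw [h1, ← Subgroup.index_ker, ← Subgroup.card_mul_index ((MonoidHom.snd S S).comp N.subtype).ker]
  congr 1
  have h2 : ∀ y : S, (y, (1 : S)) ∈ N ↔ y ∈ Subgroup.centralizer (φ.range : Set S) := by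
    intro y
    rw [hN, mem_normalizer_graph_iff, Subgroup.mem_centralizer_iff]
    constructor
    · rintro ⟨_, e⟩ _ ⟨u, rfl⟩
      have := e u
      simp only [one_mul, inv_one, mul_one, Subtype.coe_eta] at this
      rw [eq_mul_inv_iff_mul_eq] at this
      exact this
    · intro h
      refine ⟨Subgroup.one_mem _, fun u => ?_⟩
      simp only [one_mul, inv_one, mul_one, Subtype.coe_eta]
      rw [eq_mul_inv_iff_mul_eq]
      exact h _ ⟨u, rfl⟩
  exact Nat.card_congr
    { toFun := fun a => ⟨a.1.1.1, (h2 _).1 (by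
        have h3 : a.1.1.2 = 1 := a.2
        have := a.1.2
        rwa [show (a.1 : S × S) = (a.1.1.1, 1) from Prod.ext rfl h3] at this)⟩
      invFun := fun y => ⟨⟨(y.1, 1), (h2 _).2 y.2⟩, rfl⟩
      left_inv := fun a => Subtype.ext (Subtype.ext (Prod.ext rfl (show 1 = a.1.1.2 from
        (show a.1.1.2 = 1 from a.2).symm)))
      right_inv := fun y => rfl }

variable (F) in
/-- All point stabilizers of the biset are `F`-twisted diagonals; equivalently, its marks vanish at
all other subgroups, since subgroups of `F`-twisted diagonals are of the same kind. -/
def HasDiagStabilizers (x : BisetClass S S) : Prop :=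
  ∀ Γ, mark Γ x ≠ 0 → F.Diag Γ

theorem smul_mem_fixedPoints_of_mem_normalizer {X : Biset S S} {Γ : Subgroup (S × S)} :
    ∀ n ∈ Subgroup.normalizer (Γ : Set (S × S)), ∀ x ∈ MulAction.fixedPoints Γ X.carrier,
      n • x ∈ MulAction.fixedPoints Γ X.carrier := by
  intro n hn x hx
  rw [MulAction.mem_fixedPoints_iff_le_stabilizer] at hx ⊢
  intro a ha
  have h1 := hx ((Subgroup.mem_normalizer_iff.1 (Subgroup.inv_mem _ hn) a).1 ha)
  rw [MulAction.mem_stabilizer_iff] at h1 ⊢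
  rw [inv_inv, mul_smul, mul_smul, inv_smul_eq_iff] at h1
  exact h1

variable [Finite S]

theorem exists_le_conj_graph_of_mark_basic_ne_zero {T : Subgroup S} {χ : T →* S}
    {Γ : Subgroup (S × S)} (h : mark Γ (BisetClass.mk (basic T χ)) ≠ 0) :
    ∃ a : S × S, Γ ≤ MulAut.conj a • graph χ := by
  rw [mark_mk] at h
  have := MulAction.exists_le_conj_of_card_fixedPoints_ne_zero Γ (basicPoint T χ) h
  rwa [stabilizer_basic] at this

theorem hasDiagStabilizers_basic {T : Subgroup S} {χ : T →* S} (hχ : χ ∈ F.HomS T) :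
    F.HasDiagStabilizers (BisetClass.mk (basic T χ)) := by
  intro Γ h
  obtain ⟨a, ha⟩ := exists_le_conj_graph_of_mark_basic_ne_zero h
  exact ((diag_graph_iff.2 hχ).conj a).mono ha

/-- The normalizer of the graph of `φ` acts on its fixed points, and its intersection
`C_S(φ(P)) × 1` with `S × 1` acts freely. -/
theorem card_centralizer_dvd_mark (x : BisetClass S S) {P : Subgroup S} (φ : P →* S) :
    Nat.card (Subgroup.centralizer (φ.range : Set S)) ∣ mark (graph φ) x := by
  induction x using Quotient.inductionOn with | h X => ?_
  exact dvd_card_of_smul_mem X _ (card_normalizer_graph φ) _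
    smul_mem_fixedPoints_of_mem_normalizer

/-- If `φ` does not extend to `N_φ`, its mark is divisible by a further factor `p`: were the
projection to `N_φ` of the stabilizer of a fixed point in the normalizer of the graph surjective,
the stabilizer would be the graph of an extension of `φ` in `F`. -/
theorem card_centralizer_mul_dvd_mark {p : ℕ} [Fact p.Prime] (hS : IsPGroup p S)
    {x : BisetClass S S} (hx : F.HasDiagStabilizers x) {P : Subgroup S} {φ : P →* S}
    (h : ¬ ∃ ψ ∈ F.HomS (extender φ), ∀ u : P, ψ ⟨u, le_extender φ u.2⟩ = φ u) :
    Nat.card (Subgroup.centralizer (φ.range : Set S)) * p ∣ mark (graph φ) x := by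
  induction x using Quotient.inductionOn with | h X => ?_
  refine mul_dvd_card_of_smul_mem X _ (card_normalizer_graph φ) (hS.to_subgroup _) _
    smul_mem_fixedPoints_of_mem_normalizer fun x hxφ he => h ?_
  rw [map_snd_normalizer_graph] at he
  set Γ := MulAction.stabilizer (S × S) x ⊓ Subgroup.normalizer (graph φ : Set (S × S)) with hΓ
  have hD : F.Diag Γ := by
    refine hx Γ ?_
    change Nat.card (MulAction.fixedPoints Γ X.carrier) ≠ 0
    have : Nonempty (MulAction.fixedPoints Γ X.carrier) :=
      ⟨⟨x, (MulAction.mem_fixedPoints_iff_le_stabilizer _ _).2 inf_le_left⟩⟩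
    exact Nat.card_pos.ne'
  have hφΓ : graph φ ≤ Γ := le_inf
    ((MulAction.mem_fixedPoints_iff_le_stabilizer _ _).1 hxφ) Subgroup.le_normalizer
  obtain ⟨ψ, hψ, hg⟩ := hD.exists_eq_graph he
  refine ⟨ψ, hψ, fun u => ?_⟩
  have : (φ u, (u : S)) ∈ graph ψ := hg ▸ hφΓ (mem_graph.2 ⟨u, rfl, rfl⟩)
  exact (mk_mem_graph.1 this).2

end FusionSystem

/-! ### Saturation from a characteristic element -/

namespace FusionSystem

open Biset BisetClass

variable {S : Type u} [Group S] {F : FusionSystem S}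

/-- The morphisms of `F` with source `Q` and image `R` form a torsor under `Aut_F(Q)`. -/
theorem card_filter_range_eq (Q R : Subgroup S) [Fintype (Q →* S)]
    [DecidablePred fun ψ : Q →* S => ψ ∈ F.HomS Q ∧ ψ.range = R] (h : F.Conj Q R) :
    (Finset.univ.filter fun ψ : Q →* S => ψ ∈ F.HomS Q ∧ ψ.range = R).card =
      Nat.card (F.autF Q) := by
  obtain ⟨e, he⟩ := conj_iff_exists_isIso.1 h
  rw [← Fintype.card_subtype, ← Nat.card_eq_fintype_card]
  symm
  refine Nat.card_eq_of_bijective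
    (fun α => ⟨R.subtype.comp (e.toMonoidHom.comp α.1.toMonoidHom), ?_, ?_⟩) ⟨?_, ?_⟩
  · exact mem_HomS_iff.2 ((isIso_iff_mem_autF.2 α.2).trans he)
  · rw [MonoidHom.range_comp, MonoidHom.range_eq_top.2 (e.surjective.comp α.1.surjective),
      ← MonoidHom.range_eq_map, Subgroup.range_subtype]
  · intro α β hαβ
    ext u
    have := DFunLike.congr_fun (congrArg Subtype.val hαβ) u
    exact congrArg Subtype.val (e.injective (Subtype.ext this))
  · rintro ⟨ψ, hψ, hr⟩
    obtain ⟨f, hf, hfψ⟩ := exists_isIso_of_mem_HomS hψ hr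
    refine ⟨⟨f.trans e.symm, isIso_iff_mem_autF.1 (hf.trans he.symm)⟩, Subtype.ext ?_⟩
    ext u
    change (e (e.symm (f u)) : S) = ψ u
    rw [e.apply_symm_apply, hfψ]

variable [Finite S] {p : ℕ} [Fact p.Prime]

/-- A divisibility of marks that holds on the generators holds on their span. -/
theorem IsGenerated.dvd_mark {Ω : BurnsideLoc p S S} (hΩ : F.IsGenerated p Ω)
    (Γ : Subgroup (S × S)) (d : ℕ)
    (h : ∀ x : BisetClass S S, F.HasDiagStabilizers x → d ∣ mark Γ x) :
    (d : ZLoc p) ∣ Burnside.locMap p (mark Γ) Ω := by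
  induction hΩ using Submodule.span_induction with
  | mem x hx =>
    obtain ⟨T, φ, hφ, rfl⟩ := hx
    rw [Burnside.locMap_basis]
    exact_mod_cast Nat.cast_dvd_cast (α := ZLoc p) (h _ (hasDiagStabilizers_basic hφ))
  | zero => simp
  | add x y _ _ hx hy => rw [map_add]; exact dvd_add hx hy
  | smul a x _ hx => rw [map_smul, smul_eq_mul]; exact hx.mul_left a

/-- `|S| ε(Ω)` is congruent modulo `p |S|` to the sum of the marks of `Ω` at the graphs of all
homomorphisms `Q → S`. -/
theorem exists_card_mul_aug_eq (hS : IsPGroup p S) {Ω : BurnsideLoc p S S}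
    (hΩ : F.IsGenerated p Ω) (Q : Subgroup S) [Fintype (Q →* S)] :
    ∃ k : ZLoc p, (Nat.card S : ZLoc p) * Burnside.aug p Ω =
      (∑ ψ : Q →* S, Burnside.locMap p (mark (graph ψ)) Ω) + Nat.card S * p * k := by
  induction hΩ using Submodule.span_induction with
  | mem x hx =>
    obtain ⟨T, φ, hφ, rfl⟩ := hx
    obtain ⟨k, hk⟩ := (basic T φ).exists_card_mul_numOrbits_eq (p := p) Q (hS.to_subgroup _)
    refine ⟨k, ?_⟩
    rw [Burnside.aug_eq_locMap, Burnside.locMap_basis]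
    simp only [Burnside.locMap_basis]
    exact_mod_cast congrArg (Nat.cast (R := ZLoc p)) hk
  | zero => exact ⟨0, by simp⟩
  | add x y _ _ hx hy =>
    obtain ⟨k, hk⟩ := hx
    obtain ⟨l, hl⟩ := hy
    refine ⟨k + l, ?_⟩
    simp only [map_add, Finset.sum_add_distrib]
    linear_combination hk + hl
  | smul a x _ hx =>
    obtain ⟨k, hk⟩ := hx
    refine ⟨a * k, ?_⟩
    simp only [map_smul, smul_eq_mul, ← Finset.mul_sum]
    linear_combination a * hk

/-- Suppose that the mark of `Ω` at the graph of `ψ ∈ Hom_F(Q, S)` depends only on the image, say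
`f (ψ(Q))`, with `f` invariant under `S`-conjugation. Then some fully automized `R` that is
`F`-conjugate to `Q` has `f R` not divisible by `p |C_S(R)|`. Summing over images, `|S| ε(Ω)` is
congruent to `∑ |Aut_F(R)| f R` modulo `p |S|`, and the `S`-orbit of `R` contributes
`|S : N_S(R)| |Aut_F(R)| f R = |S| |Aut_F(R) : Aut_S(R)| (f R / |C_S(R)|)` to the sum. If there is
no such `R`, all these are divisible by `p |S|`, and so `p` divides `ε(Ω)`. -/
theorem exists_fullyAutomized_not_dvd (hS : IsPGroup p S) {Ω : BurnsideLoc p S S}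
    (hΩ : F.IsGenerated p Ω) (haug : ¬ (p : ZLoc p) ∣ Burnside.aug p Ω) (Q : Subgroup S)
    (f : Subgroup S → ZLoc p)
    (hf : ∀ ψ ∈ F.HomS Q, Burnside.locMap p (mark (graph ψ)) Ω = f ψ.range)
    (hinv : ∀ (g : S) (R : Subgroup S), f (MulAut.conj g • R) = f R) :
    ∃ R, F.Conj Q R ∧ F.FullyAutomized p R ∧
      ¬ ((Nat.card (Subgroup.centralizer (R : Set S)) * p : ℕ) : ZLoc p) ∣ f R := by
  classical
  by_contra! hcon
  have : Finite (Q →* S) := DFunLike.finite _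
  have := Fintype.ofFinite (Q →* S)
  have := Fintype.ofFinite (Subgroup S)
  obtain ⟨k, hk⟩ := exists_card_mul_aug_eq hS hΩ Q
  set g : Subgroup S → ZLoc p := fun R =>
    if F.Conj Q R then Nat.card (F.autF Q) * f R else 0 with hg
  have hsum : ∑ ψ : Q →* S, Burnside.locMap p (mark (graph ψ)) Ω = ∑ R, g R := by
    -- Marks at graphs outside `F` are divisible by `0`.
    have h0 : ∀ ψ : Q →* S, Burnside.locMap p (mark (graph ψ)) Ω =
        if ψ ∈ F.HomS Q then f ψ.range else 0 := fun ψ => by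
      split_ifs with h
      · exact hf ψ h
      · have := hΩ.dvd_mark (graph ψ) 0 fun x hx => by
          rw [zero_dvd_iff]
          by_contra hne
          exact h (diag_graph_iff.1 (hx _ hne))
        simpa using this
    rw [Finset.sum_congr rfl fun ψ _ => h0 ψ, ← Finset.sum_filter,
      ← Finset.sum_fiberwise (s := Finset.univ.filter fun ψ : Q →* S => ψ ∈ F.HomS Q)
        (g := fun ψ : Q →* S => ψ.range)]
    refine Finset.sum_congr rfl fun R _ => ?_
    rw [Finset.filter_filter, Finset.sum_congr rfl (g := fun _ => f R)
      (fun ψ hψ => by rw [(Finset.mem_filter.1 hψ).2.2]), Finset.sum_const, nsmul_eq_mul, hg]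
    by_cases hR : F.Conj Q R
    · simp only [if_pos hR]
      rw [card_filter_range_eq Q R hR]
    · simp only [if_neg hR]
      rw [Finset.filter_false_of_mem, Finset.card_empty, Nat.cast_zero, zero_mul]
      rintro ψ - ⟨hψ, hr⟩
      exact hR (conj_iff.2 ⟨ψ, hψ, hr⟩)
  -- `S` acts on its subgroups by conjugation.
  let act : MulAction S (Subgroup S) := MulAction.compHom (Subgroup S) (MulAut.conj (G := S))
  have hconj : ∀ (s : S) (R : Subgroup S), F.Conj R (MulAut.conj s • R) := fun s R => by
    have := (F.related_conj R.subtype s).conj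
    rwa [Subgroup.range_subtype, MonoidHom.range_comp, Subgroup.range_subtype] at this
  have hdvd : ((Nat.card S * p : ℕ) : ZLoc p) ∣ ∑ R, g R := by
    refine MulAction.dvd_sum_of_dvd_card_orbit_mul (N := S) g (fun s R => ?_) _ fun R => ?_
    · change g (MulAut.conj s • R) = g R
      have : F.Conj Q (MulAut.conj s • R) ↔ F.Conj Q R :=
        ⟨fun h => h.trans (hconj s R).symm, fun h => h.trans (hconj s R)⟩
      simp only [hg, this, hinv]
    · by_cases hR : F.Conj Q R
      swap
      · simp [hg, hR]
      have := Fintype.ofFinite S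
      have := Fintype.ofFinite (MulAction.orbit S R)
      have := Fintype.ofFinite (MulAction.stabilizer S R)
      have h1 := MulAction.card_orbit_mul_card_stabilizer_eq_card_group S R
      simp only [← Nat.card_eq_fintype_card] at h1
      have hst : MulAction.stabilizer S R = Subgroup.normalizer (R : Set S) := by
        ext s
        rw [MulAction.mem_stabilizer_iff]
        change MulAut.conj s • R = R ↔ _
        rw [Subgroup.mem_normalizer_iff]
        constructor
        · intro h x
          conv_rhs => rw [← h]
          rw [Subgroup.mem_pointwise_smul_iff_inv_smul_mem]
          simp [mul_assoc]
        · intro h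
          ext x
          rw [Subgroup.mem_pointwise_smul_iff_inv_smul_mem, h]
          simp [mul_assoc]
      rw [hst, card_normalizer_eq] at h1
      simp only [hg, if_pos hR]
      rw [hR.card_autF_eq, ← card_autS_mul_relIndex (F := F) R, ← h1]
      obtain ⟨ψ, hψ, hr⟩ := conj_iff.1 hR
      have hC : ((Nat.card (Subgroup.centralizer (R : Set S)) : ℕ) : ZLoc p) ∣ f R := by
        rw [← hr, ← hf ψ hψ]
        exact hΩ.dvd_mark _ _ fun x _ => card_centralizer_dvd_mark x ψ
      by_cases hA : F.FullyAutomized p R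
      · obtain ⟨l, hl⟩ := hcon R hR hA
        rw [hl]
        push_cast
        exact ⟨(autS R).relIndex (F.autF R) * l, by ring⟩
      · rw [FullyAutomized, not_not] at hA
        obtain ⟨m, hm⟩ := hA
        obtain ⟨l, hl⟩ := hC
        rw [hl, hm]
        push_cast
        exact ⟨m * l, by ring⟩
  rw [← hsum] at hdvd
  obtain ⟨l, hl⟩ := hdvd
  rw [hl] at hk
  refine haug ⟨l + k, ?_⟩
  have hne : (Nat.card S : ZLoc p) ≠ 0 := by
    have : CharZero (ZLoc p) := inferInstance
    exact_mod_cast Nat.card_pos.ne'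
  apply mul_left_cancel₀ hne
  rw [hk]
  push_cast
  ring

/-- `R` is receptive if no mark of `Ω` at a morphism of `F` onto `R` is divisible by
`p |C_S(R)|`. -/
theorem receptive_of_not_dvd (hS : IsPGroup p S) {Ω : BurnsideLoc p S S}
    (hΩ : F.IsGenerated p Ω) {R : Subgroup S}
    (h : ∀ (P : Subgroup S) (φ : P →* S), φ ∈ F.HomS P → φ.range = R →
      ¬ ((Nat.card (Subgroup.centralizer (R : Set S)) * p : ℕ) : ZLoc p) ∣
        Burnside.locMap p (mark (graph φ)) Ω) : F.Receptive R := by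
  intro P φ hφ hr
  by_contra hcon
  subst hr
  exact h P φ hφ rfl (hΩ.dvd_mark _ _ fun x hx => card_centralizer_mul_dvd_mark hS hx hcon)

/-- Right stability in terms of marks: along `φ` and along the inclusion of `P`, a subgroup of
`S × P` gives two subgroups of `S × S` at which `Ω` has the same mark. -/
theorem RightStable.mark_eq {Ω : BurnsideLoc p S S} (h : F.RightStable p Ω) {P : Subgroup S}
    {φ : P →* S} (hφ : φ ∈ F.HomS P) (Γ : Subgroup (S × P)) :
    Burnside.locMap p (mark (Γ.map ((MonoidHom.id S).prodMap φ))) Ω =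
      Burnside.locMap p (mark (Γ.map ((MonoidHom.id S).prodMap P.subtype))) Ω := by
  have := congrArg (Burnside.locMap p (mark Γ)) (h P φ hφ)
  rwa [Burnside.ofHom, Burnside.ofHom, Burnside.basis, Burnside.basis,
    Burnside.locMap_comp_right p _ _ _ fun x => mark_comp_basic_top x φ Γ,
    Burnside.locMap_comp_right p _ _ _ fun x => mark_comp_basic_top x P.subtype Γ] at this

theorem LeftStable.mark_eq {Ω : BurnsideLoc p S S} (h : F.LeftStable p Ω) {P : Subgroup S}
    {φ : P →* S} (hφ : φ ∈ F.HomS P) (Γ : Subgroup (P × S)) :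
    Burnside.locMap p (mark (Γ.map (φ.prodMap (MonoidHom.id S)))) Ω =
      Burnside.locMap p (mark (Γ.map (P.subtype.prodMap (MonoidHom.id S)))) Ω := by
  have := congrArg (Burnside.locMap p (mark Γ)) (h P φ hφ)
  rw [Burnside.basis, Burnside.basis,
    Burnside.locMap_comp_left p _ _ _ fun x => mark_basic_comp φ.range
      (MonoidHom.ofInjective (F.HomS_injective hφ)).symm x φ (F.HomS_injective hφ)
      (fun l => MonoidHom.apply_ofInjective_symm _ l) Γ] at this
  rw [this]
  exact Burnside.locMap_comp_left p _ _ _ (fun x => mark_basic_comp P (MulEquiv.refl P) x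
    P.subtype P.subtype_injective (fun l => rfl) Γ) Ω

/-- The marks of a right stable element at morphisms of `F` depend only on the image. -/
theorem RightStable.mark_graph_eq {Ω : BurnsideLoc p S S} (h : F.RightStable p Ω)
    {P : Subgroup S} {φ : P →* S} (hφ : φ ∈ F.HomS P) :
    Burnside.locMap p (mark (graph φ)) Ω =
      Burnside.locMap p (mark (graph φ.range.subtype)) Ω := by
  have := h.mark_eq hφ (φ.prod (MonoidHom.id P)).range
  have e1 : (φ.prod (MonoidHom.id P)).range.map ((MonoidHom.id S).prodMap φ) =
      graph φ.range.subtype := by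
    ext ⟨a, b⟩
    rw [mk_mem_graph, ← MonoidHom.range_comp]
    constructor
    · rintro ⟨u, hu⟩
      obtain ⟨rfl, rfl⟩ := Prod.ext_iff.1 hu
      exact ⟨⟨u, rfl⟩, rfl⟩
    · rintro ⟨⟨u, rfl⟩, rfl⟩
      exact ⟨u, rfl⟩
  have e2 : (φ.prod (MonoidHom.id P)).range.map ((MonoidHom.id S).prodMap P.subtype) =
      graph φ := by
    rw [← MonoidHom.range_comp]; rfl
  rw [e1, e2] at this
  exact this.symm

/-- The marks of a left stable element at morphisms of `F` depend only on the source. -/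
theorem LeftStable.mark_graph_eq {Ω : BurnsideLoc p S S} (h : F.LeftStable p Ω)
    {P : Subgroup S} {φ : P →* S} (hφ : φ ∈ F.HomS P) :
    Burnside.locMap p (mark (graph φ)) Ω =
      Burnside.locMap p (mark (graph P.subtype)) Ω := by
  have := h.mark_eq hφ ((MonoidHom.id P).prod P.subtype).range
  rw [← MonoidHom.range_comp, ← MonoidHom.range_comp] at this
  exact this

theorem isSaturated_of_isRightCharacteristic (hS : IsPGroup p S) {Ω : BurnsideLoc p S S}
    (hΩ : F.IsRightCharacteristic p Ω) : F.IsSaturated p := by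
  refine isSaturated_of_exists_receptive hS fun P => ?_
  obtain ⟨R, hPR, hRa, hR⟩ := exists_fullyAutomized_not_dvd hS hΩ.generated hΩ.aug_prime P
    (fun R => Burnside.locMap p (mark (graph R.subtype)) Ω)
    (fun ψ hψ => hΩ.stable.mark_graph_eq hψ) (fun g R => by
      have hc := mem_HomS_iff.2 (F.related_conj R.subtype g)
      have h1 := hΩ.stable.mark_graph_eq hc
      rw [MonoidHom.range_comp, Subgroup.range_subtype] at h1
      refine h1.symm.trans ?_
      have h2 : graph ((MulAut.conj g).toMonoidHom.comp R.subtype) =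
          MulAut.conj ((g, 1) : S × S) • graph R.subtype := by
        rw [conj_smul_eq_map, graph, graph, ← MonoidHom.range_comp]
        congr 1
        ext u <;> simp
      rw [h2]
      congr 2
      ext x
      induction x using Quotient.inductionOn with | h X => ?_
      exact MulAction.card_fixedPoints_conj (X := X.carrier) (graph R.subtype) ((g, 1) : S × S))
  refine ⟨R, hPR, hRa, receptive_of_not_dvd hS hΩ.generated fun Q φ hφ hr => ?_⟩
  rw [hΩ.stable.mark_graph_eq hφ, hr]
  exact hR

/-- The mark of a left stable element at a morphism `φ : Q → R` of `F` depends on `Q` and not on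
`R`, so that the subgroup `R` found for the source `P` has to be compared with the one, `R'`, found
for the source `Q`. The `p`-part of the mark at `P` is `|C_S(R)|`, that at `Q` is `|C_S(R')|`, and
`|C_S(R')|` divides the mark at `P`; hence `|C_S(R')| ≤ |C_S(R)|`, and the mark at `Q` is not
divisible by `p |C_S(R)|`. -/
theorem isSaturated_of_isLeftCharacteristic (hS : IsPGroup p S) {Ω : BurnsideLoc p S S}
    (hΩ : F.IsLeftCharacteristic p Ω) : F.IsSaturated p := by
  refine isSaturated_of_exists_receptive hS fun P => ?_
  have key := fun Q => exists_fullyAutomized_not_dvd hS hΩ.generated hΩ.aug_prime Q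
    (fun _ => Burnside.locMap p (mark (graph Q.subtype)) Ω)
    (fun ψ hψ => hΩ.stable.mark_graph_eq hψ) (fun _ _ => rfl)
  obtain ⟨R, hPR, hRa, hR⟩ := key P
  refine ⟨R, hPR, hRa, receptive_of_not_dvd hS hΩ.generated fun Q φ hφ hr hdvd => ?_⟩
  rw [hΩ.stable.mark_graph_eq hφ] at hdvd
  obtain ⟨R', hQR', -, hR'⟩ := key Q
  have hPR' : F.Conj P R' := hPR.trans ((conj_iff.2 ⟨φ, hφ, hr⟩).symm.trans hQR')
  obtain ⟨ψ, hψ, hr'⟩ := conj_iff.1 hPR'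
  -- `|C_S(R')|` divides the mark at `P`, whose `p`-part is that of `|C_S(R)|`.
  have h1 : ((Nat.card (Subgroup.centralizer (R' : Set S)) : ℕ) : ZLoc p) ∣
      Burnside.locMap p (mark (graph P.subtype)) Ω := by
    rw [← hΩ.stable.mark_graph_eq hψ, ← hr']
    exact hΩ.generated.dvd_mark _ _ fun x _ => card_centralizer_dvd_mark x ψ
  obtain ⟨a, ha⟩ := IsPGroup.iff_card.1 (hS.to_subgroup (Subgroup.centralizer (R : Set S)))
  obtain ⟨b, hb⟩ := IsPGroup.iff_card.1 (hS.to_subgroup (Subgroup.centralizer (R' : Set S)))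
  rw [ha, ← pow_succ] at hR hdvd
  rw [hb] at h1 hR'
  rw [← pow_succ] at hR'
  have hba : b ≤ a := by
    by_contra! hlt
    exact hR ((Nat.cast_dvd_cast (pow_dvd_pow p hlt)).trans h1)
  exact hR' ((Nat.cast_dvd_cast (pow_dvd_pow p (Nat.succ_le_succ hba))).trans hdvd)

end FusionSystem

/-! ### A characteristic element from saturation -/

theorem ZLoc.natCast_dvd_natCast {p : ℕ} [Fact p.Prime] {m : ℕ}
    (h : (p : ZLoc p) ∣ (m : ZLoc p)) : p ∣ m := by
  obtain ⟨q, hq⟩ := h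
  have hp : p.Prime := Fact.out
  have h1 : (m : ℚ) = p * (q : ℚ) := by exact_mod_cast congrArg Subtype.val hq
  have h2 : ((m * (q : ℚ).den : ℤ) : ℚ) = ((p * (q : ℚ).num : ℤ) : ℚ) := by
    push_cast
    rw [h1, mul_assoc, Rat.mul_den_eq_num]
  have h3 : (p : ℤ) ∣ ((m * (q : ℚ).den : ℕ) : ℤ) := by
    push_cast
    exact ⟨(q : ℚ).num, by exact_mod_cast h2⟩
  rw [Int.natCast_dvd_natCast, hp.dvd_mul] at h3
  exact h3.resolve_right q.2

namespace FusionSystem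

open Biset BisetClass

variable {S : Type u} [Group S] {F : FusionSystem S}

theorem mark_conj (a : S × S) (Γ : Subgroup (S × S)) (x : BisetClass S S) :
    mark (MulAut.conj a • Γ) x = mark Γ x := by
  induction x using Quotient.inductionOn with | h X => ?_
  exact MulAction.card_fixedPoints_conj (X := X.carrier) Γ a

theorem card_conj_smul (a : S × S) (Γ : Subgroup (S × S)) :
    Nat.card (MulAut.conj a • Γ : Subgroup (S × S)) = Nat.card Γ :=
  (Nat.card_congr (Subgroup.equivSMul (MulAut.conj a) Γ).toEquiv).symm

variable (F) in
/-- The marks of `x` at `F`-twisted diagonals of order at least `n` depend only on the `F`-class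
of the second projection. -/
def StableFrom (n : ℕ) (x : BisetClass S S) : Prop :=
  ∀ Γ₁ Γ₂ : Subgroup (S × S), F.Diag Γ₁ → F.Diag Γ₂ → n ≤ Nat.card Γ₁ →
    F.Conj (Γ₁.map (MonoidHom.snd S S)) (Γ₂.map (MonoidHom.snd S S)) → mark Γ₁ x = mark Γ₂ x

/-- If the marks depend only on the second projection up to `F`-conjugacy, they do not change when
the two coordinates of a subgroup of `S × S` are changed by morphisms of `F`. This gives right
stability and left stability. -/
theorem StableFrom.mark_map_eq {x : BisetClass S S} (hx : F.HasDiagStabilizers x)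
    (hst : F.StableFrom 0 x) {T : Type*} [Group T] {a₁ a₂ b₁ b₂ : T →* S}
    (ha : F.Related a₁ a₂) (hb : F.Related b₁ b₂) (Γ : Subgroup T) :
    mark (Γ.map (b₁.prod a₁)) x = mark (Γ.map (b₂.prod a₂)) x := by
  by_cases h : F.Diag (Γ.map (b₁.prod a₁))
  · exact hst _ _ h (Diag.map ha hb h) (Nat.zero_le _) (ha.conj_map_snd Γ)
  · have h' : ¬ F.Diag (Γ.map (b₂.prod a₂)) := fun h' => h (Diag.map ha.symm hb.symm h')
    rw [not_imp_comm.1 (hx _) h, not_imp_comm.1 (hx _) h']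

variable [Finite S]

variable (F) in
/-- The monoid of classes of disjoint unions of bisets `[T, φ]` with `φ` in `F`. -/
def diagClasses : AddSubmonoid (BisetClass S S) :=
  AddSubmonoid.closure
    {x | ∃ (T : Subgroup S) (φ : T →* S), φ ∈ F.HomS T ∧ x = BisetClass.mk (basic T φ)}

theorem mk_basic_mem_diagClasses {T : Subgroup S} {φ : T →* S} (hφ : φ ∈ F.HomS T) :
    BisetClass.mk (basic T φ) ∈ F.diagClasses :=
  AddSubmonoid.subset_closure ⟨T, φ, hφ, rfl⟩

theorem hasDiagStabilizers_of_mem {x : BisetClass S S} (hx : x ∈ F.diagClasses) :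
    F.HasDiagStabilizers x := by
  induction hx using AddSubmonoid.closure_induction with
  | mem x hx =>
    obtain ⟨T, φ, hφ, rfl⟩ := hx
    exact hasDiagStabilizers_basic hφ
  | zero => exact fun Γ h => absurd (map_zero _) h
  | add x y _ _ hx hy =>
    intro Γ h
    rw [map_add] at h
    by_cases h' : mark Γ x = 0
    · exact hy Γ (by simpa [h'] using h)
    · exact hx Γ h'

/-- The mark of `[P, φ]` at the graph of `φ` is the index of the graph in its normalizer. -/
theorem mark_basic_self_mul_card {P : Subgroup S} (φ : P →* S) :
    mark (graph φ) (BisetClass.mk (basic P φ)) * Nat.card P =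
      Nat.card (Subgroup.normalizer (graph φ : Set (S × S))) := by
  have := MulAction.card_fixedPoints_stabilizer_mul (G := S × S) (basicPoint P φ)
  rw [stabilizer_basic, card_graph] at this
  exact this

/-- Adding copies of bisets `[P, φ]` with `|P| = n` turns the marks at the `F`-twisted diagonals of
order `n` into any prescribed conjugation-invariant values that are not smaller and congruent to
them modulo the marks of the `[P, φ]` at their own graphs, and leaves the marks at larger subgroups
unchanged. At subgroups of order at least `n`, the marks of `[P, φ]` are
zero outside the conjugacy class of its own graph. The induction is on the number of subgroups
where the mark is not yet correct. -/
theorem exists_mark_eq (n : ℕ) (M : Subgroup (S × S) → ℕ)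
    (hM : ∀ (a : S × S) (Γ : Subgroup (S × S)), M (MulAut.conj a • Γ) = M Γ) (k : ℕ) :
    ∀ x ∈ F.diagClasses, {Γ | F.Diag Γ ∧ Nat.card Γ = n ∧ mark Γ x ≠ M Γ}.ncard = k →
      (∀ Γ, F.Diag Γ → Nat.card Γ = n → mark Γ x ≤ M Γ) →
      (∀ (P : Subgroup S) (φ : P →* S), φ ∈ F.HomS P → Nat.card P = n →
        mark (graph φ) (BisetClass.mk (basic P φ)) ∣ M (graph φ) - mark (graph φ) x) →
      ∃ y ∈ F.diagClasses, (∀ Γ, F.Diag Γ → Nat.card Γ = n → mark Γ y = M Γ) ∧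
        ∀ Γ : Subgroup (S × S), n < Nat.card Γ → mark Γ y = mark Γ x := by
  induction k using Nat.strong_induction_on with
  | _ k ih =>
  intro x hx hk hle hdvd
  rcases Set.eq_empty_or_nonempty {Γ | F.Diag Γ ∧ Nat.card Γ = n ∧ mark Γ x ≠ M Γ} with he | hne
  · refine ⟨x, hx, fun Γ h1 h2 => ?_, fun _ _ => rfl⟩
    by_contra h3
    exact Set.eq_empty_iff_forall_notMem.1 he Γ ⟨h1, h2, h3⟩
  obtain ⟨Γ₀, hD₀, hc₀, hm₀⟩ := hne
  obtain ⟨P₀, hP₀⟩ : ∃ P, Γ₀.map (MonoidHom.snd S S) = P := ⟨_, rfl⟩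
  obtain ⟨φ₀, hφ₀, hΓ₀⟩ := hD₀.exists_eq_graph hP₀
  have hP₀n : Nat.card P₀ = n := by rw [← hP₀, hD₀.card_eq, hc₀]
  set b := BisetClass.mk (basic P₀ φ₀) with hb
  obtain ⟨c, hc⟩ := hdvd P₀ φ₀ hφ₀ hP₀n
  rw [← hΓ₀] at hc
  have hadd : ∀ Γ : Subgroup (S × S), mark Γ (x + c • b) = mark Γ x + c * mark Γ b := fun Γ => by
    rw [map_add, map_nsmul, smul_eq_mul]
  have h₀ : mark Γ₀ (x + c • b) = M Γ₀ := by
    have := hle Γ₀ hD₀ hc₀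
    rw [hadd, mul_comm c, ← hc]
    omega
  have hb0 : ∀ Γ : Subgroup (S × S), n ≤ Nat.card Γ → mark Γ b ≠ 0 →
      ∃ a : S × S, Γ = MulAut.conj a • Γ₀ := by
    intro Γ hn h
    obtain ⟨a, ha⟩ := exists_le_conj_graph_of_mark_basic_ne_zero h
    rw [← hΓ₀] at ha
    exact ⟨a, Subgroup.eq_of_le_of_card_ge ha (by rw [card_conj_smul, hc₀]; exact hn)⟩
  have hcases : ∀ Γ : Subgroup (S × S), Nat.card Γ = n →
      mark Γ (x + c • b) = mark Γ x ∨ mark Γ (x + c • b) = M Γ := by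
    intro Γ hn
    by_cases h : mark Γ b = 0
    · left; rw [hadd, h, mul_zero, add_zero]
    · right
      obtain ⟨a, rfl⟩ := hb0 Γ hn.ge h
      rw [mark_conj, hM, h₀]
  have hlt : {Γ | F.Diag Γ ∧ Nat.card Γ = n ∧ mark Γ (x + c • b) ≠ M Γ}.ncard < k := by
    rw [← hk]
    refine Set.ncard_lt_ncard ⟨?_, fun hsub => (hsub ⟨hD₀, hc₀, hm₀⟩).2.2 h₀⟩ (Set.toFinite _)
    rintro Γ ⟨h1, h2, h3⟩
    refine ⟨h1, h2, fun h4 => h3 ?_⟩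
    rcases hcases Γ h2 with h | h
    · rw [h, h4]
    · exact h
  have hle' : ∀ Γ, F.Diag Γ → Nat.card Γ = n → mark Γ (x + c • b) ≤ M Γ := by
    intro Γ h1 h2
    rcases hcases Γ h2 with h | h
    · rw [h]; exact hle Γ h1 h2
    · exact h.le
  obtain ⟨y, hy, hy1, hy2⟩ := ih _ hlt (x + c • b)
    (add_mem hx (nsmul_mem (mk_basic_mem_diagClasses hφ₀) c)) rfl hle' (by
      intro P φ hφ hP
      rcases hcases (graph φ) ((card_graph φ).trans hP) with h | h
      · rw [h]; exact hdvd P φ hφ hP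
      · rw [h, Nat.sub_self]; exact dvd_zero _)
  refine ⟨y, hy, hy1, fun Γ hΓ => ?_⟩
  rw [hy2 Γ hΓ, hadd]
  by_cases h : mark Γ b = 0
  · rw [h, mul_zero, add_zero]
  · obtain ⟨a, rfl⟩ := hb0 Γ hΓ.le h
    rw [card_conj_smul] at hΓ
    omega

variable {p : ℕ} [Fact p.Prime]

/-- The congruence behind the construction. Let `P` be fully normalized, `e : P' → P` an isomorphism
in `F` that carries `Aut_S(P')` into `Aut_S(P)`, and `N` the normalizer of the graph of
`φ : P' → S`. By saturation `e` extends to `N_S(P')`, and `e ∘ φ⁻¹` to the first projection of `N`.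
The two extensions define a homomorphism `N → S × S` that carries the graph of `φ` to the diagonal
of `P`. If the marks at larger subgroups are stable, they do not distinguish this homomorphism from
the inclusion of `N`, and Burnside congruences apply. -/
theorem IsSaturated.mark_congr (hS : IsPGroup p S) (hF : F.IsSaturated p) {n : ℕ}
    {x : BisetClass S S} (hx : F.HasDiagStabilizers x) (hst : F.StableFrom (n + 1) x)
    {P P' : Subgroup S} (hP : F.FullyNormalized P) (hPP' : F.Conj P' P) (hn : Nat.card P' = n)
    {φ : P' →* S} (hφ : φ ∈ F.HomS P') :
    (mark (graph φ) (BisetClass.mk (basic P' φ)) : ℤ) ∣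
      mark (graph φ) x - mark (graph P.subtype) x := by
  obtain ⟨hPC, hPA⟩ := hF.sylow P hP
  obtain ⟨e, he, hea⟩ := (fullyAutomized_of_sylow hPA).exists_isIso hS hPP'
  have hφi := F.HomS_injective hφ
  -- The isomorphism `α₀ : P' → P` and its transport `β₀ : φ(P') → P`.
  set α₀ : P' →* S := P.subtype.comp e.toMonoidHom with hα₀
  let e' : φ.range ≃* P := (MonoidHom.ofInjective hφi).symm.trans e
  set β₀ : φ.range →* S := P.subtype.comp e'.toMonoidHom with hβ₀
  have hβφ : ∀ u : P', β₀ ⟨φ u, u, rfl⟩ = α₀ u := fun u => by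
    have : (⟨φ u, u, rfl⟩ : φ.range) = MonoidHom.ofInjective hφi u := rfl
    rw [this]
    simp [hβ₀, hα₀, e']
  have hα₀F : F.Related P'.subtype α₀ := he
  have hβ₀F : F.Related φ.range.subtype β₀ := by
    have h1 : F.Related φ (β₀.comp φ.rangeRestrict) := by
      have : β₀.comp φ.rangeRestrict = α₀ := by ext u; exact hβφ u
      rw [this]
      exact (mem_HomS_iff.1 hφ).symm.trans hα₀F
    exact Related.of_comp φ.rangeRestrict_surjective h1
  obtain ⟨a, ha, haα⟩ := hF.extend P' α₀ (mem_HomS_iff.2 hα₀F)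
    (by rw [hα₀, range_subtype_comp_toMonoidHom]; exact hPC)
  obtain ⟨b, hb, hbβ⟩ := hF.extend φ.range β₀ (mem_HomS_iff.2 hβ₀F)
    (by rw [hβ₀, range_subtype_comp_toMonoidHom]; exact hPC)
  set N := Subgroup.normalizer (graph φ : Set (S × S)) with hN
  have hNa : ∀ w : N, (w : S × S).2 ∈ extender α₀ := by
    rintro ⟨⟨y, z⟩, h⟩
    exact normalizer_le_extender hea (mem_normalizer_graph_iff.1 h).1
  have hNb : ∀ w : N, (w : S × S).1 ∈ extender β₀ := by
    rintro ⟨⟨y, z⟩, h⟩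
    obtain ⟨hz, hyz⟩ := mem_normalizer_graph_iff.1 h
    obtain ⟨_, t, ht, hzt⟩ := normalizer_le_extender hea hz
    have hy : y ∈ Subgroup.normalizer (φ.range : Set S) := by
      have := Subgroup.le_normalizer_map (H := graph φ) (MonoidHom.fst S S) ⟨_, h, rfl⟩
      rwa [map_fst_graph] at this
    refine ⟨hy, t, ?_, ?_⟩
    · rw [hβ₀, range_subtype_comp_toMonoidHom]
      rwa [range_subtype_comp_toMonoidHom] at ht
    · rintro ⟨_, u, rfl⟩
      have h1 : (⟨y * φ u * y⁻¹, (Subgroup.mem_normalizer_iff.1 hy _).1 ⟨u, rfl⟩⟩ : φ.range) =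
          ⟨φ ⟨z * u * z⁻¹, (Subgroup.mem_normalizer_iff.1 hz u).1 u.2⟩, _, rfl⟩ :=
        Subtype.ext (hyz u).symm
      change β₀ ⟨y * φ u * y⁻¹, _⟩ = t * β₀ ⟨φ u, _⟩ * t⁻¹
      rw [h1, hβφ, hβφ]
      exact hzt u
  let a₁ : N →* S := (MonoidHom.snd S S).comp N.subtype
  let b₁ : N →* S := (MonoidHom.fst S S).comp N.subtype
  let a₂ : N →* S := a.comp (a₁.codRestrict (extender α₀) hNa)
  let b₂ : N →* S := b.comp (b₁.codRestrict (extender β₀) hNb)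
  have haF : F.Related a₁ a₂ := (mem_HomS_iff.1 ha).comp (a₁.codRestrict (extender α₀) hNa)
  have hbF : F.Related b₁ b₂ := (mem_HomS_iff.1 hb).comp (b₁.codRestrict (extender β₀) hNb)
  have hθ₁ : b₁.prod a₁ = N.subtype := rfl
  set D : Subgroup N := (graph φ).subgroupOf N with hD
  have hDn : D.Normal := Subgroup.normal_in_normalizer
  have hDcard : Nat.card D = n := by
    rw [hD, Nat.card_congr (Subgroup.subgroupOfEquivOfLe Subgroup.le_normalizer).toEquiv,
      card_graph, hn]
  have hidx : D.index = mark (graph φ) (BisetClass.mk (basic P' φ)) := by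
    have h1 := D.card_mul_index
    have h2 := mark_basic_self_mul_card φ
    rw [hDcard] at h1
    rw [hn, mul_comm] at h2
    exact Nat.eq_of_mul_eq_mul_left (hn ▸ Nat.card_pos) (h1.trans h2.symm)
  have hD₁ : D.map (b₁.prod a₁) = graph φ := by
    rw [hθ₁, hD, Subgroup.subgroupOf_map_subtype, inf_eq_left]
    exact Subgroup.le_normalizer
  have hau : ∀ (u : P') (hu : (u : S) ∈ extender α₀), a ⟨u, hu⟩ = e u := fun u _ =>
    DFunLike.congr_fun haα u
  have hbu : ∀ (u : P') (hu : φ u ∈ extender β₀), b ⟨φ u, hu⟩ = e u := fun u _ =>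
    (DFunLike.congr_fun hbβ ⟨φ u, u, rfl⟩).trans (hβφ u)
  have hD₂ : D.map (b₂.prod a₂) = graph P.subtype := by
    ext ⟨s, t⟩
    rw [mk_mem_graph]
    constructor
    · rintro ⟨⟨⟨y, z⟩, hw⟩, hwD, hst⟩
      obtain ⟨hz, rfl⟩ := mk_mem_graph.1 (show (y, z) ∈ graph φ from hwD)
      obtain ⟨rfl, rfl⟩ := Prod.ext_iff.1 hst
      have h1 : a₂ ⟨(φ ⟨z, hz⟩, z), hw⟩ = e ⟨z, hz⟩ := hau ⟨z, hz⟩ _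
      have h2 : b₂ ⟨(φ ⟨z, hz⟩, z), hw⟩ = e ⟨z, hz⟩ := hbu ⟨z, hz⟩ _
      refine ⟨?_, h1.trans h2.symm⟩
      change a₂ _ ∈ P
      rw [h1]
      exact (e _).2
    · rintro ⟨ht, rfl⟩
      obtain ⟨u, hu⟩ := e.surjective ⟨t, ht⟩
      have hmem : (φ u, (u : S)) ∈ graph φ := mem_graph.2 ⟨u, rfl, rfl⟩
      have hut : (e u : S) = t := congrArg Subtype.val hu
      refine ⟨⟨(φ u, u), Subgroup.le_normalizer hmem⟩, Subgroup.mem_subgroupOf.2 hmem, ?_⟩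
      exact Prod.ext ((hbu u _).trans hut) ((hau u _).trans hut)
  rw [← hidx, ← hD₁, ← hD₂]
  induction x using Quotient.inductionOn with | h X => ?_
  refine MulAction.index_dvd_card_fixedPoints_sub (X := X.carrier) D (b₁.prod a₁) (b₂.prod a₂)
    fun w hw => ?_
  change mark _ (BisetClass.mk X) = mark _ (BisetClass.mk X)
  set K := D ⊔ Subgroup.zpowers w
  by_cases hK : F.Diag (K.map (b₁.prod a₁))
  · refine hst _ _ hK (Diag.map haF hbF hK) ?_ (haF.conj_map_snd K)
    rw [hθ₁, ← Nat.card_congr (K.equivMapOfInjective _ N.subtype_injective).toEquiv, ← hDcard]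
    refine Nat.succ_le_of_lt (lt_of_not_ge fun hge => hw ?_)
    have h1 : D = K := Subgroup.eq_of_le_of_card_ge le_sup_left hge
    rw [h1]
    exact Subgroup.mem_sup_right (Subgroup.mem_zpowers w)
  · have hK' : ¬ F.Diag (K.map (b₂.prod a₂)) := fun h => hK (Diag.map haF.symm hbF.symm h)
    exact (not_imp_comm.1 (hx _) hK).trans (not_imp_comm.1 (hx _) hK').symm

theorem exists_fullyNormalized (P : Subgroup S) : ∃ R, F.Conj P R ∧ F.FullyNormalized R := by
  obtain ⟨R, hR, hmax⟩ := Set.exists_max_image {R | F.Conj P R}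
    (fun R => Nat.card (Subgroup.normalizer (R : Set S))) (Set.toFinite _) ⟨P, F.conj_refl P⟩
  exact ⟨R, hR, fun Q hQ => hmax Q (hR.trans hQ)⟩

/-- One step of the construction. The new value of the marks at the `F`-twisted diagonals of order
`n` over the `F`-conjugacy class of `P` is the old value at the diagonal of a fully normalized
representative, plus a constant `B`. -/
theorem IsSaturated.exists_stableFrom (hS : IsPGroup p S) (hF : F.IsSaturated p) {n : ℕ}
    {x : BisetClass S S} (hx : x ∈ F.diagClasses) (hst : F.StableFrom (n + 1) x) :
    ∃ y ∈ F.diagClasses, F.StableFrom n y ∧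
      ∀ Γ : Subgroup (S × S), n < Nat.card Γ → mark Γ y = mark Γ x := by
  classical
  have := Fintype.ofFinite (Subgroup (S × S))
  -- A fully normalized representative, the same for all members of a class.
  let r : Subgroup S → Subgroup S := fun P =>
    Classical.epsilon fun R => F.Conj P R ∧ F.FullyNormalized R
  have hr : ∀ P, F.Conj P (r P) ∧ F.FullyNormalized (r P) := fun P =>
    Classical.epsilon_spec (exists_fullyNormalized P)
  have hrc : ∀ P Q, F.Conj P Q → r P = r Q := fun P Q h => by
    have : (fun R => F.Conj P R ∧ F.FullyNormalized R) =
        fun R => F.Conj Q R ∧ F.FullyNormalized R := by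
      ext R
      exact and_congr_left fun _ => ⟨fun h' => h.symm.trans h', fun h' => h.trans h'⟩
    simp only [r, this]
  -- `B` is at least every mark of `x`, and divisible by the order of `S × S`, so by all the marks
  -- `mark_basic_self_mul_card`.
  set B : ℕ := Nat.card (S × S) * ∑ Γ : Subgroup (S × S), mark Γ x with hB
  let d : Subgroup S → ℕ := fun R => mark (graph R.subtype) x
  let M : Subgroup (S × S) → ℕ := fun Γ => d (r (Γ.map (MonoidHom.snd S S))) + B
  have hMc : ∀ Γ₁ Γ₂ : Subgroup (S × S),
      F.Conj (Γ₁.map (MonoidHom.snd S S)) (Γ₂.map (MonoidHom.snd S S)) → M Γ₁ = M Γ₂ :=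
    fun Γ₁ Γ₂ h => by simp only [M, hrc _ _ h]
  have hle : ∀ Γ, mark Γ x ≤ M Γ := fun Γ =>
    calc mark Γ x ≤ ∑ Γ : Subgroup (S × S), mark Γ x :=
          Finset.single_le_sum (f := fun Γ => mark Γ x) (fun _ _ => Nat.zero_le _)
            (Finset.mem_univ Γ)
      _ ≤ B := Nat.le_mul_of_pos_left _ Nat.card_pos
      _ ≤ M Γ := Nat.le_add_left _ _
  obtain ⟨y, hy, hy1, hy2⟩ := exists_mark_eq (F := F) n M
    (fun a Γ => (hMc _ _ (F.conj_map_snd_smul a Γ)).symm) _ x hx rfl (fun Γ _ _ => hle Γ) (by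
      intro P φ hφ hP
      zify [hle (graph φ)]
      have h1 := hF.mark_congr hS (hasDiagStabilizers_of_mem hx) hst (hr P).2 (hr P).1 hP hφ
      have h2 : (mark (graph φ) (BisetClass.mk (basic P φ)) : ℤ) ∣ B := by
        rw [Int.natCast_dvd_natCast, hB]
        refine Dvd.dvd.mul_right (Dvd.dvd.trans ?_
          (Subgroup.card_subgroup_dvd_card (Subgroup.normalizer (graph φ : Set (S × S))))) _
        exact Dvd.intro _ (mark_basic_self_mul_card φ)
      have hMφ : M (graph φ) = d (r P) + B := by simp only [M, map_snd_graph]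
      rw [hMφ]
      push_cast
      have h3 := dvd_sub h2 h1
      have h4 : (d (r P) : ℤ) + B - mark (graph φ) x =
          B - (mark (graph φ) x - mark (graph (r P).subtype) x) := by
        simp only [d]; ring
      rw [h4]
      exact h3)
  refine ⟨y, hy, fun Γ₁ Γ₂ h₁ h₂ hn hc => ?_, hy2⟩
  have hcard : Nat.card Γ₁ = Nat.card Γ₂ := by rw [← h₁.card_eq, ← h₂.card_eq, hc.card_eq]
  rcases hn.eq_or_lt with h | h
  · rw [hy1 _ h₁ h.symm, hy1 _ h₂ (hcard.symm.trans h.symm), hMc _ _ hc]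
  · rw [hy2 _ h, hy2 _ (hcard ▸ h)]
    exact hst _ _ h₁ h₂ h hc

theorem Diag.card_le {Γ : Subgroup (S × S)} (h : F.Diag Γ) : Nat.card Γ ≤ Nat.card S :=
  h.card_eq ▸ Subgroup.card_le_card_group _

/-- The start of the construction: the union of the `[S, φ]` over representatives `φ` of the outer
automorphisms of `S` in `F`, whose marks are `|Z(S)|` at the graphs of automorphisms. -/
theorem exists_stableFrom_card : ∃ x ∈ F.diagClasses, F.StableFrom (Nat.card S) x ∧
    ∀ Γ, F.Diag Γ → Nat.card Γ = Nat.card S →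
      mark Γ x = Nat.card (Subgroup.centralizer ((⊤ : Subgroup S) : Set S)) := by
  obtain ⟨x, hx, hx1, -⟩ := exists_mark_eq (F := F) (Nat.card S)
    (fun _ => Nat.card (Subgroup.centralizer ((⊤ : Subgroup S) : Set S))) (fun _ _ => rfl) _ 0
    (zero_mem _) rfl (fun Γ _ _ => by simp) (by
      intro P φ hφ hP
      have hPt : P = ⊤ := Subgroup.eq_top_of_card_eq P hP
      have hr : φ.range = ⊤ := Subgroup.eq_top_of_card_eq _
        ((conj_iff.2 ⟨φ, hφ, rfl⟩ : F.Conj P φ.range).card_eq.symm.trans hP)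
      have h1 := mark_basic_self_mul_card φ
      have he : extender φ = ⊤ := top_le_iff.1 (hPt ▸ le_extender φ)
      rw [card_normalizer_graph, map_snd_normalizer_graph, he, hr, Subgroup.card_top, hP] at h1
      rw [map_zero, Nat.sub_zero, Nat.eq_of_mul_eq_mul_right Nat.card_pos h1])
  refine ⟨x, hx, fun Γ₁ Γ₂ h₁ h₂ hn hc => ?_, hx1⟩
  rw [hx1 _ h₁ (h₁.card_le.antisymm hn), hx1 _ h₂ ?_]
  rw [← h₂.card_eq, ← hc.card_eq, h₁.card_eq]
  exact h₁.card_le.antisymm hn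

/-- Downward induction on the order, from `|S|` to `0`. -/
theorem IsSaturated.exists_stable (hS : IsPGroup p S) (hF : F.IsSaturated p) :
    ∃ x ∈ F.diagClasses, F.StableFrom 0 x ∧ ∀ Γ, F.Diag Γ → Nat.card Γ = Nat.card S →
      mark Γ x = Nat.card (Subgroup.centralizer ((⊤ : Subgroup S) : Set S)) := by
  have key : ∀ k ≤ Nat.card S, ∃ x ∈ F.diagClasses, F.StableFrom (Nat.card S - k) x ∧
      ∀ Γ, F.Diag Γ → Nat.card Γ = Nat.card S →
        mark Γ x = Nat.card (Subgroup.centralizer ((⊤ : Subgroup S) : Set S)) := by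
    intro k
    induction k with
    | zero => exact fun _ => exists_stableFrom_card
    | succ k ih =>
      intro hk
      obtain ⟨x, hx, hst, htop⟩ := ih (by omega)
      rw [show Nat.card S - k = Nat.card S - (k + 1) + 1 by omega] at hst
      obtain ⟨y, hy, hsty, hyx⟩ := hF.exists_stableFrom hS hx hst
      exact ⟨y, hy, hsty, fun Γ hΓ hc => by rw [hyx Γ (by omega), htop Γ hΓ hc]⟩
  simpa using key (Nat.card S) le_rfl

/-- With marks `|Z(S)|` at the graphs of automorphisms in `F`, `|S| ε(Ω)` is congruent to
`|Z(S)| |Aut_F(S)| = |S| |Aut_F(S) : Aut_S(S)|` modulo `p |S|`, and the last index is prime to `p`.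
-/
theorem not_dvd_aug_of_mark_eq (hS : IsPGroup p S) (hF : F.IsSaturated p) {Ω : BurnsideLoc p S S}
    (hΩ : F.IsGenerated p Ω)
    (htop : ∀ Γ, F.Diag Γ → Nat.card Γ = Nat.card S → Burnside.locMap p (mark Γ) Ω =
      (Nat.card (Subgroup.centralizer ((⊤ : Subgroup S) : Set S)) : ZLoc p)) :
    ¬ (p : ZLoc p) ∣ Burnside.aug p Ω := by
  classical
  rintro ⟨l, hl⟩
  have : Finite ((⊤ : Subgroup S) →* S) := DFunLike.finite _
  have := Fintype.ofFinite ((⊤ : Subgroup S) →* S)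
  obtain ⟨k, hk⟩ := exists_card_mul_aug_eq hS hΩ ⊤
  have hfn : F.FullyNormalized ⊤ := fun Q hQ => by
    rw [Subgroup.eq_top_of_card_eq Q (hQ.card_eq.symm.trans Subgroup.card_top)]
  have hA := fullyAutomized_of_sylow (hF.sylow ⊤ hfn).2
  have h0 : ∀ ψ : (⊤ : Subgroup S) →* S, Burnside.locMap p (mark (graph ψ)) Ω =
      if ψ ∈ F.HomS ⊤ ∧ ψ.range = ⊤ then
        (Nat.card (Subgroup.centralizer ((⊤ : Subgroup S) : Set S)) : ZLoc p) else 0 := fun ψ => by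
    split_ifs with h
    · exact htop _ (diag_graph_iff.2 h.1) ((card_graph ψ).trans Subgroup.card_top)
    · have := hΩ.dvd_mark (graph ψ) 0 fun x hx => by
        rw [zero_dvd_iff]
        by_contra hne
        have h1 := diag_graph_iff.1 (hx _ hne)
        exact h ⟨h1, Subgroup.eq_top_of_card_eq _
          ((conj_iff.2 ⟨ψ, h1, rfl⟩ : F.Conj ⊤ ψ.range).card_eq.symm.trans Subgroup.card_top)⟩
      simpa using this
  have h1 := card_normalizer_eq (⊤ : Subgroup S)
  rw [Subgroup.normalizer_eq_top, Subgroup.card_top] at h1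
  rw [Finset.sum_congr rfl fun ψ _ => h0 ψ, ← Finset.sum_filter, Finset.sum_const, nsmul_eq_mul,
    card_filter_range_eq ⊤ ⊤ (F.conj_refl ⊤), hl, ← card_autS_mul_relIndex (F := F) ⊤, h1] at hk
  refine hA (ZLoc.natCast_dvd_natCast ⟨l - k, ?_⟩)
  have hC : (Nat.card (Subgroup.centralizer ((⊤ : Subgroup S) : Set S)) : ZLoc p) ≠ 0 := by
    exact_mod_cast Nat.card_pos.ne'
  have hB : (Nat.card (autS (⊤ : Subgroup S)) : ZLoc p) ≠ 0 := by
    exact_mod_cast Nat.card_pos.ne'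
  apply mul_left_cancel₀ (mul_ne_zero hC hB)
  push_cast at hk
  linear_combination -hk

theorem exists_isCharacteristic (hS : IsPGroup p S) (hF : F.IsSaturated p) :
    ∃ Ω : BurnsideLoc p S S, F.IsCharacteristic p Ω := by
  obtain ⟨x, hx, hst, htop⟩ := hF.exists_stable hS
  have hxD := hasDiagStabilizers_of_mem hx
  have hgen : F.IsGenerated p (1 ⊗ₜ Algebra.GrothendieckAddGroup.of x) := by
    clear hst htop hxD
    induction hx using AddSubmonoid.closure_induction with
    | mem x hx =>
      obtain ⟨T, φ, hφ, rfl⟩ := hx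
      exact Submodule.subset_span ⟨T, φ, hφ, rfl⟩
    | zero => rw [map_zero, TensorProduct.tmul_zero]; exact Submodule.zero_mem _
    | add x y _ _ hx hy => rw [map_add, TensorProduct.tmul_add]; exact Submodule.add_mem _ hx hy
  refine ⟨1 ⊗ₜ Algebra.GrothendieckAddGroup.of x, hgen, fun P φ hφ => ?_, fun P φ hφ => ?_, ?_⟩
  · rw [Burnside.ofHom, Burnside.ofHom, Burnside.basis, Burnside.basis, Burnside.comp_tmul_of,
      Burnside.comp_tmul_of]
    refine congrArg (fun z => (1 * 1 : ZLoc p) ⊗ₜ[ℤ] Algebra.GrothendieckAddGroup.of z) ?_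
    refine ext_mark fun Γ => ?_
    rw [mark_comp_basic_top, mark_comp_basic_top]
    exact (hst.mark_map_eq hxD ((mem_HomS_iff.1 hφ).comp (MonoidHom.snd S P))
      (F.related_refl (MonoidHom.fst S P)) Γ).symm
  · rw [Burnside.basis, Burnside.basis, Burnside.comp_tmul_of, Burnside.comp_tmul_of]
    refine congrArg (fun z => (1 * 1 : ZLoc p) ⊗ₜ[ℤ] Algebra.GrothendieckAddGroup.of z) ?_
    refine ext_mark fun Γ => ?_
    rw [mark_basic_comp φ.range (MonoidHom.ofInjective (F.HomS_injective hφ)).symm x φ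
      (F.HomS_injective hφ) (fun l => MonoidHom.apply_ofInjective_symm _ l)]
    refine Eq.trans ?_ (mark_basic_comp P (MulEquiv.refl P) x P.subtype P.subtype_injective
      (fun l => rfl) Γ).symm
    exact (hst.mark_map_eq hxD (F.related_refl (MonoidHom.snd P S))
      ((mem_HomS_iff.1 hφ).comp (MonoidHom.fst P S)) Γ).symm
  · refine not_dvd_aug_of_mark_eq hS hF hgen fun Γ hΓ hc => ?_
    rw [Burnside.locMap_tmul_of, htop Γ hΓ hc, mul_one]

end FusionSystem

theorem theoremA {p : ℕ} [Fact p.Prime] {S : Type*} [Group S] [Finite S] (hS : IsPGroup p S)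
    (F : FusionSystem S) :
    (F.IsSaturated p ↔ ∃ Ω : BurnsideLoc p S S, F.IsCharacteristic p Ω) ∧
    (F.IsSaturated p ↔ ∃ Ω : BurnsideLoc p S S, F.IsRightCharacteristic p Ω) ∧
    (F.IsSaturated p ↔ ∃ Ω : BurnsideLoc p S S, F.IsLeftCharacteristic p Ω) := by
  refine ⟨⟨FusionSystem.exists_isCharacteristic hS, ?_⟩, ⟨fun h => ?_, ?_⟩, ⟨fun h => ?_, ?_⟩⟩
  · rintro ⟨Ω, hΩ⟩
    exact FusionSystem.isSaturated_of_isRightCharacteristic hS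
      ⟨hΩ.generated, hΩ.right_stable, hΩ.aug_prime⟩
  · obtain ⟨Ω, hΩ⟩ := FusionSystem.exists_isCharacteristic hS h
    exact ⟨Ω, hΩ.generated, hΩ.right_stable, hΩ.aug_prime⟩
  · rintro ⟨Ω, hΩ⟩
    exact FusionSystem.isSaturated_of_isRightCharacteristic hS hΩ
  · obtain ⟨Ω, hΩ⟩ := FusionSystem.exists_isCharacteristic hS h
    exact ⟨Ω, hΩ.generated, hΩ.left_stable, hΩ.aug_prime⟩
  · rintro ⟨Ω, hΩ⟩
    exact FusionSystem.isSaturated_of_isLeftCharacteristic hS hΩ
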